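/- **Setting.** Let $\nu$ be a $\sigma$-finite measure on a measurable space $\mathcal X$, let $\mathcal P$ be the set of all probability measures dominated by $\nu$, let $\psi:\mathcal P\to\mathbb R$ and $P_0\in\mathcal P$. A *path* is a family $(P_t)_{t\in\mathbb R}\subset\mathcal P$ with jointly measurable densities $p_t(x)=dP_t/d\nu$. It is *Hellinger differentiable* at $t$ if, for some $\xi_t\in L_2(\nu)$, $\int(\sqrt{p_{t+h}}-\sqrt{p_t}-h\xi_t)^2d\nu=o(h^2)$ as $h\to0$; then $\mathcal I(t)=4\int\xi_t^2d\nu$ is its Fisher information. It is a *QMD path with score $g$* if it passes through $P_0$ at $t=0$, $g\in L_2(P_0)$ and $\int(\sqrt{p_h}-\sqrt{p_0}-\tfrac12hg\sqrt{p_0})^2d\nu=o(h^2)$. Let $L_2^0(P_0)$ be the mean-zero functions in $L_2(P_0)$. Assume that $\psi$ is pathwise differentiable at $P_0$ relative to $L_2^0(P_0)$ with efficient influence function $\dot\psi_0$: $\dot\psi_0\in L_2^0(P_0)$, and $\psi(P_t)-\psi(P_0)-t\int\dot\psi_0\,g\,dP_0=o(t)$ for every $g\in L_2^0(P_0)$ and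 every QMD path with score $g$. For a path, $n\ge1$ and $c>0$ put $\Theta_{n,c}=(-cn^{-1/2},cn^{-1/2})$ and $$R_{n,c}=\inf_T\sup_{t\in\Theta_{n,c}}\mathbb E_{P_t^n}|T(X_1,\dots,X_n)-\psi(P_t)|^2 ,$$ the infimum being over measurable $T:\mathcal X^n\to\mathbb R$. Write $H^2(P,P')=\int(\sqrt{dP}-\sqrt{dP'})^2$, and let $\chi^2(P\|P')$ be $\int(dP/dP'-1)^2dP'$ if $P\ll P'$ and $\infty$ otherwise. For a diffeomorphism $\varphi:\mathbb R\to\Theta_{n,c}$, a probability measure $Q$ on $\mathbb R$ and $h\in\mathbb R$ put $$d\mathbb P_h(x,t)=dP^n_{\varphi(t+h)}(x)\,dQ(t+h),\quad \Delta=\int\{\psi(P_{\varphi(t)})-\psi(P_{\varphi(t-h)})\}dQ(t),\quad B=\int\{\psi(P_{\varphi(t)})-\psi(P_{\varphi(t-h)})\}^2dQ(t).$$ Consider the following lower bounds, with $0/0=0$: * $L^{\rm ac}_{n,c}=\sup_{\phi,Q}\Big[\frac{|\int\phi'dQ|}{\sqrt{\mathcal I(Q)+n\int\mathcal I(t)\,dQ}}-\big(\int|\psi(P_t)-\phi(t)|^2dQ\big)^{1/2}\Big]_+^2$,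 over locally absolutely continuous $\phi$ on $\Theta_{n,c}$ and probability measures $Q$ on $\Theta_{n,c}$ with a locally absolutely continuous Lebesgue density $q$ that tends to $0$ at both end points, with $0<\mathcal I(Q)=\int_{\{q>0\}}q'^2/q<\infty$, with $\phi,\phi'$ $Q$-integrable and $\int\mathcal I(t)\,dQ<\infty$. It is defined when the path is Hellinger differentiable at every point of $\Theta_{n,c}$; otherwise $L^{\rm ac}_{n,c}=0$. * $L^{\chi^2}_{n,c}=\sup_{\varphi,Q,\lambda\in[0,1],h}\Big[\sqrt{(1-\lambda)^2\Delta^2/\chi^2(\mathbb P_h\|\lambda\mathbb P_h+(1-\lambda)\mathbb P_0)}-\sqrt{\lambda B}\Big]_+^2$, where the first square root is read as $0$ if $\lambda=1$. * $L^{H}_{n,c}=\sup_{\varphi,Q,h}\Big[\frac{|\Delta|}{2H(\mathbb P_0,\mathbb P_h)}-\sqrt B\Big]_+^2$. * $L^{\rm 2pt}_{n,c}=\sup_{t_1,t_2\in\Theta_{n,c}}\Big[\frac{1-H^2(P^n_{t_1},P^n_{t_2})}4\Big]_+|\psi(P_{t_1})-\psi(P_{t_2})|^2$. Let $P_{\cdot,g}$,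 $g\in L_2^0(P_0)$, be a choice of one path for each $g$, and write $R_{n,c}(g)$, $L_{n,c}(g)$ for the quantities above along $P_{\cdot,g}$. Say that a bound $L$ *implies the efficiency bound with value $v$* along these paths if $L_{n,c}(g)\le R_{n,c}(g)$ for all $g$, $n\ge1$, $c>0$, and $$\sup_g\liminf_{c\to\infty}\liminf_{n\to\infty}n\,L_{n,c}(g)\ \ge v,\qquad\text{hence also}\qquad \sup_g\liminf_{c\to\infty}\liminf_{n\to\infty}n\,R_{n,c}(g)\ \ge v .$$ **Proposition.** In (i)–(iii) suppose that $t\mapsto\psi(P_{t,g})$ is measurable for every $g$. (i) Let each $P_{\cdot,g}$ be a QMD path with score $g$ that is Hellinger differentiable at all $t$ in a neighbourhood of $0$, with Fisher information continuous at $t=0$. Then $L^{\rm ac}$ implies the efficiency bound with value $\int\dot\psi_0^2\,dP_0$. (ii) Let $\kappa:\mathbb R\to[0,\infty)$ be twice differentiable with $\kappa(0)=\kappa'(0)=1$ and $\kappa',\kappa''$ bounded, and for each $g$ and all $t$ near $0$ let $dP_{t,g}=\kappa(tg)\,dP_0/C_t$, $C_t=\int\kappa(tg)\,dP_0$. Then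 $L^{\chi^2}$ implies the efficiency bound with value $\int\dot\psi_0^2\,dP_0$. (iii) Let each $P_{\cdot,g}$ be a QMD path with score $g$. Then $L^{H}$ implies the efficiency bound with value $\int\dot\psi_0^2\,dP_0$. (iv) Let each $P_{\cdot,g}$ be a QMD path with score $g$. Then $L^{\rm 2pt}$ implies the efficiency bound with value $C\int\dot\psi_0^2\,dP_0$, where $C=\sup_{s\ge0}\{-\tfrac14+\tfrac12e^{-s^2/8}\}s^2\approx0.28953$, and no more: $\sup_g\liminf_{c\to\infty}\liminf_{n\to\infty}n\,L^{\rm 2pt}_{n,c}(g)=C\int\dot\psi_0^2\,dP_0$. -/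

import Mathlib

open MeasureTheory Filter Topology Set
open scoped ENNReal

noncomputable section

namespace SEB

/-! ### Divergences -/

/-- Squared Hellinger distance `∫ (√dμ - √dη)²`, with densities taken with respect to the
dominating measure `μ + η`. -/
def hellingerSq {Ω : Type*} [MeasurableSpace Ω] (μ η : Measure Ω) : ℝ≥0∞ :=
  ∫⁻ x, ENNReal.ofReal
    ((√(μ.rnDeriv (μ + η) x).toReal - √(η.rnDeriv (μ + η) x).toReal) ^ 2) ∂(μ + η)

open Classical in
/-- Chi-squared divergence `χ²(μ ‖ η)`, infinite when `μ` is not dominated by `η`. -/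
def chiSq {Ω : Type*} [MeasurableSpace Ω] (μ η : Measure Ω) : ℝ≥0∞ :=
  if μ ≪ η then ∫⁻ x, ENNReal.ofReal (((μ.rnDeriv η x).toReal - 1) ^ 2) ∂η else ∞

/-! ### Parametric paths -/

/-- A univariate parametric path `t ↦ P_t` of probability measures dominated by `ν`, given by
jointly measurable densities. -/
structure ParamPath {X : Type*} [MeasurableSpace X] (ν : Measure X) where
  dens : ℝ → X → ℝ
  measurable_dens : Measurable fun z : ℝ × X => dens z.1 z.2
  dens_nonneg : ∀ t x, 0 ≤ dens t x
  lintegral_dens : ∀ t, ∫⁻ x, ENNReal.ofReal (dens t x) ∂ν = 1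

variable {X : Type*} [MeasurableSpace X] {ν : Measure X}

/-- The member `P_t` of the path. -/
def ParamPath.law (p : ParamPath ν) (t : ℝ) : ProbabilityMeasure X :=
  ⟨ν.withDensity fun x => ENNReal.ofReal (p.dens t x), ⟨by
    rw [withDensity_apply _ MeasurableSet.univ, Measure.restrict_univ, p.lintegral_dens t]⟩⟩

/-- The law `P_t^n` of `n` i.i.d. observations from `P_t`. -/
def ParamPath.sampleLaw (p : ParamPath ν) (n : ℕ) (t : ℝ) : Measure (Fin n → X) :=
  Measure.pi fun _ => (p.law t : Measure X)

/-- The path is Hellinger differentiable at `t` with derivative `ξ`. -/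
def ParamPath.HasHellingerDerivAt (p : ParamPath ν) (ξ : X → ℝ) (t : ℝ) : Prop :=
  MemLp ξ 2 ν ∧
    (fun h : ℝ => ∫ x, (√(p.dens (t + h) x) - √(p.dens t x) - h * ξ x) ^ 2 ∂ν)
      =o[𝓝 0] fun h : ℝ => h ^ 2

/-- The path is Hellinger differentiable at `t`. -/
def ParamPath.HellingerDifferentiableAt (p : ParamPath ν) (t : ℝ) : Prop :=
  ∃ ξ : X → ℝ, p.HasHellingerDerivAt ξ t

open Classical in
/-- Fisher information `4 ∫ ξ_t² dν`; the Hellinger derivative `ξ_t` is unique up to `ν`-null sets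
(value `0` where the path is not Hellinger differentiable). -/
def ParamPath.fisherInfo (p : ParamPath ν) (t : ℝ) : ℝ :=
  if h : p.HellingerDifferentiableAt t then 4 * ∫ x, (h.choose x) ^ 2 ∂ν else 0

/-- The path is differentiable in quadratic mean at `t` with score `g`. -/
def ParamPath.QMDAt (p : ParamPath ν) (g : X → ℝ) (t : ℝ) : Prop :=
  MemLp g 2 (p.law t : Measure X) ∧
    (fun h : ℝ =>
      ∫ x, (√(p.dens (t + h) x) - √(p.dens t x) - 1 / 2 * (h * g x * √(p.dens t x))) ^ 2 ∂ν)
      =o[𝓝 0] fun h : ℝ => h ^ 2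

/-- The maximal tangent space `L₂⁰(P₀)`: square integrable functions with mean zero. -/
def TangentSpace (P₀ : ProbabilityMeasure X) : Type _ :=
  {g : X → ℝ // MemLp g 2 (P₀ : Measure X) ∧ ∫ x, g x ∂(P₀ : Measure X) = 0}

/-- The path passes through `P₀` at `t = 0` and is differentiable in quadratic mean there with
score `g`. -/
def IsQMDPath (P₀ : ProbabilityMeasure X) (g : X → ℝ) (p : ParamPath ν) : Prop :=
  p.law 0 = P₀ ∧ p.QMDAt g 0

/-- `ψ` is pathwise differentiable at `P₀`, relative to the maximal tangent space, with efficient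
influence function `ψdot`. The tangent space being all of `L₂⁰(P₀)`, the efficient influence
function is the one that belongs to `L₂⁰(P₀)`. -/
def HasEfficientInfluenceFunction (ν : Measure X) (ψ : ProbabilityMeasure X → ℝ)
    (P₀ : ProbabilityMeasure X) (ψdot : X → ℝ) : Prop :=
  MemLp ψdot 2 (P₀ : Measure X) ∧ ∫ x, ψdot x ∂(P₀ : Measure X) = 0 ∧
    ∀ (g : TangentSpace P₀) (p : ParamPath ν), IsQMDPath P₀ g.1 p →
      (fun t : ℝ => ψ (p.law t) - ψ P₀ - t * ∫ x, ψdot x * g.1 x ∂(P₀ : Measure X))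
        =o[𝓝 0] fun t : ℝ => t

/-! ### Local minimax risk -/

/-- The local parameter set `{t : |t| < c n^{-1/2}}`. -/
def localSet (n : ℕ) (c : ℝ) : Set ℝ := Ioo (-(c / √n)) (c / √n)

/-- `inf_T sup_{|t| < c n^{-1/2}} E_{P_t^n} |T(X) - ψ(P_t)|²`. -/
def localMinimaxRisk (ψ : ProbabilityMeasure X → ℝ) (p : ParamPath ν) (n : ℕ) (c : ℝ) : ℝ≥0∞ :=
  ⨅ (T : (Fin n → X) → ℝ) (_ : Measurable T), ⨆ t ∈ localSet n c,
    ∫⁻ x, ENNReal.ofReal ((T x - ψ (p.law t)) ^ 2) ∂(p.sampleLaw n t)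

/-- `sup_g liminf_{c → ∞} liminf_{n → ∞} n · R(P_{·,g}, n, c)`. -/
def asymptoticValue {P₀ : ProbabilityMeasure X} (P : TangentSpace P₀ → ParamPath ν)
    (R : ParamPath ν → ℕ → ℝ → ℝ≥0∞) : ℝ≥0∞ :=
  ⨆ g : TangentSpace P₀,
    liminf (fun c : ℝ => liminf (fun n : ℕ => (n : ℝ≥0∞) * R (P g) n c) atTop) atTop

/-! ### The lower bound by approximating functionals -/

/-- Absolute continuity on every compact subinterval of `(a, b)`. -/
def LocallyAC (f : ℝ → ℝ) (a b : ℝ) : Prop :=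
  ∀ x y, a < x → x ≤ y → y < b → AbsolutelyContinuousOnInterval f x y

/-- The measure on `(a, b)` with Lebesgue density `q`. -/
def priorMeasure (q : ℝ → ℝ) (a b : ℝ) : Measure ℝ :=
  (volume.restrict (Ioo a b)).withDensity fun t => ENNReal.ofReal (q t)

/-- Fisher information `∫ q'² / q · 1(q > 0)` of a prior density on `(a, b)`. -/
def priorInfo (q : ℝ → ℝ) (a b : ℝ) : ℝ≥0∞ :=
  ∫⁻ t in Ioo a b, if 0 < q t then ENNReal.ofReal ((deriv q t) ^ 2 / q t) else 0

/-- `Q = q dt` is a nice prior on `(a, b)` for the path `p` and the functional `φ`. -/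
structure IsNicePrior (p : ParamPath ν) (φ q : ℝ → ℝ) (a b : ℝ) : Prop where
  nonneg : ∀ t ∈ Ioo a b, 0 ≤ q t
  prob : priorMeasure q a b univ = 1
  ac : LocallyAC q a b
  info_pos : 0 < priorInfo q a b
  info_lt_top : priorInfo q a b < ∞
  integrable_fun : Integrable φ (priorMeasure q a b)
  integrable_deriv : Integrable (deriv φ) (priorMeasure q a b)
  integrable_info : ∫⁻ t, ENNReal.ofReal (p.fisherInfo t) ∂(priorMeasure q a b) < ∞
  tendsto_left : Tendsto q (𝓝[>] a) (𝓝 0)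
  tendsto_right : Tendsto q (𝓝[<] b) (𝓝 0)

/-- The value `[Γ^{1/2} - (∫ |ψ - φ|² dQ)^{1/2}]₊²` with
`Γ = (∫ φ' dQ)² / (I(Q) + n ∫ I(t) dQ)`. -/
def approxValue (ψ : ProbabilityMeasure X → ℝ) (p : ParamPath ν) (n : ℕ) (φ q : ℝ → ℝ)
    (a b : ℝ) : ℝ≥0∞ :=
  ((ENNReal.ofReal ((∫ t, deriv φ t ∂(priorMeasure q a b)) ^ 2) /
      (priorInfo q a b +
        n * ∫⁻ t, ENNReal.ofReal (p.fisherInfo t) ∂(priorMeasure q a b))) ^ (1 / 2 : ℝ) -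
    (∫⁻ t, ENNReal.ofReal ((ψ (p.law t) - φ t) ^ 2) ∂(priorMeasure q a b)) ^ (1 / 2 : ℝ)) ^ 2

/-- The best lower bound given by approximation with absolutely continuous functionals `φ` and
nice priors, for `n` observations on the local parameter set. The bound is available only if the
path is Hellinger differentiable on the whole local parameter set (otherwise the value is `0`). -/
def approxBound (ψ : ProbabilityMeasure X → ℝ) (p : ParamPath ν) (n : ℕ) (c : ℝ) : ℝ≥0∞ :=
  ⨆ (_ : ∀ t ∈ localSet n c, p.HellingerDifferentiableAt t) (φ : ℝ → ℝ) (q : ℝ → ℝ)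
    (_ : LocallyAC φ (-(c / √n)) (c / √n))
    (_ : IsNicePrior p φ q (-(c / √n)) (c / √n)),
    approxValue ψ p n φ q (-(c / √n)) (c / √n)

/-! ### The mixture lower bounds -/

/-- `φ` is a diffeomorphism from `ℝ` onto `S`. -/
def IsDiffeoOnto (φ : ℝ → ℝ) (S : Set ℝ) : Prop :=
  BijOn φ univ S ∧ Differentiable ℝ φ ∧
    ∃ η : ℝ → ℝ, (∀ t, η (φ t) = t) ∧ DifferentiableOn ℝ η S

/-- The joint law `dP^n_{φ(t+h)}(x) dQ(t+h)` on `Xⁿ × ℝ`. -/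
def jointLaw (p : ParamPath ν) (n : ℕ) (φ : ℝ → ℝ) (Q : ProbabilityMeasure ℝ) (h : ℝ) :
    Measure ((Fin n → X) × ℝ) :=
  ((Measure.pi fun _ : Fin n => ν).prod ((Q : Measure ℝ).map fun u => u - h)).withDensity
    fun z => ∏ i, ENNReal.ofReal (p.dens (φ (z.2 + h)) (z.1 i))

/-- `|∫ (ψ(P_{φ(t)}) - ψ(P_{φ(t-h)})) dQ(t)|²`. -/
def meanIncrementSq (ψ : ProbabilityMeasure X → ℝ) (p : ParamPath ν) (φ : ℝ → ℝ)
    (Q : ProbabilityMeasure ℝ) (h : ℝ) : ℝ≥0∞ :=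
  ENNReal.ofReal ((∫ t, (ψ (p.law (φ t)) - ψ (p.law (φ (t - h)))) ∂(Q : Measure ℝ)) ^ 2)

/-- `∫ |ψ(P_{φ(t)}) - ψ(P_{φ(t-h)})|² dQ(t)`. -/
def meanSqIncrement (ψ : ProbabilityMeasure X → ℝ) (p : ParamPath ν) (φ : ℝ → ℝ)
    (Q : ProbabilityMeasure ℝ) (h : ℝ) : ℝ≥0∞ :=
  ∫⁻ t, ENNReal.ofReal ((ψ (p.law (φ t)) - ψ (p.law (φ (t - h)))) ^ 2) ∂(Q : Measure ℝ)

/-- The best lower bound given by the mixture chi-squared inequality, for `n` observations on the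
local parameter set: the supremum of `[√((1-l)² A) - √(l B)]₊²` over diffeomorphisms, priors,
`l ∈ [0,1]` and shifts `h`. -/
def chiSqBound (ψ : ProbabilityMeasure X → ℝ) (p : ParamPath ν) (n : ℕ) (c : ℝ) : ℝ≥0∞ :=
  ⨆ (φ : ℝ → ℝ) (_ : IsDiffeoOnto φ (localSet n c)) (Q : ProbabilityMeasure ℝ)
    (l : ℝ) (_ : l ∈ Icc (0 : ℝ) 1) (h : ℝ),
    ((ENNReal.ofReal ((1 - l) ^ 2) *
        (meanIncrementSq ψ p φ Q h /
          chiSq (jointLaw p n φ Q h)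
            (ENNReal.ofReal l • jointLaw p n φ Q h +
              ENNReal.ofReal (1 - l) • jointLaw p n φ Q 0))) ^ (1 / 2 : ℝ) -
      (ENNReal.ofReal l * meanSqIncrement ψ p φ Q h) ^ (1 / 2 : ℝ)) ^ 2

/-- The best lower bound given by the mixture Hellinger inequality, for `n` observations on the
local parameter set: the supremum of `[√A - √B]₊²` over diffeomorphisms, priors and shifts. -/
def hellingerBound (ψ : ProbabilityMeasure X → ℝ) (p : ParamPath ν) (n : ℕ) (c : ℝ) : ℝ≥0∞ :=
  ⨆ (φ : ℝ → ℝ) (_ : IsDiffeoOnto φ (localSet n c)) (Q : ProbabilityMeasure ℝ) (h : ℝ),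
    ((meanIncrementSq ψ p φ Q h /
        (4 * hellingerSq (jointLaw p n φ Q 0) (jointLaw p n φ Q h))) ^ (1 / 2 : ℝ) -
      (meanSqIncrement ψ p φ Q h) ^ (1 / 2 : ℝ)) ^ 2

/-- The best two-point Hellinger lower bound, for `n` observations on the local parameter set. -/
def twoPointBound (ψ : ProbabilityMeasure X → ℝ) (p : ParamPath ν) (n : ℕ) (c : ℝ) : ℝ≥0∞ :=
  ⨆ (t₁ ∈ localSet n c) (t₂ ∈ localSet n c),
    (1 - hellingerSq (p.sampleLaw n t₁) (p.sampleLaw n t₂)) / 4 *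
      ENNReal.ofReal ((ψ (p.law t₁) - ψ (p.law t₂)) ^ 2)

/-! ### Obtaining an efficiency bound from a finite-sample bound -/

/-- Along the paths `P_{·,g}`, the finite-sample bound `L` is a lower bound for the local minimax
risk for every sample size and every radius, and its asymptotic value, hence that of the local
minimax risk, is at least `v`. -/
def YieldsBound {P₀ : ProbabilityMeasure X} (ψ : ProbabilityMeasure X → ℝ)
    (P : TangentSpace P₀ → ParamPath ν)
    (L : (ProbabilityMeasure X → ℝ) → ParamPath ν → ℕ → ℝ → ℝ≥0∞) (v : ℝ≥0∞) : Prop :=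
  (∀ (g : TangentSpace P₀) (n : ℕ) (c : ℝ), 0 < n → 0 < c →
      L ψ (P g) n c ≤ localMinimaxRisk ψ (P g) n c) ∧
    v ≤ asymptoticValue P (L ψ) ∧
    v ≤ asymptoticValue P (localMinimaxRisk ψ)

/-- `P` is the bounded path `dP_t = κ(t g) dP₀ / C_t`, `C_t = ∫ κ(t g) dP₀`, for `t` near `0`. -/
def IsKappaPath (κ : ℝ → ℝ) (P₀ : ProbabilityMeasure X) (g : X → ℝ) (p : ParamPath ν) : Prop :=
  ∀ᶠ t in 𝓝 (0 : ℝ), (p.law t : Measure X) =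
    (P₀ : Measure X).withDensity fun x =>
      ENNReal.ofReal (κ (t * g x) / ∫ y, κ (t * g y) ∂(P₀ : Measure X))

end SEB

end

/-! The square roots of the densities form a curve `root` of unit vectors in L²(ν). Hellinger
differentiability is differentiability of this curve, and the Fisher information is four times its
squared speed. A QMD path with score g has derivative ζ at 0 with 2‖ζ‖ = ‖g‖ in L²(P₀). The affinity
of n-fold products is the n-th power of the affinity (`inner_root_sample`), so squared Hellinger
distances grow at most by the factor n. Pathwise differentiability gives t ↦ ψ(P_t) the slope
∫ψdot·g at 0. For the score g = ψdot, with σ² = ∫ψdot² dP₀, slope and information at 0 are both σ²,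
so slope²/information = σ². All lower estimates of asymptotic values use this one path.

Every finite-sample bound is a Cauchy-Schwarz inequality. For two points, T - ψ(P_s) and T - ψ(P_t)
are integrated against √(p_s p_t) and subtracted. For mixtures, T - ψ is integrated against the
difference of a joint law and its translate; T cancels (`chiSqBound_le_localMinimaxRisk`). The
Hellinger bound is dominated by the chi-squared bound at weight 1/2
(`hellingerBound_le_chiSqBound`), so its validity comes from the chi-squared bound, and the
asymptotics of the chi-squared bound come from it. For absolutely continuous functionals the
inequality is that of van Trees (`vanTrees`): integration by parts for q(t)(E_t T - φ(t)), then
Minkowski to pass from φ to ψ.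

The asymptotics linearize `root` and ψ uniformly on the local set
(`eventually_sqrt_mul_norm_sub_le`). The information of the prior, of order n/c², becomes negligible
against nσ² as c → ∞, which gives the sharp value σ² for the first three bounds. Two points cannot
spread this way: with separation s the bound tends to (-1/4 + e^{-s²/8}/2)s²σ². Optimizing s gives
Cσ², and Cauchy-Schwarz for ∫ψdot·g shows that no other score does better. -/

noncomputable section

namespace SEB

/-! ### Square integrable functions -/

section L2
variable {Ω : Type*} [MeasurableSpace Ω] {m : Measure Ω}

lemma norm_sq_toLp {f : Ω → ℝ} (hf : MemLp f 2 m) : ‖hf.toLp f‖ ^ 2 = ∫ x, f x ^ 2 ∂m := by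
  rw [← real_inner_self_eq_norm_sq, L2.inner_def]
  refine integral_congr_ae ?_
  filter_upwards [hf.coeFn_toLp] with x hx
  simp [hx, sq]

lemma inner_toLp {f g : Ω → ℝ} (hf : MemLp f 2 m) (hg : MemLp g 2 m) :
    inner ℝ (hf.toLp f) (hg.toLp g) = ∫ x, f x * g x ∂m := by
  rw [L2.inner_def]
  refine integral_congr_ae ?_
  filter_upwards [hf.coeFn_toLp, hg.coeFn_toLp] with x hx hy
  simp [hx, hy, mul_comm]

lemma lintegral_sq_eq_ofReal {f : Ω → ℝ} (hf : MemLp f 2 m) :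
    ∫⁻ x, ENNReal.ofReal (f x ^ 2) ∂m = ENNReal.ofReal (∫ x, f x ^ 2 ∂m) := by
  rw [ofReal_integral_eq_lintegral_ofReal hf.integrable_sq (ae_of_all _ fun _ => sq_nonneg _)]

lemma memLp_two_of_lintegral_sq_lt_top {f : Ω → ℝ} (hf : AEStronglyMeasurable f m)
    (h : ∫⁻ x, ENNReal.ofReal (f x ^ 2) ∂m < ∞) : MemLp f 2 m := by
  rw [memLp_two_iff_integrable_sq hf]
  refine ⟨hf.pow 2, ?_⟩
  rw [hasFiniteIntegral_iff_ofReal (ae_of_all _ fun _ => sq_nonneg _)]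
  exact h

lemma abs_integral_mul_le {f g : Ω → ℝ} (hf : MemLp f 2 m) (hg : MemLp g 2 m) :
    |∫ x, f x * g x ∂m| ≤ √(∫ x, f x ^ 2 ∂m) * √(∫ x, g x ^ 2 ∂m) := by
  rw [← inner_toLp hf hg, ← norm_sq_toLp hf, ← norm_sq_toLp hg, Real.sqrt_sq (norm_nonneg _),
    Real.sqrt_sq (norm_nonneg _)]
  exact abs_real_inner_le_norm _ _

/-- For unit vectors, change of length and change of direction separate. With a and b square roots
of a prior density, this splits a joint distance into a prior part and a model part. -/
lemma norm_smul_sub_smul_sq {E : Type*} [NormedAddCommGroup E] [InnerProductSpace ℝ E] {u v : E}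
    (hu : ‖u‖ = 1) (hv : ‖v‖ = 1) (a b : ℝ) :
    ‖a • u - b • v‖ ^ 2 = (a - b) ^ 2 + a * b * ‖u - v‖ ^ 2 := by
  rw [norm_sub_sq_real, norm_sub_sq_real, norm_smul, norm_smul, hu, hv, inner_smul_left,
    inner_smul_right, Real.norm_eq_abs, Real.norm_eq_abs, mul_one, mul_one, sq_abs, sq_abs]
  simp only [conj_trivial]
  ring

end L2

/-! ### Hellinger and chi-squared divergences -/

section Divergence
variable {Ω : Type*} [MeasurableSpace Ω]

/-- Relative to the sum of the two measures the densities are f/(f+g) and g/(f+g), and the factor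
f+g of the sum cancels the common denominator. Where f+g = 0 both sides vanish. -/
lemma hellingerSq_withDensity {m : Measure Ω} [SigmaFinite m] {f g : Ω → ℝ} (hf : Measurable f)
    (hg : Measurable g) (hf0 : ∀ x, 0 ≤ f x) (hg0 : ∀ x, 0 ≤ g x)
    (hfi : ∫⁻ x, ENNReal.ofReal (f x) ∂m ≠ ∞) (hgi : ∫⁻ x, ENNReal.ofReal (g x) ∂m ≠ ∞) :
    hellingerSq (m.withDensity fun x => ENNReal.ofReal (f x))
        (m.withDensity fun x => ENNReal.ofReal (g x)) =
      ∫⁻ x, ENNReal.ofReal ((√(f x) - √(g x)) ^ 2) ∂m := by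
  have : IsFiniteMeasure (m.withDensity fun x => ENNReal.ofReal (f x)) :=
    isFiniteMeasure_withDensity hfi
  have : IsFiniteMeasure (m.withDensity fun x => ENNReal.ofReal (g x)) :=
    isFiniteMeasure_withDensity hgi
  set μ := m.withDensity fun x => ENNReal.ofReal (f x) with hμ
  set η := m.withDensity fun x => ENNReal.ofReal (g x) with hη
  have hsum : μ + η = m.withDensity fun x => ENNReal.ofReal (f x + g x) := by
    rw [hμ, hη, ← withDensity_add_left hf.ennreal_ofReal]
    congr 1
    ext x
    simp [ENNReal.ofReal_add (hf0 x) (hg0 x)]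
  have hfg : Measurable fun x => ENNReal.ofReal (f x + g x) := (hf.add hg).ennreal_ofReal
  have key : ∀ k : Ω → ℝ, Measurable k → (∀ x, 0 ≤ k x) → (∀ x, k x ≤ f x + g x) →
      (m.withDensity fun x => ENNReal.ofReal (k x)).rnDeriv (μ + η) =ᵐ[μ + η]
        fun x => ENNReal.ofReal (k x / (f x + g x)) := by
    intro k hk hk0 hkle
    have hkm : Measurable fun x => ENNReal.ofReal (k x / (f x + g x)) :=
      (hk.div (hf.add hg)).ennreal_ofReal
    have : (m.withDensity fun x => ENNReal.ofReal (k x)) =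
        (μ + η).withDensity fun x => ENNReal.ofReal (k x / (f x + g x)) := by
      rw [hsum, ← withDensity_mul _ hfg hkm]
      congr 1
      ext x
      rw [Pi.mul_apply, ← ENNReal.ofReal_mul (add_nonneg (hf0 x) (hg0 x))]
      rcases eq_or_lt_of_le (add_nonneg (hf0 x) (hg0 x)) with h | h
      · have h0 := hkle x
        rw [← h] at h0
        rw [le_antisymm h0 (hk0 x)]; simp
      · rw [mul_div_cancel₀ _ h.ne']
    rw [this]
    exact Measure.rnDeriv_withDensity _ hkm
  unfold hellingerSq
  have h1 := key f hf hf0 fun x => le_add_of_nonneg_right (hg0 x)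
  have h2 := key g hg hg0 fun x => le_add_of_nonneg_left (hf0 x)
  have h3 : ∫⁻ x, ENNReal.ofReal
      ((√(μ.rnDeriv (μ + η) x).toReal - √(η.rnDeriv (μ + η) x).toReal) ^ 2) ∂(μ + η) =
      ∫⁻ x, ENNReal.ofReal ((√(f x / (f x + g x)) - √(g x / (f x + g x))) ^ 2) ∂(μ + η) := by
    refine lintegral_congr_ae ?_
    filter_upwards [h1, h2] with x hx hy
    rw [hx, hy, ENNReal.toReal_ofReal (div_nonneg (hf0 x) (add_nonneg (hf0 x) (hg0 x))),
      ENNReal.toReal_ofReal (div_nonneg (hg0 x) (add_nonneg (hf0 x) (hg0 x)))]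
  rw [h3, hsum, lintegral_withDensity_eq_lintegral_mul _ hfg (by fun_prop)]
  refine lintegral_congr fun x => ?_
  have hs := add_nonneg (hf0 x) (hg0 x)
  rw [Pi.mul_apply, ← ENNReal.ofReal_mul hs]
  congr 1
  rw [Real.sqrt_div (hf0 x), Real.sqrt_div (hg0 x), ← sub_div, div_pow, Real.sq_sqrt hs]
  rcases eq_or_lt_of_le hs with h | h
  · have hfx : f x = 0 := by linarith [hf0 x, hg0 x]
    have hgx : g x = 0 := by linarith [hf0 x, hg0 x]
    simp [hfx, hgx]
  · rw [mul_div_cancel₀ _ h.ne']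

/-- Relative to `η + μ` the two densities a, b sum to 1 and the density of `μ` with respect to the
midpoint is 2b. Then 2b - 1 = b - a = (√b - √a)(√b + √a), where (√b + √a)² ≤ 2, and the weight 1/2
of the midpoint absorbs this 2. -/
lemma chiSq_midpoint_le_hellingerSq (μ η : Measure Ω) [IsFiniteMeasure μ] [IsFiniteMeasure η] :
    chiSq μ (ENNReal.ofReal (1 / 2) • μ + ENNReal.ofReal (1 / 2) • η) ≤ hellingerSq η μ := by
  set c : ℝ≥0∞ := ENNReal.ofReal (1 / 2) with hc
  have hc0 : c ≠ 0 := by simp [hc]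
  have hct : c ≠ ∞ := ENNReal.ofReal_ne_top
  have hM : c • μ + c • η = c • (η + μ) := by rw [smul_add, add_comm]
  have hac : μ ≪ c • (η + μ) :=
    (Measure.AbsolutelyContinuous.rfl.add_right' η).trans
      (Measure.AbsolutelyContinuous.smul_right Measure.AbsolutelyContinuous.rfl hc0)
  rw [hM, chiSq, if_pos hac, hellingerSq, lintegral_smul_measure, smul_eq_mul,
    ← lintegral_const_mul' _ _ hct]
  have hr : μ.rnDeriv (c • (η + μ)) =ᵐ[η + μ] c⁻¹ • μ.rnDeriv (η + μ) :=
    Measure.rnDeriv_smul_right_of_ne_top' μ (η + μ) hc0 hct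
  have hadd : (η + μ).rnDeriv (η + μ) =ᵐ[η + μ] η.rnDeriv (η + μ) + μ.rnDeriv (η + μ) :=
    η.rnDeriv_add' μ (η + μ)
  have hinv : c⁻¹.toReal = 2 := by
    rw [hc, ← ENNReal.ofReal_inv_of_pos (by norm_num), ENNReal.toReal_ofReal (by norm_num)]
    norm_num
  refine lintegral_mono_ae ?_
  filter_upwards [hr, hadd, (η + μ).rnDeriv_self, η.rnDeriv_lt_top (η + μ),
    μ.rnDeriv_lt_top (η + μ)] with x h1 h2 h3 h4 h5
  rw [h1, hc, ← ENNReal.ofReal_mul (by norm_num)]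
  apply ENNReal.ofReal_le_ofReal
  set a := (η.rnDeriv (η + μ) x).toReal with ha
  set b := (μ.rnDeriv (η + μ) x).toReal with hb
  have hab : a + b = 1 := by
    rw [ha, hb, ← ENNReal.toReal_add h4.ne h5.ne, ← Pi.add_apply, ← h2, h3, ENNReal.toReal_one]
  have ha0 : 0 ≤ a := ENNReal.toReal_nonneg
  have hb0 : 0 ≤ b := ENNReal.toReal_nonneg
  rw [Pi.smul_apply, smul_eq_mul, ENNReal.toReal_mul, hinv, ← hb]
  have h2b : 2 * b - 1 = (√b - √a) * (√b + √a) := by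
    have := Real.sq_sqrt ha0; have := Real.sq_sqrt hb0
    nlinarith
  rw [h2b]
  have : (√b + √a) ^ 2 ≤ 2 := by
    have := Real.sq_sqrt ha0; have := Real.sq_sqrt hb0
    nlinarith [sq_nonneg (√b - √a)]
  nlinarith [sq_nonneg (√b - √a), mul_le_mul_of_nonneg_left this (sq_nonneg (√b - √a))]

end Divergence

/-! ### The square root of the density as a curve in `L²(ν)` -/

namespace ParamPath
variable {X : Type*} [MeasurableSpace X] {ν : Measure X}

lemma measurable_dens_right (p : ParamPath ν) (t : ℝ) : Measurable (p.dens t) :=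
  p.measurable_dens.comp (measurable_const.prodMk measurable_id)

lemma integrable_dens (p : ParamPath ν) (t : ℝ) : Integrable (p.dens t) ν := by
  refine ⟨(p.measurable_dens_right t).aestronglyMeasurable, ?_⟩
  rw [hasFiniteIntegral_iff_ofReal (ae_of_all _ (p.dens_nonneg t)), p.lintegral_dens]
  simp

lemma integral_dens (p : ParamPath ν) (t : ℝ) : ∫ x, p.dens t x ∂ν = 1 := by
  rw [integral_eq_lintegral_of_nonneg_ae (ae_of_all _ (p.dens_nonneg t))
    (p.measurable_dens_right t).aestronglyMeasurable, p.lintegral_dens, ENNReal.toReal_one]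

lemma memLp_sqrt_dens (p : ParamPath ν) (t : ℝ) : MemLp (fun x => √(p.dens t x)) 2 ν := by
  rw [memLp_two_iff_integrable_sq (p.measurable_dens_right t).sqrt.aestronglyMeasurable]
  simpa only [Real.sq_sqrt (p.dens_nonneg t _)] using p.integrable_dens t

/-- The square root of the density of `P_t`, as an element of `L²(ν)`. -/
def root (p : ParamPath ν) (t : ℝ) : Lp ℝ 2 ν := (p.memLp_sqrt_dens t).toLp

lemma norm_root (p : ParamPath ν) (t : ℝ) : ‖p.root t‖ = 1 := by
  have : ‖p.root t‖ ^ 2 = 1 := by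
    rw [root, norm_sq_toLp]
    simpa only [Real.sq_sqrt (p.dens_nonneg t _)] using p.integral_dens t
  nlinarith [norm_nonneg (p.root t)]

lemma inner_root (p : ParamPath ν) (s t : ℝ) :
    inner ℝ (p.root s) (p.root t) = ∫ x, √(p.dens s x) * √(p.dens t x) ∂ν :=
  inner_toLp _ _

lemma norm_root_sub_sq (p : ParamPath ν) (s t : ℝ) :
    ‖p.root s - p.root t‖ ^ 2 = ∫ x, (√(p.dens s x) - √(p.dens t x)) ^ 2 ∂ν := by
  rw [root, root, ← MemLp.toLp_sub, norm_sq_toLp]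
  rfl

lemma norm_root_sub_sq_eq (p : ParamPath ν) (s t : ℝ) :
    ‖p.root s - p.root t‖ ^ 2 = 2 - 2 * inner ℝ (p.root s) (p.root t) := by
  rw [norm_sub_sq_real, p.norm_root, p.norm_root]; ring

lemma inner_root_nonneg (p : ParamPath ν) (s t : ℝ) : 0 ≤ inner ℝ (p.root s) (p.root t) := by
  rw [inner_root]; exact integral_nonneg fun x => by positivity

lemma inner_root_le_one (p : ParamPath ν) (s t : ℝ) : inner ℝ (p.root s) (p.root t) ≤ 1 := by
  have := p.norm_root_sub_sq_eq s t
  nlinarith [sq_nonneg ‖p.root s - p.root t‖]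

lemma hellingerSq_law [SigmaFinite ν] (p : ParamPath ν) (s t : ℝ) :
    hellingerSq (p.law s : Measure X) (p.law t) =
      ENNReal.ofReal (‖p.root s - p.root t‖ ^ 2) := by
  have := hellingerSq_withDensity (m := ν) (p.measurable_dens_right s) (p.measurable_dens_right t)
    (p.dens_nonneg s) (p.dens_nonneg t) (by simp [p.lintegral_dens]) (by simp [p.lintegral_dens])
  rw [norm_root_sub_sq]
  exact this.trans (lintegral_sq_eq_ofReal ((p.memLp_sqrt_dens s).sub (p.memLp_sqrt_dens t)))

lemma toLp_remainder (p : ParamPath ν) {ξ : X → ℝ} (hξ : MemLp ξ 2 ν) (t h : ℝ) :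
    ‖p.root (t + h) - p.root t - h • hξ.toLp ξ‖ ^ 2 =
      ∫ x, (√(p.dens (t + h) x) - √(p.dens t x) - h * ξ x) ^ 2 ∂ν := by
  rw [root, root, ← MemLp.toLp_sub, ← MemLp.toLp_const_smul, ← MemLp.toLp_sub, norm_sq_toLp]
  rfl

/-- The integral in the definition is the squared L² norm of the first-order remainder, so o(h²) for
it is o(h) for the norm. -/
lemma hasHellingerDerivAt_iff (p : ParamPath ν) {ξ : X → ℝ} (hξ : MemLp ξ 2 ν) (t : ℝ) :
    p.HasHellingerDerivAt ξ t ↔ HasDerivAt p.root (hξ.toLp ξ) t := by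
  rw [HasHellingerDerivAt, hasDerivAt_iff_isLittleO_nhds_zero, and_iff_right hξ]
  simp_rw [← p.toLp_remainder hξ t]
  constructor
  · intro h
    exact (Asymptotics.IsLittleO.of_pow (n := 2) (f := fun h : ℝ =>
      ‖p.root (t + h) - p.root t - h • hξ.toLp ξ‖) h two_ne_zero).of_norm_left
  · intro h
    exact h.norm_left.pow two_pos

lemma hellingerDifferentiableAt_iff (p : ParamPath ν) (t : ℝ) :
    p.HellingerDifferentiableAt t ↔ DifferentiableAt ℝ p.root t := by
  constructor
  · rintro ⟨ξ, hξ⟩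
    exact ((p.hasHellingerDerivAt_iff hξ.1 t).1 hξ).differentiableAt
  · intro h
    refine ⟨((deriv p.root t : Lp ℝ 2 ν) : X → ℝ), (p.hasHellingerDerivAt_iff (Lp.memLp _) t).2 ?_⟩
    rw [Lp.toLp_coeFn]
    exact h.hasDerivAt

/-- Uniqueness of the derivative makes the chosen ξ irrelevant; where the curve is not
differentiable both sides take their default value 0. -/
lemma fisherInfo_eq (p : ParamPath ν) (t : ℝ) : p.fisherInfo t = 4 * ‖deriv p.root t‖ ^ 2 := by
  unfold fisherInfo
  split_ifs with h
  · rw [((p.hasHellingerDerivAt_iff h.choose_spec.1 t).1 h.choose_spec).deriv, norm_sq_toLp]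
  · rw [deriv_zero_of_not_differentiableAt
      (fun hd => h ((p.hellingerDifferentiableAt_iff t).2 hd))]
    simp

lemma fisherInfo_nonneg (p : ParamPath ν) (t : ℝ) : 0 ≤ p.fisherInfo t := by
  rw [fisherInfo_eq]; positivity

lemma aemeasurable_fisherInfo (p : ParamPath ν) (m : Measure ℝ) : AEMeasurable p.fisherInfo m := by
  rw [funext p.fisherInfo_eq]
  exact (((aestronglyMeasurable_deriv p.root m).norm.aemeasurable.pow_const 2).const_mul 4)

lemma QMDAt.exists_hasDerivAt {p : ParamPath ν} {g : X → ℝ} {t : ℝ} (h : p.QMDAt g t) :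
    ∃ ζ : Lp ℝ 2 ν, HasDerivAt p.root ζ t ∧
      4 * ‖ζ‖ ^ 2 = ∫ x, g x ^ 2 ∂(p.law t : Measure X) := by
  obtain ⟨hg, ho⟩ := h
  have hlaw : (p.law t : Measure X) = ν.withDensity fun x => ENNReal.ofReal (p.dens t x) := rfl
  obtain ⟨g', hg'm, hg'⟩ := hg.1
  -- The score is determined only P_t-almost everywhere, but its product with √p_t is determined
  -- ν-almost everywhere, because the factor vanishes where p_t does.
  have hae : ∀ᵐ x ∂ν, g x * √(p.dens t x) = g' x * √(p.dens t x) := by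
    have h1 : ∀ᵐ x ∂(ν.withDensity fun x => ENNReal.ofReal (p.dens t x)), g x = g' x := hg'
    rw [ae_withDensity_iff (p.measurable_dens_right t).ennreal_ofReal] at h1
    filter_upwards [h1] with x hx
    by_cases h0 : p.dens t x = 0
    · simp [h0]
    · rw [hx]
      simpa using lt_of_le_of_ne (p.dens_nonneg t x) (Ne.symm h0)
  have hint : ∀ k : X → ℝ, ∫ x, k x ∂(p.law t : Measure X) = ∫ x, p.dens t x * k x ∂ν := by
    intro k
    rw [hlaw, integral_withDensity_eq_integral_toReal_smul
      (p.measurable_dens_right t).ennreal_ofReal (by simp)]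
    simp only [ENNReal.toReal_ofReal (p.dens_nonneg t _), smul_eq_mul]
  have hξ : MemLp (fun x => 1 / 2 * (g x * √(p.dens t x))) 2 ν := by
    have hm : AEStronglyMeasurable (fun x => g x * √(p.dens t x)) ν :=
      (hg'm.measurable.mul (p.measurable_dens_right t).sqrt).aestronglyMeasurable.congr
        (by filter_upwards [hae] with x hx using hx.symm)
    refine MemLp.const_mul ?_ _
    rw [memLp_two_iff_integrable_sq hm]
    have := hg.integrable_sq
    rw [hlaw, integrable_withDensity_iff_integrable_smul'
      (p.measurable_dens_right t).ennreal_ofReal (by simp)] at this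
    refine this.congr (ae_of_all _ fun x => ?_)
    simp only [ENNReal.toReal_ofReal (p.dens_nonneg t _), smul_eq_mul]
    rw [mul_pow, Real.sq_sqrt (p.dens_nonneg t x), mul_comm]
  refine ⟨hξ.toLp _, (p.hasHellingerDerivAt_iff hξ t).1 ⟨hξ, ?_⟩, ?_⟩
  · refine ho.congr (fun h => ?_) fun _ => rfl
    refine integral_congr_ae (ae_of_all _ fun x => ?_)
    simp only
    ring
  · rw [norm_sq_toLp, hint, ← integral_const_mul]
    refine integral_congr_ae (ae_of_all _ fun x => ?_)
    simp only
    rw [mul_pow, mul_pow, Real.sq_sqrt (p.dens_nonneg t x)]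
    ring

/-! ### Samples -/

/-- The path of the laws of `n` i.i.d. observations. -/
def sample [SigmaFinite ν] (p : ParamPath ν) (n : ℕ) :
    ParamPath (Measure.pi fun _ : Fin n => ν) where
  dens t x := ∏ i, p.dens t (x i)
  measurable_dens := by
    refine Finset.measurable_fun_prod _ fun i _ => ?_
    exact p.measurable_dens.comp
      (measurable_fst.prodMk ((measurable_pi_apply i).comp measurable_snd))
  dens_nonneg t x := Finset.prod_nonneg fun i _ => p.dens_nonneg t _
  lintegral_dens t := by
    rw [← ofReal_integral_eq_lintegral_ofReal
      (Integrable.fintype_prod fun _ => p.integrable_dens t)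
      (ae_of_all _ fun x => Finset.prod_nonneg fun i _ => p.dens_nonneg t _),
      integral_fintype_prod_eq_prod (f := fun _ => p.dens t)]
    simp [p.integral_dens]

variable [SigmaFinite ν]

lemma sampleLaw_eq (p : ParamPath ν) (n : ℕ) (t : ℝ) :
    p.sampleLaw n t = ((p.sample n).law t : Measure (Fin n → X)) := by
  refine Measure.pi_eq fun s hs => ?_
  change ((Measure.pi fun _ : Fin n => ν).withDensity
    fun x => ENNReal.ofReal (∏ i, p.dens t (x i))) (Set.pi univ s) = _
  rw [withDensity_apply _ (MeasurableSet.univ_pi hs)]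
  have h1 : ∀ i, (p.law t : Measure X) (s i) = ENNReal.ofReal (∫ x in s i, p.dens t x ∂ν) := by
    intro i
    change (ν.withDensity fun x => ENNReal.ofReal (p.dens t x)) (s i) = _
    rw [withDensity_apply _ (hs i), ofReal_integral_eq_lintegral_ofReal
      (p.integrable_dens t).integrableOn (ae_of_all _ (p.dens_nonneg t))]
  simp_rw [h1]
  rw [Measure.restrict_pi_pi, ← ofReal_integral_eq_lintegral_ofReal
      (Integrable.fintype_prod fun i => (p.integrable_dens t).integrableOn)
      (ae_of_all _ fun x => Finset.prod_nonneg fun i _ => p.dens_nonneg t _),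
      integral_fintype_prod_eq_prod (f := fun _ => p.dens t),
      ENNReal.ofReal_prod_of_nonneg fun i _ => integral_nonneg (p.dens_nonneg t)]

lemma inner_root_sample (p : ParamPath ν) (n : ℕ) (s t : ℝ) :
    inner ℝ ((p.sample n).root s) ((p.sample n).root t) = (inner ℝ (p.root s) (p.root t)) ^ n := by
  rw [inner_root, inner_root]
  have : ∀ x : Fin n → X, √((p.sample n).dens s x) * √((p.sample n).dens t x) =
      ∏ i, (√(p.dens s (x i)) * √(p.dens t (x i))) := by
    intro x
    simp only [sample]
    rw [Real.sqrt_prod _ fun i _ => p.dens_nonneg s _, Real.sqrt_prod _ fun i _ => p.dens_nonneg t _,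
      Finset.prod_mul_distrib]
  simp_rw [this]
  rw [integral_fintype_prod_eq_prod (f := fun _ x => √(p.dens s x) * √(p.dens t x))]
  simp

/-- Bernoulli's inequality 1 - aⁿ ≤ n(1 - a) for the affinity a. -/
lemma norm_root_sample_sub_sq_le (p : ParamPath ν) (n : ℕ) (s t : ℝ) :
    ‖(p.sample n).root s - (p.sample n).root t‖ ^ 2 ≤ n * ‖p.root s - p.root t‖ ^ 2 := by
  rw [norm_root_sub_sq_eq, norm_root_sub_sq_eq, inner_root_sample]
  have := one_add_mul_le_pow (a := inner ℝ (p.root s) (p.root t) - 1)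
    (by linarith [p.inner_root_nonneg s t]) n
  rw [add_sub_cancel] at this
  linarith

lemma norm_root_sample_sub_le (p : ParamPath ν) (n : ℕ) (s t : ℝ) :
    ‖(p.sample n).root s - (p.sample n).root t‖ ≤ √n * ‖p.root s - p.root t‖ := by
  refine (sq_le_sq₀ (norm_nonneg _) (by positivity)).1 ?_
  rw [mul_pow, Real.sq_sqrt (Nat.cast_nonneg n)]
  exact p.norm_root_sample_sub_sq_le n s t

end ParamPath

/-! ### Local expansions and asymptotic values -/

lemma mem_localSet {n : ℕ} {c t : ℝ} : t ∈ localSet n c ↔ |t| < c / √n := by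
  rw [localSet, mem_Ioo, abs_lt]

lemma tendsto_div_sqrt_natCast (c : ℝ) : Tendsto (fun n : ℕ => c / √(n : ℝ)) atTop (𝓝 0) :=
  tendsto_const_nhds.div_atTop (Real.tendsto_sqrt_atTop.comp tendsto_natCast_atTop_atTop)

lemma eventually_forall_localSet {P : ℝ → Prop} (h : ∀ᶠ t in 𝓝 (0 : ℝ), P t) (c : ℝ) :
    ∀ᶠ n : ℕ in atTop, ∀ t ∈ localSet n c, P t := by
  obtain ⟨ε, hε, hP⟩ := Metric.eventually_nhds_iff.1 h
  filter_upwards [(tendsto_div_sqrt_natCast c).eventually (gt_mem_nhds hε)] with n hn t ht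
  refine hP ?_
  rw [Real.dist_eq, sub_zero]
  exact (mem_localSet.1 ht).trans hn

/-- Linearization with error o(n^{-1/2}), uniform over pairs of local parameters. Both points are
expanded around 0, and each remainder is at most δ/(2c) times c/√n. -/
lemma eventually_sqrt_mul_norm_sub_le {E : Type*} [NormedAddCommGroup E] [NormedSpace ℝ E]
    {f : ℝ → E} {f' : E} (hf : HasDerivAt f f' 0) {c δ : ℝ} (hc : 0 < c) (hδ : 0 < δ) :
    ∀ᶠ n : ℕ in atTop, ∀ s ∈ localSet n c, ∀ t ∈ localSet n c,
      √(n : ℝ) * ‖f s - f t - (s - t) • f'‖ ≤ δ := by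
  have ho := hasDerivAt_iff_isLittleO_nhds_zero.1 hf
  have := ho.def (c := δ / (2 * c)) (by positivity)
  filter_upwards [eventually_forall_localSet this c, eventually_gt_atTop 0] with n hn hn0 s hs t ht
  have hs' := hn s hs
  have ht' := hn t ht
  rw [zero_add, Real.norm_eq_abs] at hs' ht'
  have hsn : 0 < √(n : ℝ) := Real.sqrt_pos.2 (by exact_mod_cast hn0)
  have e : f s - f t - (s - t) • f' = (f s - f 0 - s • f') - (f t - f 0 - t • f') := by
    rw [sub_smul]; abel
  have h1 := (lt_div_iff₀ hsn).1 (mem_localSet.1 hs)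
  have h2 := (lt_div_iff₀ hsn).1 (mem_localSet.1 ht)
  calc √(n : ℝ) * ‖f s - f t - (s - t) • f'‖
      ≤ √(n : ℝ) * (δ / (2 * c) * |s| + δ / (2 * c) * |t|) := by
        rw [e]
        exact mul_le_mul_of_nonneg_left ((norm_sub_le _ _).trans (add_le_add hs' ht')) hsn.le
    _ = δ / (2 * c) * (|s| * √(n : ℝ) + |t| * √(n : ℝ)) := by ring
    _ ≤ δ / (2 * c) * (c + c) := by gcongr
    _ = δ := by field_simp; ring

lemma tendsto_sqrt_smul_sub {E : Type*} [NormedAddCommGroup E] [NormedSpace ℝ E]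
    {f : ℝ → E} {f' : E} (hf : HasDerivAt f f' 0) (s : ℝ) :
    Tendsto (fun n : ℕ => √(n : ℝ) • (f (s / √n) - f 0)) atTop (𝓝 (s • f')) := by
  rw [Metric.tendsto_atTop']
  intro ε hε
  have h := eventually_sqrt_mul_norm_sub_le hf (c := |s| + 1) (δ := ε / 2) (by positivity)
    (by positivity)
  obtain ⟨N, hN⟩ := eventually_atTop.1 (h.and (eventually_gt_atTop 0))
  refine ⟨N, fun n hn => ?_⟩
  obtain ⟨h1, h2⟩ := hN n hn.le
  have hsn : 0 < √(n : ℝ) := Real.sqrt_pos.2 (by exact_mod_cast h2)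
  have h3 := h1 (s / √n) (mem_localSet.2 (by
    rw [abs_div, abs_of_pos hsn]
    gcongr
    linarith)) 0 (mem_localSet.2 (by rw [abs_zero]; positivity))
  rw [dist_eq_norm]
  have e : √(n : ℝ) • (f (s / √n) - f 0) - s • f' =
      √(n : ℝ) • (f (s / √n) - f 0 - (s / √n - 0) • f') := by
    rw [smul_sub √(n : ℝ) (f (s / √n) - f 0), smul_smul, sub_zero, mul_div_cancel₀ _ hsn.ne']
  rw [e, norm_smul, Real.norm_eq_abs, abs_of_pos hsn]
  linarith

section Path
variable {X : Type*} [MeasurableSpace X] {ν : Measure X}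

lemma ParamPath.exists_memLp_mul_sqrt (p : ParamPath ν) {W : X → ℝ} (hW : Measurable W) {t : ℝ}
    (h : ∫⁻ x, ENNReal.ofReal (W x ^ 2) ∂(p.law t : Measure X) < ∞) :
    MemLp (fun x => W x * √(p.dens t x)) 2 ν ∧
      ENNReal.ofReal (∫ x, (W x * √(p.dens t x)) ^ 2 ∂ν) =
        ∫⁻ x, ENNReal.ofReal (W x ^ 2) ∂(p.law t : Measure X) := by
  have e : ∫⁻ x, ENNReal.ofReal (W x ^ 2) ∂(p.law t : Measure X) =
      ∫⁻ x, ENNReal.ofReal ((W x * √(p.dens t x)) ^ 2) ∂ν := by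
    change ∫⁻ x, _ ∂(ν.withDensity fun x => ENNReal.ofReal (p.dens t x)) = _
    rw [lintegral_withDensity_eq_lintegral_mul _ (p.measurable_dens_right t).ennreal_ofReal
      (by fun_prop)]
    refine lintegral_congr fun x => ?_
    rw [Pi.mul_apply, ← ENNReal.ofReal_mul (p.dens_nonneg t x), mul_pow,
      Real.sq_sqrt (p.dens_nonneg t x), mul_comm]
  have hm : MemLp (fun x => W x * √(p.dens t x)) 2 ν := by
    refine memLp_two_of_lintegral_sq_lt_top
      (hW.mul (p.measurable_dens_right t).sqrt).aestronglyMeasurable ?_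
    rwa [← e]
  exact ⟨hm, by rw [e, lintegral_sq_eq_ofReal hm]⟩

variable {P₀ : ProbabilityMeasure X} {ψ : ProbabilityMeasure X → ℝ} {ψdot : X → ℝ}

lemma HasEfficientInfluenceFunction.hasDerivAt
    (hψ : HasEfficientInfluenceFunction ν ψ P₀ ψdot) (g : TangentSpace P₀) {p : ParamPath ν}
    (hp : IsQMDPath P₀ g.1 p) :
    HasDerivAt (fun t => ψ (p.law t)) (∫ x, ψdot x * g.1 x ∂(P₀ : Measure X)) 0 := by
  rw [hasDerivAt_iff_isLittleO_nhds_zero]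
  simpa [hp.1] using hψ.2.2 g p hp

lemma IsQMDPath.exists_hasDerivAt {g : X → ℝ} {p : ParamPath ν} (hp : IsQMDPath P₀ g p) :
    ∃ ζ : Lp ℝ 2 ν, HasDerivAt p.root ζ 0 ∧ 2 * ‖ζ‖ = √(∫ x, g x ^ 2 ∂(P₀ : Measure X)) := by
  obtain ⟨ζ, h1, h2⟩ := hp.2.exists_hasDerivAt
  refine ⟨ζ, h1, ?_⟩
  rw [← hp.1, ← h2, show 4 * ‖ζ‖ ^ 2 = (2 * ‖ζ‖) ^ 2 by ring, Real.sqrt_sq (by positivity)]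

lemma YieldsBound.of_le {P : TangentSpace P₀ → ParamPath ν}
    {L : (ProbabilityMeasure X → ℝ) → ParamPath ν → ℕ → ℝ → ℝ≥0∞} {v : ℝ≥0∞}
    (h : ∀ (g : TangentSpace P₀) (n : ℕ) (c : ℝ), 0 < n → 0 < c →
      L ψ (P g) n c ≤ localMinimaxRisk ψ (P g) n c)
    (hv : v ≤ asymptoticValue P (L ψ)) : YieldsBound ψ P L v := by
  refine ⟨h, hv, hv.trans (iSup_mono fun g => ?_)⟩
  refine liminf_le_liminf ?_
  filter_upwards [eventually_gt_atTop 0] with c hc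
  refine liminf_le_liminf ?_
  filter_upwards [eventually_gt_atTop 0] with n hn
  gcongr
  exact h g n c hn hc

/-- The efficient influence function as an element of the tangent space. -/
def HasEfficientInfluenceFunction.tangent (hψ : HasEfficientInfluenceFunction ν ψ P₀ ψdot) :
    TangentSpace P₀ := ⟨ψdot, hψ.1, hψ.2.1⟩

/-! ### The two-point bound -/

/-- The squared Hellinger distance is 2 - 2aⁿ with a the affinity. Truncated subtraction on the left
and `ENNReal.ofReal` on the right both take the positive part. -/
lemma two_point_term [SigmaFinite ν] (p : ParamPath ν) (n : ℕ) (s t d : ℝ) :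
    (1 - hellingerSq (p.sampleLaw n s) (p.sampleLaw n t)) / 4 * ENNReal.ofReal (d ^ 2) =
      ENNReal.ofReal ((2 * inner ℝ (p.root s) (p.root t) ^ n - 1) / 4 * d ^ 2) := by
  rw [p.sampleLaw_eq, p.sampleLaw_eq, ParamPath.hellingerSq_law,
    ENNReal.ofReal_mul' (sq_nonneg d), ENNReal.ofReal_div_of_pos (by norm_num),
    ParamPath.norm_root_sub_sq_eq, p.inner_root_sample, ← ENNReal.ofReal_one,
    ← ENNReal.ofReal_sub]
  · congr 2
    · congr 1; ring
    · simp
  · have := pow_le_one₀ (n := n) (p.inner_root_nonneg s t) (p.inner_root_le_one s t)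
    linarith

/-- Integrate T - ψ(P_t) and T - ψ(P_s) against the product of the root densities and subtract: T
cancels and aⁿ(ψ(P_s) - ψ(P_t)) remains. By Cauchy-Schwarz each integral is at most √R, so a²ⁿd² ≤
4R for the increment d, and 2aⁿ - 1 ≤ a²ⁿ. -/
lemma twoPointBound_le_localMinimaxRisk [SigmaFinite ν] (p : ParamPath ν) (n : ℕ) (c : ℝ) :
    twoPointBound ψ p n c ≤ localMinimaxRisk ψ p n c := by
  refine le_iInf₂ fun T hT => iSup₂_le fun s hs => iSup₂_le fun t ht => ?_
  set R := ⨆ t ∈ localSet n c, ∫⁻ x, ENNReal.ofReal ((T x - ψ (p.law t)) ^ 2) ∂(p.sampleLaw n t)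
    with hR
  have hE : ∀ u ∈ localSet n c,
      ∫⁻ x, ENNReal.ofReal ((T x - ψ (p.law u)) ^ 2) ∂((p.sample n).law u : Measure (Fin n → X))
        ≤ R := by
    intro u hu
    rw [← p.sampleLaw_eq]
    exact le_iSup₂ (f := fun t _ => ∫⁻ x, ENNReal.ofReal ((T x - ψ (p.law t)) ^ 2)
      ∂(p.sampleLaw n t)) u hu
  rcases eq_or_ne R ∞ with hRt | hRt
  · rw [hRt]; exact le_top
  have hm : ∀ u ∈ localSet n c, MemLp (fun x => (T x - ψ (p.law u)) * √((p.sample n).dens u x)) 2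
      (Measure.pi fun _ : Fin n => ν) ∧
      √(∫ x, ((T x - ψ (p.law u)) * √((p.sample n).dens u x)) ^ 2
        ∂(Measure.pi fun _ : Fin n => ν)) ≤ √R.toReal := by
    intro u hu
    obtain ⟨h1, h2⟩ := (p.sample n).exists_memLp_mul_sqrt (W := fun x => T x - ψ (p.law u))
      (hT.sub_const _) ((hE u hu).trans_lt hRt.lt_top)
    refine ⟨h1, Real.sqrt_le_sqrt ?_⟩
    refine (ENNReal.ofReal_le_iff_le_toReal hRt).1 ?_
    rw [h2]; exact hE u hu
  obtain ⟨ms, bs⟩ := hm s hs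
  obtain ⟨mt, bt⟩ := hm t ht
  have rs := (p.sample n).memLp_sqrt_dens s
  have rt := (p.sample n).memLp_sqrt_dens t
  have hone : ∀ u, √(∫ x, √((p.sample n).dens u x) ^ 2 ∂(Measure.pi fun _ : Fin n => ν)) = 1 := by
    intro u
    simp [Real.sq_sqrt ((p.sample n).dens_nonneg u _), (p.sample n).integral_dens]
  have c1 := abs_integral_mul_le ms rt
  have c2 := abs_integral_mul_le mt rs
  rw [hone, mul_one] at c1 c2
  set a := inner ℝ (p.root s) (p.root t) with ha
  have hid : a ^ n * (ψ (p.law s) - ψ (p.law t)) =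
      (∫ x, (T x - ψ (p.law t)) * √((p.sample n).dens t x) * √((p.sample n).dens s x)
        ∂(Measure.pi fun _ : Fin n => ν)) -
      ∫ x, (T x - ψ (p.law s)) * √((p.sample n).dens s x) * √((p.sample n).dens t x)
        ∂(Measure.pi fun _ : Fin n => ν) := by
    rw [ha, ← p.inner_root_sample, ParamPath.inner_root, ← integral_mul_const]
    refine Eq.trans (integral_congr_ae (ae_of_all _ fun x => ?_))
      (integral_sub (mt.integrable_mul rs) (ms.integrable_mul rt))
    simp only
    ring
  have habs : |a ^ n * (ψ (p.law s) - ψ (p.law t))| ≤ 2 * √R.toReal := by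
    rw [hid]
    refine (abs_sub _ _).trans ?_
    linarith
  rw [two_point_term, ← ha, ← ENNReal.ofReal_toReal hRt]
  apply ENNReal.ofReal_le_ofReal
  have h4 : (a ^ n * (ψ (p.law s) - ψ (p.law t))) ^ 2 ≤ 4 * R.toReal := by
    rw [← sq_abs, ← Real.sq_sqrt (ENNReal.toReal_nonneg (a := R))]
    nlinarith [abs_nonneg (a ^ n * (ψ (p.law s) - ψ (p.law t)))]
  nlinarith [sq_nonneg ((a ^ n - 1) * (ψ (p.law s) - ψ (p.law t)))]

/-- The limiting profile of the two-point bound. -/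
def twoPointProfile (s : ℝ) : ℝ := (-(1 / 4) + 1 / 2 * Real.exp (-(s ^ 2) / 8)) * s ^ 2

/-- Up to linearization errors, y = 2√n|s - t|‖ζ‖ is the separation of the two points: the affinity
of the samples is at most exp(-y²/8), and Cauchy-Schwarz for ∫ψdot·g limits the increment of ψ to
σy/√n. Hence the profile at y, times σ², bounds the term, uniformly over the pair. -/
lemma asymptotic_twoPointBound_le [SigmaFinite ν]
    (hψ : HasEfficientInfluenceFunction ν ψ P₀ ψdot) (g : TangentSpace P₀) {p : ParamPath ν}
    (hp : IsQMDPath P₀ g.1 p) {C : ℝ} (hC : ∀ s, 0 ≤ s → twoPointProfile s ≤ C) :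
    liminf (fun c : ℝ => liminf (fun n : ℕ => (n : ℝ≥0∞) * twoPointBound ψ p n c) atTop) atTop ≤
      ENNReal.ofReal (C * ∫ x, ψdot x ^ 2 ∂(P₀ : Measure X)) := by
  obtain ⟨ζ, hζ, hζn⟩ := hp.exists_hasDerivAt
  have hd := hψ.hasDerivAt g hp
  set b := ∫ x, ψdot x * g.1 x ∂(P₀ : Measure X) with hb
  set σ := √(∫ x, ψdot x ^ 2 ∂(P₀ : Measure X)) with hσ
  have hσ2 : σ ^ 2 = ∫ x, ψdot x ^ 2 ∂(P₀ : Measure X) :=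
    Real.sq_sqrt (integral_nonneg fun x => sq_nonneg _)
  have hσ0 : 0 ≤ σ := Real.sqrt_nonneg _
  have hbσ : |b| ≤ σ * (2 * ‖ζ‖) := by rw [hζn]; exact abs_integral_mul_le hψ.1 g.2.1
  rw [← hσ2]
  refine liminf_le_of_frequently_le' (Eventually.frequently ?_)
  filter_upwards [eventually_gt_atTop 0] with c hc
  -- The error terms come from bounding √n times the increment by σy + (2σδ + δ), with y ≤ 4c‖ζ‖ and
  -- a weight of at most 1/4. For fixed c they vanish as δ → 0.
  set r : ℝ → ℝ := fun δ => C * σ ^ 2 +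
    (2 * σ * (4 * c * ‖ζ‖) * (2 * σ * δ + δ) + (2 * σ * δ + δ) ^ 2) / 4 with hr
  have hr0 : Tendsto (fun δ => ENNReal.ofReal (r δ)) (𝓝[>] 0) (𝓝 (ENNReal.ofReal (C * σ ^ 2))) := by
    refine ENNReal.tendsto_ofReal ?_
    have : Continuous r := by fun_prop
    have h := (this.tendsto 0).mono_left (nhdsWithin_le_nhds (s := Ioi (0 : ℝ)))
    simpa [hr] using h
  refine ge_of_tendsto hr0 ?_
  filter_upwards [self_mem_nhdsWithin] with δ hδ
  have hδ : 0 < δ := hδ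
  refine liminf_le_of_frequently_le' (Eventually.frequently ?_)
  filter_upwards [eventually_sqrt_mul_norm_sub_le hζ hc hδ,
    eventually_sqrt_mul_norm_sub_le hd hc hδ, eventually_gt_atTop 0] with n h1 h2 hn
  have hsn : 0 < √(n : ℝ) := Real.sqrt_pos.2 (by exact_mod_cast hn)
  have hn2 : √(n : ℝ) ^ 2 = n := Real.sq_sqrt (Nat.cast_nonneg n)
  rw [twoPointBound, ENNReal.mul_iSup]
  refine iSup_le fun s => ?_
  rw [ENNReal.mul_iSup]
  refine iSup_le fun hs => ?_
  rw [ENNReal.mul_iSup]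
  refine iSup_le fun t => ?_
  rw [ENNReal.mul_iSup]
  refine iSup_le fun ht => ?_
  rw [two_point_term, ← ENNReal.ofReal_natCast, ← ENNReal.ofReal_mul (Nat.cast_nonneg n)]
  apply ENNReal.ofReal_le_ofReal
  specialize h1 s hs t ht
  specialize h2 s hs t ht
  set S := √(n : ℝ) * |s - t| with hS
  have hS0 : 0 ≤ S := by positivity
  have hSc : S ≤ 2 * c := by
    have e1 := (lt_div_iff₀ hsn).1 (mem_localSet.1 hs)
    have e2 := (lt_div_iff₀ hsn).1 (mem_localSet.1 ht)
    have e3 : |s - t| ≤ |s| + |t| := abs_sub s t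
    nlinarith [mul_le_mul_of_nonneg_left e3 hsn.le]
  have hζ0 := norm_nonneg ζ
  set D := √(n : ℝ) * ‖p.root s - p.root t‖ with hD
  have hDl : S * ‖ζ‖ - δ ≤ D := by
    have : ‖(s - t) • ζ‖ ≤ ‖p.root s - p.root t‖ + ‖p.root s - p.root t - (s - t) • ζ‖ := by
      have := norm_sub_le (p.root s - p.root t) (p.root s - p.root t - (s - t) • ζ)
      rwa [sub_sub_cancel] at this
    rw [norm_smul, Real.norm_eq_abs] at this
    have := mul_le_mul_of_nonneg_left this hsn.le
    rw [mul_add, ← mul_assoc] at this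
    linarith
  have hD0 : 0 ≤ D := by positivity
  -- Twice the available lower bound for D, cut off at 0: it stays below 2D and is an admissible
  -- argument of the profile.
  set y := max 0 (2 * (S * ‖ζ‖ - δ)) with hy
  have hy0 : 0 ≤ y := le_max_left _ _
  have hyD : y ≤ 2 * D := max_le (by positivity) (by linarith)
  have hyc : y ≤ 4 * c * ‖ζ‖ := max_le (by positivity) (by nlinarith)
  have hyS : 2 * (S * ‖ζ‖) ≤ y + 2 * δ := by linarith [le_max_right 0 (2 * (S * ‖ζ‖ - δ))]
  set e := √(n : ℝ) * |ψ (p.law s) - ψ (p.law t)| with he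
  have he0 : 0 ≤ e := by positivity
  have hele : e ≤ σ * y + (2 * σ * δ + δ) := by
    have h3 : |ψ (p.law s) - ψ (p.law t)| ≤
        |ψ (p.law s) - ψ (p.law t) - (s - t) • b| + |s - t| * |b| := by
      rw [← abs_mul, ← smul_eq_mul]
      have := abs_add_le (ψ (p.law s) - ψ (p.law t) - (s - t) • b) ((s - t) • b)
      rwa [sub_add_cancel] at this
    have h4 := mul_le_mul_of_nonneg_left h3 hsn.le
    rw [mul_add, ← mul_assoc] at h4
    rw [Real.norm_eq_abs] at h2
    have h5 : S * |b| ≤ S * (σ * (2 * ‖ζ‖)) := mul_le_mul_of_nonneg_left hbσ hS0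
    nlinarith [mul_le_mul_of_nonneg_left hyS hσ0]
  -- The affinity is 1 - x with x half the squared distance, and 1 - x ≤ exp(-x).
  have hae : inner ℝ (p.root s) (p.root t) ^ n ≤ Real.exp (-(y ^ 2) / 8) := by
    have i1 := p.norm_root_sub_sq_eq s t
    calc inner ℝ (p.root s) (p.root t) ^ n
        ≤ Real.exp (-(‖p.root s - p.root t‖ ^ 2 / 2)) ^ n := by
          refine pow_le_pow_left₀ (p.inner_root_nonneg s t) ?_ n
          have := Real.add_one_le_exp (-(‖p.root s - p.root t‖ ^ 2 / 2))
          linarith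
      _ = Real.exp (-(D ^ 2 / 2)) := by
          rw [← Real.exp_nat_mul, hD, mul_pow, hn2]; ring_nf
      _ ≤ Real.exp (-(y ^ 2) / 8) := by
          apply Real.exp_le_exp.2
          nlinarith
  have hexp1 : Real.exp (-(y ^ 2) / 8) ≤ 1 := Real.exp_le_one_iff.2 (by nlinarith [sq_nonneg y])
  set E := Real.exp (-(y ^ 2) / 8) with hE
  have hprof : (-(1 / 4) + 1 / 2 * E) * y ^ 2 ≤ C := hC y hy0
  have hC0 : 0 ≤ C := by simpa [twoPointProfile] using hC 0 le_rfl
  have heq : (n : ℝ) * ((2 * inner ℝ (p.root s) (p.root t) ^ n - 1) / 4 *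
      (ψ (p.law s) - ψ (p.law t)) ^ 2) =
      (2 * inner ℝ (p.root s) (p.root t) ^ n - 1) / 4 * e ^ 2 := by
    rw [he, mul_pow, hn2, sq_abs]; ring
  rw [heq]
  have hδ' : 0 ≤ 2 * σ * δ + δ := by positivity
  set δ' := 2 * σ * δ + δ with hδdef
  have hw : (2 * inner ℝ (p.root s) (p.root t) ^ n - 1) / 4 ≤ -(1 / 4) + 1 / 2 * E := by linarith
  -- Upper bounds on the increment help only when the weight is positive; otherwise the term itself
  -- is nonpositive.
  rcases le_or_gt (-(1 / 4) + 1 / 2 * E) 0 with hneg | hpos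
  · have : (2 * inner ℝ (p.root s) (p.root t) ^ n - 1) / 4 * e ^ 2 ≤ 0 :=
      mul_nonpos_of_nonpos_of_nonneg (hw.trans hneg) (sq_nonneg e)
    refine this.trans ?_
    simp only [hr]
    positivity
  · have s1 : (2 * inner ℝ (p.root s) (p.root t) ^ n - 1) / 4 * e ^ 2 ≤
        (-(1 / 4) + 1 / 2 * E) * (σ * y + δ') ^ 2 :=
      mul_le_mul hw (pow_le_pow_left₀ he0 hele 2) (sq_nonneg e) hpos.le
    have s2 : (-(1 / 4) + 1 / 2 * E) * (σ * y + δ') ^ 2 =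
        (-(1 / 4) + 1 / 2 * E) * y ^ 2 * σ ^ 2 +
          (-(1 / 4) + 1 / 2 * E) * (2 * σ * y * δ' + δ' ^ 2) := by ring
    have s3 : (-(1 / 4) + 1 / 2 * E) * y ^ 2 * σ ^ 2 ≤ C * σ ^ 2 :=
      mul_le_mul_of_nonneg_right hprof (sq_nonneg σ)
    have s4 : (-(1 / 4) + 1 / 2 * E) * (2 * σ * y * δ' + δ' ^ 2) ≤
        1 / 4 * (2 * σ * (4 * c * ‖ζ‖) * δ' + δ' ^ 2) := by
      refine mul_le_mul (by linarith) ?_ (by positivity) (by norm_num)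
      gcongr
    simp only [hr]
    linarith

/-- Along the score ψdot one has ‖ζ‖ = σ/2 and slope σ². For the points y/(σ√n) and 0, n times the
squared distance tends to y²/4, so the affinity of the samples tends to exp(-y²/8), and √n times the
increment of ψ tends to σy. Every y ≥ 0 thus yields the profile at y times σ². -/
lemma le_asymptotic_twoPointBound [SigmaFinite ν]
    (hψ : HasEfficientInfluenceFunction ν ψ P₀ ψdot) {p : ParamPath ν}
    (hp : IsQMDPath P₀ ψdot p) {C : ℝ} (hC : IsLUB (twoPointProfile '' Ici 0) C) :
    ENNReal.ofReal (C * ∫ x, ψdot x ^ 2 ∂(P₀ : Measure X)) ≤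
      liminf (fun c : ℝ => liminf (fun n : ℕ => (n : ℝ≥0∞) * twoPointBound ψ p n c) atTop)
        atTop := by
  obtain ⟨ζ, hζ, hζn⟩ := hp.exists_hasDerivAt
  have hd := hψ.hasDerivAt hψ.tangent hp
  set b := ∫ x, ψdot x * hψ.tangent.1 x ∂(P₀ : Measure X) with hb
  set σ := √(∫ x, ψdot x ^ 2 ∂(P₀ : Measure X)) with hσ
  have hσ2 : σ ^ 2 = ∫ x, ψdot x ^ 2 ∂(P₀ : Measure X) :=
    Real.sq_sqrt (integral_nonneg fun x => sq_nonneg _)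
  have hbσ : b = σ ^ 2 := by rw [hσ2, hb]; simp only [HasEfficientInfluenceFunction.tangent, sq]
  rw [← hσ2]
  rcases eq_or_lt_of_le (show 0 ≤ σ from Real.sqrt_nonneg _) with h0 | hσ0
  · rw [← h0]; simp
  set V := liminf (fun c : ℝ => liminf (fun n : ℕ => (n : ℝ≥0∞) * twoPointBound ψ p n c) atTop)
        atTop with hV
  have key : ∀ y, 0 ≤ y → ENNReal.ofReal (twoPointProfile y * σ ^ 2) ≤ V := by
    intro y hy
    refine le_liminf_of_le (by isBoundedDefault) ?_
    -- This is exactly the condition for y/(σ√n) to lie in the local set.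
    filter_upwards [eventually_gt_atTop (y / σ)] with c hc
    have hc0 : 0 < c := (div_nonneg hy hσ0.le).trans_lt hc
    have l1 := tendsto_sqrt_smul_sub hζ (y / σ)
    have l2 := tendsto_sqrt_smul_sub hd (y / σ)
    have l3 : Tendsto (fun n : ℕ => (n : ℝ) * -(‖p.root (y / σ / √n) - p.root 0‖ ^ 2 / 2)) atTop
        (𝓝 (-(y ^ 2) / 8)) := by
      have := (l1.norm.pow 2).div_const (-2)
      refine (this.congr fun n => ?_).trans (le_of_eq ?_)
      · rw [norm_smul, mul_pow, Real.norm_eq_abs, sq_abs, Real.sq_sqrt (Nat.cast_nonneg n)]; ring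
      · congr 1
        rw [norm_smul, mul_pow, Real.norm_eq_abs, sq_abs]
        have : ‖ζ‖ = σ / 2 := by linarith
        have hσn : σ ≠ 0 := ne_of_gt hσ0
        rw [this]
        field_simp
        ring
    have l4 := Real.tendsto_one_add_pow_exp_of_tendsto l3
    have l5 : Tendsto (fun n : ℕ => ENNReal.ofReal
        ((2 * (1 + -(‖p.root (y / σ / √n) - p.root 0‖ ^ 2 / 2)) ^ n - 1) / 4 *
          (√(n : ℝ) • (ψ (p.law (y / σ / √n)) - ψ (p.law 0))) ^ 2)) atTop
        (𝓝 (ENNReal.ofReal (twoPointProfile y * σ ^ 2))) := by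
      refine ENNReal.tendsto_ofReal ?_
      have := (((l4.const_mul 2).sub_const 1).div_const 4).mul (l2.pow 2)
      refine this.trans (le_of_eq ?_)
      congr 1
      rw [hbσ, twoPointProfile, smul_eq_mul]
      field_simp
      ring
    rw [← l5.liminf_eq]
    refine liminf_le_liminf ?_
    filter_upwards [eventually_gt_atTop 0] with n hn
    have hsn : 0 < √(n : ℝ) := Real.sqrt_pos.2 (by exact_mod_cast hn)
    have m1 : y / σ / √n ∈ localSet n c := mem_localSet.2 (by
      rw [abs_of_nonneg (by positivity)]; gcongr)
    have m2 : (0 : ℝ) ∈ localSet n c := mem_localSet.2 (by rw [abs_zero]; positivity)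
    have hle : ENNReal.ofReal ((2 * inner ℝ (p.root (y / σ / √n)) (p.root 0) ^ n - 1) / 4 *
        (ψ (p.law (y / σ / √n)) - ψ (p.law 0)) ^ 2) ≤ twoPointBound ψ p n c := by
      rw [← two_point_term]
      exact le_iSup₂_of_le (f := fun t₁ (_ : t₁ ∈ localSet n c) => ⨆ t₂ ∈ localSet n c,
        (1 - hellingerSq (p.sampleLaw n t₁) (p.sampleLaw n t₂)) / 4 *
        ENNReal.ofReal ((ψ (p.law t₁) - ψ (p.law t₂)) ^ 2)) _ m1
        (le_iSup₂_of_le (f := fun t₂ (_ : t₂ ∈ localSet n c) =>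
        (1 - hellingerSq (p.sampleLaw n _) (p.sampleLaw n t₂)) / 4 *
        ENNReal.ofReal ((ψ (p.law _) - ψ (p.law t₂)) ^ 2)) _ m2 le_rfl)
    refine le_trans (le_of_eq ?_) (mul_le_mul_right hle _)
    rw [← ENNReal.ofReal_natCast, ← ENNReal.ofReal_mul (Nat.cast_nonneg n),
      ParamPath.norm_root_sub_sq_eq, smul_eq_mul, mul_pow, Real.sq_sqrt (Nat.cast_nonneg n)]
    congr 1
    ring_nf
  rcases eq_or_ne V ∞ with h | h
  · rw [h]; exact le_top
  refine ENNReal.ofReal_le_of_le_toReal ?_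
  rw [← le_div_iff₀ (by positivity)]
  refine hC.2 ?_
  rintro _ ⟨y, hy, rfl⟩
  rw [le_div_iff₀ (by positivity)]
  exact (ENNReal.ofReal_le_iff_le_toReal h).1 (key y hy)

end Path

/-! ### The numerical value of the two-point constant -/

lemma twoPointProfile_le (s : ℝ) : twoPointProfile s ≤ 0.289535 := by
  -- With y = s²/8 the profile is 4y·exp(-y) - 2y, which is stationary where exp y = 2(1 - y), that
  -- is, y ≈ 0.3149. The tangent of exp at that point reduces the claim to a quadratic inequality.
  have hE : (1.370121 : ℝ) ≤ Real.exp 0.3149 := by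
    refine le_trans ?_ (Real.sum_le_exp_of_nonneg (by norm_num) 9)
    simp only [Finset.sum_range_succ, Finset.sum_range_zero, Nat.factorial]
    norm_num
  set y := s ^ 2 / 8 with hy
  have hy0 : 0 ≤ y := by positivity
  have h1 : (1.370121 : ℝ) * (1 + (y - 0.3149)) ≤ Real.exp y := by
    have : Real.exp y = Real.exp 0.3149 * Real.exp (y - 0.3149) := by
      rw [← Real.exp_add]; congr 1; ring
    rw [this]
    refine mul_le_mul hE ?_ (by linarith) (Real.exp_pos _).le
    linarith [Real.add_one_le_exp (y - 0.3149)]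
  have h2 : 4 * y ≤ (2 * y + 0.289535) * Real.exp y := by
    refine le_trans ?_ (mul_le_mul_of_nonneg_left h1 (by positivity))
    nlinarith [sq_nonneg (y - 0.3149)]
  have h3 : 4 * y * Real.exp (-y) ≤ 2 * y + 0.289535 := by
    rw [Real.exp_neg, ← div_eq_mul_inv, div_le_iff₀ (Real.exp_pos _)]
    exact h2
  have h4 : twoPointProfile s = 4 * y * Real.exp (-y) - 2 * y := by
    rw [twoPointProfile, show -(s ^ 2) / 8 = -y by rw [hy]; ring, show s ^ 2 = 8 * y by rw [hy]; ring]
    ring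
  linarith

lemma exists_twoPointProfile_ge : ∃ s, 0 ≤ s ∧ 0.289525 ≤ twoPointProfile s := by
  refine ⟨√(8 * 0.3149), Real.sqrt_nonneg _, ?_⟩
  have hE : Real.exp 0.3149 ≤ 1.370123 := by
    refine le_trans (Real.exp_bound' (by norm_num) (by norm_num) (n := 9) (by norm_num)) ?_
    simp only [Finset.sum_range_succ, Finset.sum_range_zero, Nat.factorial]
    norm_num
  have h1 : (1 / 1.370123 : ℝ) ≤ Real.exp (-0.3149) := by
    rw [Real.exp_neg, ← one_div]
    exact one_div_le_one_div_of_le (Real.exp_pos _) hE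
  rw [twoPointProfile, Real.sq_sqrt (by norm_num),
    show -(8 * 0.3149 : ℝ) / 8 = -0.3149 by norm_num]
  norm_num at h1 ⊢
  linarith

lemma exists_isLUB_twoPointProfile :
    ∃ C : ℝ, |C - 0.28953| ≤ 0.000005 ∧ IsLUB (twoPointProfile '' Ici 0) C := by
  have hub : 0.289535 ∈ upperBounds (twoPointProfile '' Ici 0) := by
    rintro _ ⟨s, -, rfl⟩
    exact twoPointProfile_le s
  have hlub := isLUB_csSup (⟨_, mem_image_of_mem _ self_mem_Ici⟩ :
    (twoPointProfile '' Ici 0).Nonempty) ⟨_, hub⟩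
  refine ⟨_, ?_, hlub⟩
  obtain ⟨s, hs, h⟩ := exists_twoPointProfile_ge
  have h1 := hlub.1 (mem_image_of_mem twoPointProfile (show s ∈ Ici 0 from hs))
  have h2 := hlub.2 hub
  rw [abs_le]
  constructor <;> norm_num at * <;> linarith

/-! ### The chi-squared inequality for a mixture reference measure -/

lemma sq_rpow_half_sub_le {X Y R : ℝ≥0∞}
    (h : R ≠ ∞ → Y ≠ ∞ → X ≤ ENNReal.ofReal ((√R.toReal + √Y.toReal) ^ 2)) :
    (X ^ (1 / 2 : ℝ) - Y ^ (1 / 2 : ℝ)) ^ 2 ≤ R := by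
  rcases eq_or_ne R ∞ with hR | hR
  · rw [hR]; exact le_top
  -- An infinite approximation term makes the truncated difference 0.
  rcases eq_or_ne Y ∞ with hY | hY
  · rw [hY, ENNReal.top_rpow_of_pos (by norm_num)]; simp
  have half : ∀ Z : ℝ≥0∞, Z ≠ ∞ → Z ^ (1 / 2 : ℝ) = ENNReal.ofReal √Z.toReal := by
    intro Z hZ
    conv_lhs => rw [← ENNReal.ofReal_toReal hZ]
    rw [ENNReal.ofReal_rpow_of_nonneg ENNReal.toReal_nonneg (by norm_num), Real.sqrt_eq_rpow]
  have h1 : X ^ (1 / 2 : ℝ) ≤ R ^ (1 / 2 : ℝ) + Y ^ (1 / 2 : ℝ) := by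
    rw [half R hR, half Y hY, ← ENNReal.ofReal_add (Real.sqrt_nonneg _) (Real.sqrt_nonneg _)]
    refine (ENNReal.rpow_le_rpow (h hR hY) (by norm_num)).trans ?_
    rw [half _ ENNReal.ofReal_ne_top, ENNReal.toReal_ofReal (sq_nonneg _),
      Real.sqrt_sq (by positivity)]
  calc (X ^ (1 / 2 : ℝ) - Y ^ (1 / 2 : ℝ)) ^ 2 ≤ (R ^ (1 / 2 : ℝ)) ^ 2 := by
        gcongr
        exact tsub_le_iff_right.2 h1
    _ = R := by rw [← ENNReal.rpow_natCast, ← ENNReal.rpow_mul]; norm_num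

section Core
variable {Ω : Type*} [MeasurableSpace Ω]

lemma integral_add_sq_le {m : Measure Ω} {f g : Ω → ℝ} (hf : MemLp f 2 m) (hg : MemLp g 2 m) :
    ∫ x, (f x + g x) ^ 2 ∂m ≤ (√(∫ x, f x ^ 2 ∂m) + √(∫ x, g x ^ 2 ∂m)) ^ 2 := by
  have h := norm_add_le (hf.toLp f) (hg.toLp g)
  rw [← MemLp.toLp_add] at h
  have e := norm_sq_toLp (hf.add hg)
  rw [← Real.sqrt_sq (norm_nonneg (hf.toLp f)), ← Real.sqrt_sq (norm_nonneg (hg.toLp g)),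
    norm_sq_toLp, norm_sq_toLp] at h
  simp only [Pi.add_apply] at e
  rw [← e]
  exact pow_le_pow_left₀ (norm_nonneg _) h 2

/-- For the mixture M one has μ - M = (1 - l)(μ - η), so (1 - l) times the difference of the two
integrals is the M-integral of f(dμ/dM - 1), to which Cauchy-Schwarz applies. Finiteness of the
divergence makes dμ/dM square integrable, whence f is μ-integrable. -/
lemma integrable_and_sq_le_of_chiSq {μ η : Measure Ω} [IsProbabilityMeasure μ]
    [IsProbabilityMeasure η] {l : ℝ} (hl : l ∈ Icc (0 : ℝ) 1) {f : Ω → ℝ} (hη : Integrable f η)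
    (hM : MemLp f 2 (ENNReal.ofReal l • μ + ENNReal.ofReal (1 - l) • η))
    (hχ : chiSq μ (ENNReal.ofReal l • μ + ENNReal.ofReal (1 - l) • η) ≠ ∞) :
    Integrable f μ ∧ ENNReal.ofReal (((1 - l) * (∫ x, f x ∂μ - ∫ x, f x ∂η)) ^ 2) ≤
      (∫⁻ x, ENNReal.ofReal (f x ^ 2) ∂(ENNReal.ofReal l • μ + ENNReal.ofReal (1 - l) • η)) *
        chiSq μ (ENNReal.ofReal l • μ + ENNReal.ofReal (1 - l) • η) := by
  have fin1 : IsFiniteMeasure (ENNReal.ofReal l • μ) := μ.smul_finite ENNReal.ofReal_ne_top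
  have fin2 : IsFiniteMeasure (ENNReal.ofReal (1 - l) • η) := η.smul_finite ENNReal.ofReal_ne_top
  set M := ENNReal.ofReal l • μ + ENNReal.ofReal (1 - l) • η with hMdef
  have hac : μ ≪ M := by
    by_contra h
    exact hχ (by rw [chiSq, if_neg h])
  have hχe : chiSq μ M = ∫⁻ x, ENNReal.ofReal (((μ.rnDeriv M x).toReal - 1) ^ 2) ∂M := by
    rw [chiSq, if_pos hac]
  have hr : MemLp (fun x => (μ.rnDeriv M x).toReal - 1) 2 M := by
    refine memLp_two_of_lintegral_sq_lt_top
      ((μ.measurable_rnDeriv M).ennreal_toReal.sub_const 1).aestronglyMeasurable ?_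
    rw [← hχe]
    exact hχ.lt_top
  have hr1 : MemLp (fun x => (μ.rnDeriv M x).toReal) 2 M := by
    convert hr.add (memLp_const (1 : ℝ)) using 1
    ext x
    simp
  have hrf : Integrable (fun x => (μ.rnDeriv M x).toReal * f x) M := hr1.integrable_mul hM
  have hμ : Integrable f μ := (integrable_toReal_rnDeriv_mul_iff hac).1 hrf
  refine ⟨hμ, ?_⟩
  have hfM : Integrable f M := hM.integrable one_le_two
  have e1 : ∫ x, f x ∂M = l * ∫ x, f x ∂μ + (1 - l) * ∫ x, f x ∂η := by
    rw [hMdef, integral_add_measure (hμ.smul_measure ENNReal.ofReal_ne_top)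
      (hη.smul_measure ENNReal.ofReal_ne_top), integral_smul_measure, integral_smul_measure,
      ENNReal.toReal_ofReal hl.1, ENNReal.toReal_ofReal (by linarith [hl.2])]
    simp
  have e2 : (1 - l) * (∫ x, f x ∂μ - ∫ x, f x ∂η) =
      ∫ x, f x * ((μ.rnDeriv M x).toReal - 1) ∂M := by
    have : ∫ x, f x * ((μ.rnDeriv M x).toReal - 1) ∂M =
        ∫ x, (μ.rnDeriv M x).toReal * f x ∂M - ∫ x, f x ∂M := by
      rw [← integral_sub hrf hfM]
      refine integral_congr_ae (ae_of_all _ fun x => ?_)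
      simp only
      ring
    rw [this, integral_toReal_rnDeriv_mul hac, e1]
    ring
  rw [hχe, lintegral_sq_eq_ofReal hM, lintegral_sq_eq_ofReal hr, e2,
    ← ENNReal.ofReal_mul (integral_nonneg fun x => sq_nonneg _)]
  apply ENNReal.ofReal_le_ofReal
  have h := pow_le_pow_left₀ (abs_nonneg _) (abs_integral_mul_le hM hr) 2
  rwa [sq_abs, mul_pow, Real.sq_sqrt (integral_nonneg fun x => sq_nonneg _),
    Real.sq_sqrt (integral_nonneg fun x => sq_nonneg _)] at h

end Core

/-! ### The joint laws -/

section Joint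
variable {X : Type*} [MeasurableSpace X] {ν : Measure X} [SigmaFinite ν]

lemma measurable_jointDens (p : ParamPath ν) (n : ℕ) {φ : ℝ → ℝ} (hφ : Measurable φ) (h : ℝ) :
    Measurable fun z : (Fin n → X) × ℝ => (p.sample n).dens (φ (z.2 + h)) z.1 :=
  (p.sample n).measurable_dens.comp
    ((hφ.comp (measurable_snd.add_const h)).prodMk measurable_fst)

lemma jointLaw_eq_withDensity (p : ParamPath ν) (n : ℕ) (φ : ℝ → ℝ) (Q : ProbabilityMeasure ℝ)
    (h : ℝ) : jointLaw p n φ Q h =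
      ((Measure.pi fun _ : Fin n => ν).prod ((Q : Measure ℝ).map fun u => u - h)).withDensity
        fun z => ENNReal.ofReal ((p.sample n).dens (φ (z.2 + h)) z.1) := by
  unfold jointLaw
  congr 1
  ext z
  exact (ENNReal.ofReal_prod_of_nonneg fun i _ => p.dens_nonneg _ _).symm

lemma lintegral_jointLaw (p : ParamPath ν) (n : ℕ) {φ : ℝ → ℝ} (hφ : Measurable φ)
    (Q : ProbabilityMeasure ℝ) (h : ℝ) {F : (Fin n → X) × ℝ → ℝ≥0∞} (hF : Measurable F) :
    ∫⁻ z, F z ∂(jointLaw p n φ Q h) =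
      ∫⁻ u, ∫⁻ x, F (x, u - h) ∂((p.sample n).law (φ u) : Measure (Fin n → X)) ∂(Q : Measure ℝ) := by
  have hmap : IsProbabilityMeasure ((Q : Measure ℝ).map fun u => u - h) :=
    Measure.isProbabilityMeasure_map (by fun_prop)
  have hd := (measurable_jointDens p n hφ h).ennreal_ofReal
  rw [jointLaw_eq_withDensity, lintegral_withDensity_eq_lintegral_mul _ hd hF,
    lintegral_prod_symm' _ (hd.mul hF),
    lintegral_map ((hd.mul hF).lintegral_prod_left') (by fun_prop)]
  refine lintegral_congr fun u => ?_
  change _ = ∫⁻ x, F (x, u - h) ∂((Measure.pi fun _ : Fin n => ν).withDensity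
    fun x => ENNReal.ofReal ((p.sample n).dens (φ u) x))
  have hFu : Measurable fun x => F (x, u - h) := hF.comp (measurable_id.prodMk measurable_const)
  rw [lintegral_withDensity_eq_lintegral_mul _
    ((p.sample n).measurable_dens_right _).ennreal_ofReal hFu]
  simp [sub_add_cancel]

lemma isProbabilityMeasure_jointLaw (p : ParamPath ν) (n : ℕ) {φ : ℝ → ℝ} (hφ : Measurable φ)
    (Q : ProbabilityMeasure ℝ) (h : ℝ) : IsProbabilityMeasure (jointLaw p n φ Q h) := by
  refine ⟨?_⟩
  rw [← lintegral_one, lintegral_jointLaw p n hφ Q h measurable_const]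
  simp

/-- All joint laws are translates of a single one in the parameter coordinate, so integrals under
any of them become integrals under the unshifted law. -/
lemma jointLaw_eq_map (p : ParamPath ν) (n : ℕ) {φ : ℝ → ℝ} (hφ : Measurable φ)
    (Q : ProbabilityMeasure ℝ) (h : ℝ) :
    jointLaw p n φ Q h = (jointLaw p n φ Q 0).map fun z => (z.1, z.2 - h) := by
  have hm : Measurable fun z : (Fin n → X) × ℝ => (z.1, z.2 - h) := by fun_prop
  refine Measure.ext_of_lintegral _ fun F hF => ?_
  have hF' : Measurable fun z : (Fin n → X) × ℝ => F (z.1, z.2 - h) := hF.comp hm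
  rw [lintegral_map hF hm, lintegral_jointLaw p n hφ Q h hF, lintegral_jointLaw p n hφ Q 0 hF']
  simp

lemma map_snd_jointLaw_zero (p : ParamPath ν) (n : ℕ) {φ : ℝ → ℝ} (hφ : Measurable φ)
    (Q : ProbabilityMeasure ℝ) : (jointLaw p n φ Q 0).map Prod.snd = Q := by
  refine Measure.ext_of_lintegral _ fun F hF => ?_
  have hF' : Measurable fun z : (Fin n → X) × ℝ => F z.2 := hF.comp measurable_snd
  rw [lintegral_map hF measurable_snd, lintegral_jointLaw p n hφ Q 0 hF']
  simp

variable {ψ : ProbabilityMeasure X → ℝ}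

/-- A Bayes risk is at most the maximal risk. -/
lemma lintegral_sq_jointLaw_zero_le (p : ParamPath ν) (n : ℕ) {φ : ℝ → ℝ} (hφ : Measurable φ)
    (Q : ProbabilityMeasure ℝ) {T : (Fin n → X) → ℝ} (hT : Measurable T)
    (hψm : Measurable fun t => ψ (p.law t)) {S : Set ℝ} (hS : ∀ t, φ t ∈ S) :
    ∫⁻ z, ENNReal.ofReal ((T z.1 - ψ (p.law (φ z.2))) ^ 2) ∂(jointLaw p n φ Q 0) ≤
      ⨆ t ∈ S, ∫⁻ x, ENNReal.ofReal ((T x - ψ (p.law t)) ^ 2) ∂(p.sampleLaw n t) := by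
  have hχ : Measurable fun t => ψ (p.law (φ t)) := hψm.comp hφ
  have hF : Measurable fun z : (Fin n → X) × ℝ =>
      ENNReal.ofReal ((T z.1 - ψ (p.law (φ z.2))) ^ 2) :=
    (((hT.comp measurable_fst).sub (hχ.comp measurable_snd)).pow_const 2).ennreal_ofReal
  rw [lintegral_jointLaw p n hφ Q 0 hF]
  refine (lintegral_mono (g := fun _ => ⨆ t ∈ S, ∫⁻ x, ENNReal.ofReal ((T x - ψ (p.law t)) ^ 2)
    ∂(p.sampleLaw n t)) fun u => ?_).trans (by simp)
  simp only [sub_zero, ← p.sampleLaw_eq]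
  exact le_iSup₂ (f := fun t (_ : t ∈ S) => ∫⁻ x, ENNReal.ofReal ((T x - ψ (p.law t)) ^ 2)
      ∂(p.sampleLaw n t)) _ (hS u)

/-- The mixture inequality is applied to f(x,t) = T(x) - ψ(P_{φ(t)}). Under the unshifted law its
second moment is at most R; translation adds an increment of ψ, so under the shifted law Minkowski
gives (√R + √B)². The mixture of these two bounds is at most (√R + √(lB))². -/
lemma chiSqBound_le_localMinimaxRisk (p : ParamPath ν) (hψm : Measurable fun t => ψ (p.law t))
    (n : ℕ) (c : ℝ) : chiSqBound ψ p n c ≤ localMinimaxRisk ψ p n c := by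
  refine le_iInf₂ fun T hT => iSup₂_le fun φ hφd => iSup_le fun Q => iSup₂_le fun l hl =>
    iSup_le fun h => ?_
  have hφ : Measurable φ := hφd.2.1.continuous.measurable
  have hφS : ∀ t, φ t ∈ localSet n c := fun t => hφd.1.mapsTo (mem_univ t)
  have hχ : Measurable fun t => ψ (p.law (φ t)) := hψm.comp hφ
  have hA0 := lintegral_sq_jointLaw_zero_le p n hφ Q hT hψm hφS
  have pr0 := isProbabilityMeasure_jointLaw p n hφ Q 0
  have prh := isProbabilityMeasure_jointLaw p n hφ Q h
  set R := ⨆ t ∈ localSet n c, ∫⁻ x, ENNReal.ofReal ((T x - ψ (p.law t)) ^ 2) ∂(p.sampleLaw n t)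
    with hR
  refine sq_rpow_half_sub_le fun hRt hYt => ?_
  set f : (Fin n → X) × ℝ → ℝ := fun z => T z.1 - ψ (p.law (φ z.2)) with hf
  have hfm : Measurable f := (hT.comp measurable_fst).sub (hχ.comp measurable_snd)
  have hχh : Measurable fun t => ψ (p.law (φ t)) - ψ (p.law (φ (t - h))) :=
    hχ.sub (hχ.comp (measurable_id.sub_const h))
  have hχh' : Measurable fun z : (Fin n → X) × ℝ =>
      ψ (p.law (φ z.2)) - ψ (p.law (φ (z.2 - h))) := hχh.comp measurable_snd
  set B := meanSqIncrement ψ p φ Q h with hB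
  have hshift : Measurable fun z : (Fin n → X) × ℝ => (z.1, z.2 - h) := by fun_prop
  have hmapeq := jointLaw_eq_map p n hφ Q h
  have hsnd := map_snd_jointLaw_zero p n hφ Q
  have hf0 : MemLp f 2 (jointLaw p n φ Q 0) :=
    memLp_two_of_lintegral_sq_lt_top hfm.aestronglyMeasurable (hA0.trans_lt hRt.lt_top)
  have hfi0 : Integrable f (jointLaw p n φ Q 0) := hf0.integrable one_le_two
  have hr0 : ∫ z, f z ^ 2 ∂(jointLaw p n φ Q 0) ≤ R.toReal := by
    refine (ENNReal.ofReal_le_iff_le_toReal hRt).1 ?_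
    rw [← lintegral_sq_eq_ofReal hf0]
    exact hA0
  have hMbound : ∫⁻ z, ENNReal.ofReal (f z ^ 2) ∂(ENNReal.ofReal l • jointLaw p n φ Q h +
      ENNReal.ofReal (1 - l) • jointLaw p n φ Q 0) ≤
      ENNReal.ofReal ((√R.toReal + √(ENNReal.ofReal l * B).toReal) ^ 2) := by
    rw [lintegral_add_measure, lintegral_smul_measure, lintegral_smul_measure, smul_eq_mul,
      smul_eq_mul]
    -- For l = 0 the product l·B is 0 even when B is infinite, so finiteness of B can be inferred
    -- only for l > 0.
    rcases eq_or_lt_of_le hl.1 with h0 | h0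
    · simp only [← h0, ENNReal.ofReal_zero, zero_mul, sub_zero, ENNReal.ofReal_one, one_mul,
        zero_add, ENNReal.toReal_zero, Real.sqrt_zero, add_zero]
      rw [Real.sq_sqrt ENNReal.toReal_nonneg, ENNReal.ofReal_toReal hRt]
      exact hA0
    · have hBt : B ≠ ∞ := by
        intro hBt
        rw [hBt, ENNReal.mul_top (by simpa using h0)] at hYt
        exact hYt rfl
      have hB' : ∫⁻ z, ENNReal.ofReal ((ψ (p.law (φ z.2)) - ψ (p.law (φ (z.2 - h)))) ^ 2)
          ∂(jointLaw p n φ Q 0) = B := by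
        rw [hB, meanSqIncrement, ← hsnd, lintegral_map (hχh.pow_const 2).ennreal_ofReal measurable_snd]
      have hk : MemLp (fun z : (Fin n → X) × ℝ =>
          ψ (p.law (φ z.2)) - ψ (p.law (φ (z.2 - h)))) 2 (jointLaw p n φ Q 0) := by
        refine memLp_two_of_lintegral_sq_lt_top hχh'.aestronglyMeasurable ?_
        rw [hB']; exact hBt.lt_top
      have hkB : ∫ z, (ψ (p.law (φ z.2)) - ψ (p.law (φ (z.2 - h)))) ^ 2 ∂(jointLaw p n φ Q 0) =
          B.toReal := by
        rw [← hB', lintegral_sq_eq_ofReal hk,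
          ENNReal.toReal_ofReal (integral_nonneg fun z => sq_nonneg _)]
      have hAh : ∫⁻ z, ENNReal.ofReal (f z ^ 2) ∂(jointLaw p n φ Q h) ≤
          ENNReal.ofReal ((√R.toReal + √B.toReal) ^ 2) := by
        have e : ∫⁻ z, ENNReal.ofReal (f z ^ 2) ∂(jointLaw p n φ Q h) =
            ∫⁻ z, ENNReal.ofReal ((f z + (ψ (p.law (φ z.2)) - ψ (p.law (φ (z.2 - h))))) ^ 2)
              ∂(jointLaw p n φ Q 0) := by
          rw [hmapeq, lintegral_map (hfm.pow_const 2).ennreal_ofReal hshift]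
          refine lintegral_congr fun z => ?_
          simp only [hf]
          congr 2
          ring
        rw [e]
        refine (lintegral_sq_eq_ofReal (hf0.add hk)).trans_le ?_
        apply ENNReal.ofReal_le_ofReal
        refine (integral_add_sq_le hf0 hk).trans ?_
        rw [hkB]
        gcongr
      refine (add_le_add (mul_le_mul_right hAh _) (mul_le_mul_right hA0 _)).trans ?_
      rw [← ENNReal.ofReal_toReal hRt, ← ENNReal.ofReal_mul hl.1,
        ← ENNReal.ofReal_mul (by linarith [hl.2]),
        ← ENNReal.ofReal_add (mul_nonneg hl.1 (sq_nonneg _))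
          (mul_nonneg (by linarith [hl.2]) ENNReal.toReal_nonneg)]
      apply ENNReal.ofReal_le_ofReal
      rw [ENNReal.toReal_ofReal ENNReal.toReal_nonneg, ENNReal.toReal_mul,
        ENNReal.toReal_ofReal hl.1, Real.sqrt_mul hl.1]
      have hsq := Real.sq_sqrt (ENNReal.toReal_nonneg (a := R))
      have hsB := Real.sq_sqrt (ENNReal.toReal_nonneg (a := B))
      have hsl := Real.sq_sqrt hl.1
      have hl1 : √l ≤ 1 := Real.sqrt_le_one.2 hl.2
      -- This compares the cross terms: the mixture contributes 2√R√B·l, the target square 2√R√B·√l.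
      have hll : l ≤ √l := by nlinarith [Real.sqrt_nonneg l]
      have : l * (√R.toReal + √B.toReal) ^ 2 + (1 - l) * R.toReal =
          √R.toReal ^ 2 + 2 * (√R.toReal * √B.toReal) * l + l * √B.toReal ^ 2 := by
        nlinarith
      rw [this, show (√R.toReal + √l * √B.toReal) ^ 2 = √R.toReal ^ 2 +
        2 * (√R.toReal * √B.toReal) * √l + √l ^ 2 * √B.toReal ^ 2 by ring, hsl]
      gcongr
  set χ2 := chiSq (jointLaw p n φ Q h) (ENNReal.ofReal l • jointLaw p n φ Q h +
      ENNReal.ofReal (1 - l) • jointLaw p n φ Q 0) with hχ2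
  rcases eq_or_ne χ2 ∞ with ht | ht
  · rw [ht, ENNReal.div_top, mul_zero]; exact zero_le
  have hfM : MemLp f 2 (ENNReal.ofReal l • jointLaw p n φ Q h +
      ENNReal.ofReal (1 - l) • jointLaw p n φ Q 0) :=
    memLp_two_of_lintegral_sq_lt_top hfm.aestronglyMeasurable
      (hMbound.trans_lt ENNReal.ofReal_lt_top)
  obtain ⟨hfih, hcs⟩ := integrable_and_sq_le_of_chiSq hl hfi0 hfM ht
  -- After translation both integrals are over the same law, the estimator cancels, and only the
  -- marginal Q of the parameter matters.
  have hΔ : ∫ z, f z ∂(jointLaw p n φ Q h) - ∫ z, f z ∂(jointLaw p n φ Q 0) =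
      ∫ t, (ψ (p.law (φ t)) - ψ (p.law (φ (t - h)))) ∂(Q : Measure ℝ) := by
    rw [hmapeq] at hfih ⊢
    have hfs : Integrable (fun z : (Fin n → X) × ℝ => f (z.1, z.2 - h)) (jointLaw p n φ Q 0) :=
      hfih.comp_measurable hshift
    rw [integral_map hshift.aemeasurable hfm.aestronglyMeasurable,
      ← integral_sub hfs hfi0, ← hsnd,
      integral_map measurable_snd.aemeasurable hχh.aestronglyMeasurable]
    refine integral_congr_ae (ae_of_all _ fun z => ?_)
    simp only [hf]
    ring
  rw [meanIncrementSq, ← mul_div_assoc, ← ENNReal.ofReal_mul (sq_nonneg _), ← mul_pow, ← hΔ]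
  exact ENNReal.div_le_of_le_mul (hcs.trans (mul_le_mul_left hMbound _))

/-- At l = 1/2 the reference measure is the midpoint, whose chi-squared divergence is at most H².
The factor (1 - l)² = 1/4 matches the 4 in the Hellinger quotient, and B/2 ≤ B. -/
lemma hellingerBound_le_chiSqBound (p : ParamPath ν) (n : ℕ) (c : ℝ) :
    hellingerBound ψ p n c ≤ chiSqBound ψ p n c := by
  refine iSup₂_mono fun φ hφd => iSup_mono fun Q => ?_
  refine le_iSup₂_of_le (1 / 2) (by constructor <;> norm_num) (iSup_mono fun h => ?_)
  have hφ : Measurable φ := hφd.2.1.continuous.measurable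
  have pr0 := isProbabilityMeasure_jointLaw p n hφ Q 0
  have prh := isProbabilityMeasure_jointLaw p n hφ Q h
  have hχ := chiSq_midpoint_le_hellingerSq (jointLaw p n φ Q h) (jointLaw p n φ Q 0)
  have e1 : (1 - 1 / 2 : ℝ) = 1 / 2 := by norm_num
  rw [e1]
  gcongr ?_ ^ 2
  refine tsub_le_tsub (ENNReal.rpow_le_rpow ?_ (by norm_num))
    (ENNReal.rpow_le_rpow (mul_le_of_le_one_left' ?_) (by norm_num))
  · have e2 : ENNReal.ofReal ((1 / 2) ^ 2) = 4⁻¹ := by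
      rw [show ((1 / 2) ^ 2 : ℝ) = (4 : ℝ)⁻¹ by norm_num, ENNReal.ofReal_inv_of_pos (by norm_num)]
      norm_num
    rw [e2, div_eq_mul_inv, div_eq_mul_inv,
      ENNReal.mul_inv (Or.inl (by norm_num)) (Or.inl (by norm_num)), mul_left_comm]
    gcongr
  · exact ENNReal.ofReal_le_one.2 (by norm_num)

end Joint

/-! ### Asymptotics of the Hellinger mixture bound -/

/-- The density is a normalized squared tent: its root is Lipschitz with compact support, so a
translation by h costs O(h²) in squared Hellinger distance. For 0 ≤ h ≤ r both tents vanish off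
[-2r, 2r], whose length 4r enters K. -/
lemma exists_smooth_prior {r : ℝ} (hr : 0 < r) :
    ∃ (q : ℝ → ℝ) (K : ℝ), 0 < K ∧ Measurable q ∧ (∀ t, 0 ≤ q t) ∧
      ∫⁻ t, ENNReal.ofReal (q t) = 1 ∧ (∀ t, r < |t| → q t = 0) ∧
      ∀ h, 0 ≤ h → h ≤ r →
        ∫⁻ t, ENNReal.ofReal ((√(q t) - √(q (t + h))) ^ 2) ≤ ENNReal.ofReal (K * h ^ 2) := by
  set w : ℝ → ℝ := fun t => max (r - |t|) 0 with hw
  have hwc : Continuous w := by fun_prop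
  have hw0 : ∀ t, 0 ≤ w t := fun t => le_max_right _ _
  have hwr : ∀ t, r ≤ |t| → w t = 0 := fun t ht => max_eq_right (by linarith)
  have hsupp : HasCompactSupport fun t => w t ^ 2 := by
    refine HasCompactSupport.intro (isCompact_Icc (a := -r) (b := r)) fun t ht => ?_
    rw [hwr t, zero_pow two_ne_zero]
    by_contra h
    exact ht (abs_le.1 (not_le.1 h).le)
  have hint : Integrable fun t => w t ^ 2 := (hwc.pow 2).integrable_of_hasCompactSupport hsupp
  have hA : 0 < ∫ t, w t ^ 2 := by
    refine (hwc.pow 2).integral_pos_of_hasCompactSupport_nonneg_nonzero hsupp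
      (fun t => sq_nonneg _) (x := 0) ?_
    simp [hw, hr.ne', hr.le]
  set A := ∫ t, w t ^ 2 with hAdef
  have hsq : ∀ t, √(A⁻¹ * w t ^ 2) = √A⁻¹ * w t := fun t => by
    rw [Real.sqrt_mul (inv_nonneg.2 hA.le), Real.sqrt_sq (hw0 t)]
  refine ⟨fun t => A⁻¹ * w t ^ 2, A⁻¹ * (4 * r), by positivity, by fun_prop,
    fun t => by positivity, ?_, fun t ht => ?_, fun h h0 hhr => ?_⟩
  · rw [← ofReal_integral_eq_lintegral_ofReal (hint.const_mul _)
      (ae_of_all _ fun t => by positivity), integral_const_mul, inv_mul_cancel₀ hA.ne',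
      ENNReal.ofReal_one]
  · simp [hwr t ht.le]
  · have hlip : ∀ t, (w t - w (t + h)) ^ 2 ≤ h ^ 2 := by
      intro t
      rw [← sq_abs, ← sq_abs h]
      refine pow_le_pow_left₀ (abs_nonneg _) ?_ 2
      refine (abs_max_sub_max_le_abs _ _ _).trans ?_
      rw [show r - |t| - (r - |t + h|) = |t + h| - |t| by ring]
      refine (abs_abs_sub_abs_le _ _).trans ?_
      simp
    calc ∫⁻ t, ENNReal.ofReal ((√(A⁻¹ * w t ^ 2) - √(A⁻¹ * w (t + h) ^ 2)) ^ 2)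
        ≤ ∫⁻ t, (Icc (-(2 * r)) (2 * r)).indicator
            (fun _ => ENNReal.ofReal (A⁻¹ * h ^ 2)) t := by
          refine lintegral_mono fun t => ?_
          by_cases ht : t ∈ Icc (-(2 * r)) (2 * r)
          · rw [indicator_of_mem ht]
            apply ENNReal.ofReal_le_ofReal
            rw [hsq, hsq, ← mul_sub, mul_pow, Real.sq_sqrt (inv_nonneg.2 hA.le)]
            exact mul_le_mul_of_nonneg_left (hlip t) (inv_nonneg.2 hA.le)
          · rw [indicator_of_notMem ht]
            have h1 : 2 * r < |t| := by
              by_contra hh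
              exact ht (abs_le.1 (not_lt.1 hh))
            have h2 : r ≤ |t + h| := by
              have := abs_sub_abs_le_abs_sub t (-h)
              rw [sub_neg_eq_add, abs_neg, abs_of_nonneg h0] at this
              linarith
            simp [hwr t (by linarith), hwr _ h2]
      _ = ENNReal.ofReal (A⁻¹ * (4 * r) * h ^ 2) := by
          rw [lintegral_indicator measurableSet_Icc, setLIntegral_const, Real.volume_Icc,
            ← ENNReal.ofReal_mul (by positivity)]
          congr 1
          ring

section Joint
variable {X : Type*} [MeasurableSpace X] {ν : Measure X} [SigmaFinite ν]

lemma jointLaw_eq_withDensity_prod (p : ParamPath ν) (n : ℕ) {φ : ℝ → ℝ} (hφ : Measurable φ)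
    {q : ℝ → ℝ} (hq : Measurable q) (hq0 : ∀ t, 0 ≤ q t) {Q : ProbabilityMeasure ℝ}
    (hQ : (Q : Measure ℝ) = volume.withDensity fun t => ENNReal.ofReal (q t)) (h : ℝ) :
    jointLaw p n φ Q h = ((Measure.pi fun _ : Fin n => ν).prod volume).withDensity
      fun z => ENNReal.ofReal (q (z.2 + h) * (p.sample n).dens (φ (z.2 + h)) z.1) := by
  have hqh : Measurable fun t => ENNReal.ofReal (q (t + h)) :=
    (hq.comp (measurable_id.add_const h)).ennreal_ofReal
  have hmap : (Q : Measure ℝ).map (fun u => u - h) =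
      volume.withDensity fun t => ENNReal.ofReal (q (t + h)) := by
    refine Measure.ext_of_lintegral _ fun F hF => ?_
    have hF' : Measurable fun u => F (u - h) := hF.comp (measurable_id.sub_const h)
    rw [lintegral_map hF (by fun_prop), hQ,
      lintegral_withDensity_eq_lintegral_mul _ hq.ennreal_ofReal hF',
      lintegral_withDensity_eq_lintegral_mul _ hqh hF,
      ← lintegral_add_right_eq_self _ h]
    simp
  have hd := (measurable_jointDens p n hφ h).ennreal_ofReal
  have hq2 : Measurable fun z : (Fin n → X) × ℝ => ENNReal.ofReal (q (z.2 + h)) :=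
    hqh.comp measurable_snd
  rw [jointLaw_eq_withDensity, hmap, prod_withDensity_right hqh, ← withDensity_mul _ hq2 hd]
  congr 1
  ext z
  rw [Pi.mul_apply, ENNReal.ofReal_mul (hq0 _)]

/-- At a fixed parameter, `norm_smul_sub_smul_sq` separates the change of the prior from that of the
model. The model part carries the weight √q(t)√q(t+h) ≤ (q(t) + q(t+h))/2, which integrates to at
most 1. -/
lemma hellingerSq_jointLaw_le (p : ParamPath ν) (n : ℕ) {φ : ℝ → ℝ} (hφ : Measurable φ)
    {q : ℝ → ℝ} (hq : Measurable q) (hq0 : ∀ t, 0 ≤ q t) {Q : ProbabilityMeasure ℝ}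
    (hQ : (Q : Measure ℝ) = volume.withDensity fun t => ENNReal.ofReal (q t)) (h : ℝ) {β : ℝ}
    (hβ : ∀ t, ‖(p.sample n).root (φ t) - (p.sample n).root (φ (t + h))‖ ^ 2 ≤ β) :
    hellingerSq (jointLaw p n φ Q 0) (jointLaw p n φ Q h) ≤
      (∫⁻ t, ENNReal.ofReal ((√(q t) - √(q (t + h))) ^ 2)) + ENNReal.ofReal β := by
  have hβ0 : 0 ≤ β := (sq_nonneg _).trans (hβ 0)
  set m := (Measure.pi fun _ : Fin n => ν).prod (volume : Measure ℝ) with hm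
  have hqh : ∀ h, Measurable fun t => q (t + h) := fun h => hq.comp (measurable_id.add_const h)
  set F : ℝ → (Fin n → X) × ℝ → ℝ :=
    fun h z => q (z.2 + h) * (p.sample n).dens (φ (z.2 + h)) z.1 with hF
  have hFm : ∀ h, Measurable (F h) := fun h =>
    ((hqh h).comp measurable_snd).mul (measurable_jointDens p n hφ h)
  have hF0 : ∀ h z, 0 ≤ F h z := fun h z => mul_nonneg (hq0 _) ((p.sample n).dens_nonneg _ _)
  have hFi : ∀ h, ∫⁻ z, ENNReal.ofReal (F h z) ∂m ≠ ∞ := by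
    intro h
    have := isProbabilityMeasure_jointLaw p n hφ Q h
    have h1 := this.measure_univ
    rw [jointLaw_eq_withDensity_prod p n hφ hq hq0 hQ h, withDensity_apply _ MeasurableSet.univ,
      Measure.restrict_univ] at h1
    simp only [hF, hm]
    rw [h1]
    exact ENNReal.one_ne_top
  have hqone : ∀ h, ∫⁻ t, ENNReal.ofReal (q (t + h)) = 1 := by
    intro h
    have h1 := measure_univ (μ := (Q : Measure ℝ))
    rw [hQ, withDensity_apply _ MeasurableSet.univ, Measure.restrict_univ] at h1
    rw [← h1]
    exact lintegral_add_right_eq_self (fun t => ENNReal.ofReal (q t)) h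
  rw [jointLaw_eq_withDensity_prod p n hφ hq hq0 hQ 0, jointLaw_eq_withDensity_prod p n hφ hq hq0 hQ h]
  have hFF : Measurable fun z : (Fin n → X) × ℝ => ENNReal.ofReal ((√(F 0 z) - √(F h z)) ^ 2) :=
    (((hFm 0).sqrt.sub (hFm h).sqrt).pow_const 2).ennreal_ofReal
  refine (hellingerSq_withDensity (hFm 0) (hFm h) (hF0 0) (hF0 h) (hFi 0) (hFi h)).trans_le ?_
  rw [hm, lintegral_prod_symm' _ hFF]
  have hinner : ∀ t, ∫⁻ x, ENNReal.ofReal ((√(F 0 (x, t)) - √(F h (x, t))) ^ 2)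
      ∂(Measure.pi fun _ : Fin n => ν) ≤
      ENNReal.ofReal ((√(q t) - √(q (t + h))) ^ 2) +
        ENNReal.ofReal (β / 2) * (ENNReal.ofReal (q t) + ENNReal.ofReal (q (t + h))) := by
    intro t
    have m1 := (p.sample n).memLp_sqrt_dens (φ t)
    have m2 := (p.sample n).memLp_sqrt_dens (φ (t + h))
    have e : ∀ x, (√(F 0 (x, t)) - √(F h (x, t))) =
        √(q t) * √((p.sample n).dens (φ t) x) -
          √(q (t + h)) * √((p.sample n).dens (φ (t + h)) x) := by
      intro x
      simp only [hF, add_zero]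
      rw [Real.sqrt_mul (hq0 _), Real.sqrt_mul (hq0 _)]
    simp_rw [e]
    have e2 := lintegral_sq_eq_ofReal ((m1.const_mul √(q t)).sub (m2.const_mul √(q (t + h))))
    refine e2.trans_le ?_
    rw [← norm_sq_toLp ((m1.const_mul √(q t)).sub (m2.const_mul √(q (t + h)))),
      MemLp.toLp_sub (m1.const_mul √(q t)) (m2.const_mul √(q (t + h)))]
    change ENNReal.ofReal (‖√(q t) • (p.sample n).root (φ t) -
      √(q (t + h)) • (p.sample n).root (φ (t + h))‖ ^ 2) ≤ _
    rw [norm_smul_sub_smul_sq (ParamPath.norm_root _ _) (ParamPath.norm_root _ _),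
      ← ENNReal.ofReal_add (hq0 _) (hq0 _), ← ENNReal.ofReal_mul (by positivity),
      ← ENNReal.ofReal_add (sq_nonneg _) (by have := hq0 t; have := hq0 (t + h); positivity)]
    apply ENNReal.ofReal_le_ofReal
    refine add_le_add le_rfl ?_
    have h1 : √(q t) * √(q (t + h)) ≤ (q t + q (t + h)) / 2 := by
      nlinarith [sq_nonneg (√(q t) - √(q (t + h))), Real.sq_sqrt (hq0 t),
        Real.sq_sqrt (hq0 (t + h))]
    calc _ ≤ (q t + q (t + h)) / 2 * β :=
          mul_le_mul h1 (hβ t) (sq_nonneg _) (by have := hq0 t; have := hq0 (t + h); positivity)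
      _ = _ := by ring
  refine (lintegral_mono hinner).trans ?_
  have h0 := hqone 0
  simp only [add_zero] at h0
  rw [lintegral_add_right _ (by have := hqh h; fun_prop), lintegral_const_mul _ (by have := hqh h; fun_prop),
    lintegral_add_left hq.ennreal_ofReal, hqone h, h0]
  gcongr
  rw [show (1 + 1 : ℝ≥0∞) = ENNReal.ofReal 2 by norm_num, ← ENNReal.ofReal_mul (by positivity)]
  apply le_of_eq
  congr 1
  ring

end Joint

lemma isDiffeoOnto_arctan {n : ℕ} (hn : 0 < n) {c : ℝ} (hc : 0 < c) :
    IsDiffeoOnto (fun t => c / √n * (2 / Real.pi) * Real.arctan t) (localSet n c) := by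
  have hsn : 0 < √(n : ℝ) := Real.sqrt_pos.2 (by exact_mod_cast hn)
  set a := c / √(n : ℝ) * (2 / Real.pi) with ha
  have hpi := Real.pi_pos
  have ha0 : 0 < a := by positivity
  have hcn : c / √(n : ℝ) = a * (Real.pi / 2) := by rw [ha]; field_simp
  have hmem : ∀ s ∈ localSet n c, -(Real.pi / 2) < s / a ∧ s / a < Real.pi / 2 := by
    intro s hs
    rw [localSet, hcn] at hs
    rw [lt_div_iff₀ ha0, div_lt_iff₀ ha0]
    constructor <;> nlinarith [hs.1, hs.2]
  refine ⟨⟨fun t _ => ?_, fun s _ t _ hst => ?_, fun s hs => ?_⟩, ?_,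
    fun s => Real.tan (s / a), fun t => ?_, fun s hs => ?_⟩
  · rw [localSet, hcn]
    constructor <;> nlinarith [Real.arctan_lt_pi_div_two t, Real.neg_pi_div_two_lt_arctan t]
  · exact Real.arctan_injective (mul_left_cancel₀ ha0.ne' hst)
  · obtain ⟨h1, h2⟩ := hmem s hs
    refine ⟨Real.tan (s / a), mem_univ _, ?_⟩
    simp only
    rw [Real.arctan_tan h1 h2, mul_div_cancel₀ _ ha0.ne']
  · exact Real.differentiable_arctan.const_mul _
  · simp only
    rw [mul_div_cancel_left₀ _ ha0.ne', Real.tan_arctan]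
  · obtain ⟨h1, h2⟩ := hmem s hs
    have hcos : Real.cos (s / a) ≠ 0 := (Real.cos_pos_of_mem_Ioo ⟨h1, h2⟩).ne'
    have hd : DifferentiableAt ℝ (fun s => s / a) s := by fun_prop
    exact ((Real.differentiableAt_tan.2 hcos).comp s hd).differentiableWithinAt

lemma arctan_sub_le {s t : ℝ} (h : s ≤ t) : Real.arctan t - Real.arctan s ≤ t - s := by
  have := convex_univ.image_sub_le_mul_sub_of_deriv_le (f := Real.arctan) (C := 1)
    Real.continuous_arctan.continuousOn Real.differentiable_arctan.differentiableOn
    (fun x _ => by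
      rw [Real.deriv_arctan, div_le_one (by positivity)]
      nlinarith [sq_nonneg x]) s (mem_univ s) t (mem_univ t) h
  linarith

lemma le_arctan_sub {δ s t : ℝ} (hδ : 0 ≤ δ) (hs : s ∈ Icc (-√δ) √δ) (ht : t ∈ Icc (-√δ) √δ)
    (h : s ≤ t) : (1 - δ) * (t - s) ≤ Real.arctan t - Real.arctan s := by
  refine (convex_Icc (-√δ) √δ).mul_sub_le_image_sub_of_le_deriv (f := Real.arctan)
    Real.continuous_arctan.continuousOn Real.differentiable_arctan.differentiableOn
    (fun x hx => ?_) s hs t ht h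
  have hx' := interior_subset hx
  have hx2 : x ^ 2 ≤ δ := by
    have := abs_le.2 hx'
    rw [← sq_abs, ← Real.sq_sqrt hδ]
    gcongr
  rw [Real.deriv_arctan, le_div_iff₀ (by positivity)]
  nlinarith [mul_nonneg hδ (sq_nonneg x)]

section Asymp
variable {X : Type*} [MeasurableSpace X] {ν : Measure X} [SigmaFinite ν]
variable {P₀ : ProbabilityMeasure X} {ψ : ProbabilityMeasure X → ℝ} {ψdot : X → ℝ}

/-- The local set is parametrized by a scaled arctangent, and the prior lives so close to 0 that
this map is nearly linear there. With x = 2c/π the slope of √n·φ at 0, the increment is at least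
h(x(1 - δ)σ² - δ)/√n, and 4H² is at most h²(K + (xσ + 2δ)²), where K is the cost of translating the
prior. The shift h cancels from the quotient. `K` depends on δ through the prior but not on c, which
allows c → ∞ afterwards. -/
lemma le_liminf_hellingerBound {p : ParamPath ν} (hψm : Measurable fun t => ψ (p.law t))
    {ζ : Lp ℝ 2 ν} (hζ : HasDerivAt p.root ζ 0) {σ : ℝ} (hσ : 0 < σ) (hζn : 2 * ‖ζ‖ = σ)
    (hd : HasDerivAt (fun t => ψ (p.law t)) (σ ^ 2) 0) {δ : ℝ} (hδ : 0 < δ) (hδ1 : δ < 1) :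
    ∃ K : ℝ, 0 < K ∧ ∀ c : ℝ, 1 ≤ c * (2 / Real.pi) →
      0 ≤ c * (2 / Real.pi) * ((1 - δ) * σ ^ 2) - δ →
      ENNReal.ofReal ((c * (2 / Real.pi) * ((1 - δ) * σ ^ 2) - δ) /
        √(K + (c * (2 / Real.pi) * σ + 2 * δ) ^ 2) - δ * (σ ^ 2 + δ)) ^ 2 ≤
      liminf (fun n : ℕ => (n : ℝ≥0∞) * hellingerBound ψ p n c) atTop := by
  set r := √δ / 2 with hr
  have hr0 : 0 < r := by positivity
  have hr1 : r < 1 := by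
    have : √δ < 1 := (Real.sqrt_lt' one_pos).2 (by simpa using hδ1)
    rw [hr]; linarith
  obtain ⟨q, K, hK, hqm, hq0, hq1, hqr, hqh⟩ := exists_smooth_prior hr0
  set Q : ProbabilityMeasure ℝ := ⟨volume.withDensity fun t => ENNReal.ofReal (q t), ⟨by
    rw [withDensity_apply _ MeasurableSet.univ, Measure.restrict_univ, hq1]⟩⟩ with hQdef
  have hQ : (Q : Measure ℝ) = volume.withDensity fun t => ENNReal.ofReal (q t) := rfl
  refine ⟨4 * K, by positivity, fun c hc1 hA => ?_⟩
  have hpi := Real.pi_pos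
  set x := c * (2 / Real.pi) with hx
  have hx0 : 0 < x := by linarith
  have hc : 0 < c := by
    by_contra h
    have : x ≤ 0 := mul_nonpos_of_nonpos_of_nonneg (not_lt.1 h) (by positivity)
    linarith
  -- The quotient of increment and Hellinger distance is insensitive to h, while √B is proportional
  -- to hx. The choice gives hx ≤ δ, which makes √B negligible, and x ≥ 1 gives h ≤ r and h ≤ δ. The
  -- linearizations below have error δh, small compared with h itself.
  set h := δ * r / x with hh
  have hh0 : 0 < h := by positivity
  have hhr : h ≤ r := by
    rw [hh, div_le_iff₀ hx0]; nlinarith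
  have hhx : h * x ≤ δ := by
    rw [hh, div_mul_cancel₀ _ hx0.ne']; nlinarith
  have hh1 : h ≤ δ := by nlinarith
  set A := x * ((1 - δ) * σ ^ 2) - δ with hAdef
  refine le_liminf_of_le (by isBoundedDefault) ?_
  filter_upwards [eventually_sqrt_mul_norm_sub_le hζ hc (mul_pos hδ hh0),
    eventually_sqrt_mul_norm_sub_le hd hc (mul_pos hδ hh0), eventually_gt_atTop 0] with n h1 h2 hn
  have hn' : (0 : ℝ) < n := by exact_mod_cast hn
  have hsn : 0 < √(n : ℝ) := Real.sqrt_pos.2 hn'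
  have hn2 : √(n : ℝ) ^ 2 = n := Real.sq_sqrt hn'.le
  set φ : ℝ → ℝ := fun t => c / √n * (2 / Real.pi) * Real.arctan t with hφdef
  have hφd := isDiffeoOnto_arctan hn hc
  have hφ : Measurable φ := hφd.2.1.continuous.measurable
  have hφS : ∀ t, φ t ∈ localSet n c := fun t => hφd.1.mapsTo (mem_univ t)
  have hφdiff : ∀ s t, √(n : ℝ) * (φ t - φ s) = x * (Real.arctan t - Real.arctan s) := by
    intro s t
    simp only [hφdef, hx]
    field_simp
  have hup : ∀ t, 0 ≤ √(n : ℝ) * (φ (t + h) - φ t) ∧ √(n : ℝ) * (φ (t + h) - φ t) ≤ x * h := by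
    intro t
    rw [hφdiff]
    have i1 := arctan_sub_le (show t ≤ t + h by linarith)
    rw [add_sub_cancel_left] at i1
    have i2 := Real.arctan_strictMono.monotone (show t ≤ t + h by linarith)
    constructor
    · exact mul_nonneg hx0.le (by linarith)
    · exact mul_le_mul_of_nonneg_left i1 hx0.le
  -- the Hellinger distance between the joint laws
  have hβ : ∀ t, ‖(p.sample n).root (φ t) - (p.sample n).root (φ (t + h))‖ ^ 2 ≤
      (h * (x * σ / 2 + δ)) ^ 2 := by
    intro t
    refine pow_le_pow_left₀ (norm_nonneg _) ((p.norm_root_sample_sub_le n _ _).trans ?_) 2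
    have j1 := h1 _ (hφS (t + h)) _ (hφS t)
    have j2 : ‖p.root (φ (t + h)) - p.root (φ t)‖ ≤
        ‖p.root (φ (t + h)) - p.root (φ t) - (φ (t + h) - φ t) • ζ‖ +
          |φ (t + h) - φ t| * ‖ζ‖ := by
      rw [← Real.norm_eq_abs, ← norm_smul]
      have := norm_add_le (p.root (φ (t + h)) - p.root (φ t) - (φ (t + h) - φ t) • ζ)
        ((φ (t + h) - φ t) • ζ)
      rwa [sub_add_cancel] at this
    rw [norm_sub_rev]
    have j3 : √(n : ℝ) * |φ (t + h) - φ t| ≤ x * h := by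
      have e : √(n : ℝ) * |φ (t + h) - φ t| = √(n : ℝ) * (φ (t + h) - φ t) := by
        rw [abs_of_nonneg (nonneg_of_mul_nonneg_right (hup t).1 hsn)]
      rw [e]; exact (hup t).2
    calc _ ≤ √(n : ℝ) * ‖p.root (φ (t + h)) - p.root (φ t) - (φ (t + h) - φ t) • ζ‖ +
          √(n : ℝ) * |φ (t + h) - φ t| * ‖ζ‖ := by
          rw [mul_assoc, ← mul_add]; exact mul_le_mul_of_nonneg_left j2 hsn.le
      _ ≤ δ * h + x * h * ‖ζ‖ := by gcongr
      _ = h * (x * σ / 2 + δ) := by rw [← hζn]; ring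
  have hH : 4 * hellingerSq (jointLaw p n φ Q 0) (jointLaw p n φ Q h) ≤
      ENNReal.ofReal (h ^ 2 * (4 * K + (x * σ + 2 * δ) ^ 2)) := by
    refine (mul_le_mul_right ((hellingerSq_jointLaw_le p n hφ hqm hq0 hQ h hβ).trans
      (add_le_add_left (hqh h hh0.le hhr) _)) 4).trans ?_
    rw [← ENNReal.ofReal_add (by positivity) (by positivity),
      show (4 : ℝ≥0∞) = ENNReal.ofReal 4 by norm_num, ← ENNReal.ofReal_mul (by norm_num)]
    apply ENNReal.ofReal_le_ofReal
    apply le_of_eq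
    ring
  -- the increments of the functional
  set D : ℝ → ℝ := fun t => ψ (p.law (φ t)) - ψ (p.law (φ (t - h))) with hDdef
  have hDm : Measurable D :=
    (hψm.comp hφ).sub (hψm.comp (hφ.comp (measurable_id.sub_const h)))
  have hDexp : ∀ t, |√(n : ℝ) * D t - √(n : ℝ) * (φ t - φ (t - h)) * σ ^ 2| ≤ δ * h := by
    intro t
    have := h2 _ (hφS t) _ (hφS (t - h))
    rw [← abs_of_pos hsn, Real.norm_eq_abs, ← abs_mul, smul_eq_mul] at this
    have e : √(n : ℝ) * D t - √(n : ℝ) * (φ t - φ (t - h)) * σ ^ 2 =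
        √(n : ℝ) * (ψ (p.law (φ t)) - ψ (p.law (φ (t - h))) - (φ t - φ (t - h)) * σ ^ 2) := by
      rw [hDdef]
      ring
    rwa [e]
  have hDup : ∀ t, |√(n : ℝ) * D t| ≤ h * (x * σ ^ 2 + δ) := by
    intro t
    have i1 := hup (t - h)
    rw [sub_add_cancel] at i1
    have i2 := abs_le.1 (hDexp t)
    have i3 := mul_le_mul_of_nonneg_right i1.2 (sq_nonneg σ)
    have i4 := mul_nonneg i1.1 (sq_nonneg σ)
    rw [abs_le]
    constructor <;> nlinarith
  -- Since h ≤ r = √δ/2, both t and t - h lie in [-√δ, √δ], where arctan has slope at least 1 - δ.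
  have hDlow : ∀ t, |t| ≤ r → h * A ≤ √(n : ℝ) * D t := by
    intro t ht
    have i2 := abs_le.1 (hDexp t)
    have ht' := abs_le.1 ht
    have i3 := le_arctan_sub (s := t - h) (t := t) hδ.le
      ⟨by rw [show √δ = 2 * r by rw [hr]; ring]; linarith,
        by rw [show √δ = 2 * r by rw [hr]; ring]; linarith⟩
      ⟨by rw [show √δ = 2 * r by rw [hr]; ring]; linarith,
        by rw [show √δ = 2 * r by rw [hr]; ring]; linarith⟩ (by linarith)
    rw [sub_sub_cancel] at i3
    have i4 := mul_le_mul_of_nonneg_right (mul_le_mul_of_nonneg_left i3 hx0.le) (sq_nonneg σ)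
    rw [← hφdiff] at i4
    rw [hAdef]
    nlinarith
  have hDi : Integrable (fun t => √(n : ℝ) * D t) (Q : Measure ℝ) :=
    Integrable.of_bound (hDm.const_mul _).aestronglyMeasurable _ (ae_of_all _ hDup)
  have hsupp : ∀ᵐ t ∂(Q : Measure ℝ), |t| ≤ r := by
    rw [hQ, ae_withDensity_iff hqm.ennreal_ofReal]
    refine ae_of_all _ fun t ht => ?_
    by_contra hcon
    exact ht (by rw [hqr t (not_le.1 hcon), ENNReal.ofReal_zero])
  have hΔ : h * A ≤ √(n : ℝ) * ∫ t, D t ∂(Q : Measure ℝ) := by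
    rw [← integral_const_mul]
    calc h * A = ∫ _, h * A ∂(Q : Measure ℝ) := by simp
      _ ≤ _ := integral_mono_ae (integrable_const _) hDi (by
        filter_upwards [hsupp] with t ht using hDlow t ht)
  have hB : (n : ℝ≥0∞) * meanSqIncrement ψ p φ Q h ≤
      ENNReal.ofReal ((h * (x * σ ^ 2 + δ)) ^ 2) := by
    rw [meanSqIncrement, ← ENNReal.ofReal_natCast, ← lintegral_const_mul' _ _ ENNReal.ofReal_ne_top]
    refine (lintegral_mono (g := fun _ => ENNReal.ofReal ((h * (x * σ ^ 2 + δ)) ^ 2))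
      fun t => ?_).trans (by simp)
    simp only
    rw [← ENNReal.ofReal_mul hn'.le, ← hn2, ← mul_pow]
    apply ENNReal.ofReal_le_ofReal
    rw [← sq_abs]
    exact pow_le_pow_left₀ (abs_nonneg _) (hDup t) 2
  have hAn : (n : ℝ≥0∞) * meanIncrementSq ψ p φ Q h ≥ ENNReal.ofReal ((h * A) ^ 2) := by
    rw [meanIncrementSq, ← ENNReal.ofReal_natCast, ← ENNReal.ofReal_mul hn'.le, ← hn2, ← mul_pow]
    apply ENNReal.ofReal_le_ofReal
    exact pow_le_pow_left₀ (by positivity) hΔ 2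
  have sqrt_ofReal : ∀ z : ℝ, 0 ≤ z → ENNReal.ofReal (z ^ 2) ^ (1 / 2 : ℝ) = ENNReal.ofReal z := by
    intro z hz
    rw [ENNReal.ofReal_rpow_of_nonneg (sq_nonneg z) (by norm_num), ← Real.sqrt_eq_rpow,
      Real.sqrt_sq hz]
  set den := 4 * K + (x * σ + 2 * δ) ^ 2 with hden
  have hden0 : 0 < den := by positivity
  have t1 : ENNReal.ofReal (A / √den) ≤
      ((n : ℝ≥0∞) * (meanIncrementSq ψ p φ Q h /
        (4 * hellingerSq (jointLaw p n φ Q 0) (jointLaw p n φ Q h)))) ^ (1 / 2 : ℝ) := by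
    rw [← sqrt_ofReal (A / √den) (by positivity)]
    refine ENNReal.rpow_le_rpow ?_ (by norm_num)
    rw [← mul_div_assoc]
    refine le_trans ?_ (ENNReal.div_le_div hAn hH)
    rw [← ENNReal.ofReal_div_of_pos (by positivity)]
    apply ENNReal.ofReal_le_ofReal
    rw [div_pow, Real.sq_sqrt hden0.le, mul_pow, mul_div_mul_left _ _ (by positivity)]
  have t2 : ((n : ℝ≥0∞) * meanSqIncrement ψ p φ Q h) ^ (1 / 2 : ℝ) ≤
      ENNReal.ofReal (δ * (σ ^ 2 + δ)) := by
    refine (ENNReal.rpow_le_rpow hB (by norm_num)).trans ?_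
    rw [sqrt_ofReal _ (by positivity)]
    apply ENNReal.ofReal_le_ofReal
    nlinarith [mul_le_mul_of_nonneg_right hhx (sq_nonneg σ)]
  have hle : ((meanIncrementSq ψ p φ Q h /
        (4 * hellingerSq (jointLaw p n φ Q 0) (jointLaw p n φ Q h))) ^ (1 / 2 : ℝ) -
      (meanSqIncrement ψ p φ Q h) ^ (1 / 2 : ℝ)) ^ 2 ≤ hellingerBound ψ p n c :=
    le_iSup₂_of_le φ hφd (le_iSup₂_of_le (f := fun (Q : ProbabilityMeasure ℝ) (h : ℝ) =>
      ((meanIncrementSq ψ p φ Q h /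
        (4 * hellingerSq (jointLaw p n φ Q 0) (jointLaw p n φ Q h))) ^ (1 / 2 : ℝ) -
      (meanSqIncrement ψ p φ Q h) ^ (1 / 2 : ℝ)) ^ 2) Q h le_rfl)
  refine le_trans ?_ (mul_le_mul_right hle _)
  rw [ENNReal.ofReal_sub _ (by positivity)]
  refine (pow_le_pow_left' (tsub_le_tsub t1 t2) 2).trans (le_of_eq ?_)
  rw [ENNReal.mul_rpow_of_nonneg _ _ (by norm_num), ENNReal.mul_rpow_of_nonneg _ _ (by norm_num),
    ← ENNReal.mul_sub (fun _ _ => by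
      exact ENNReal.rpow_ne_top_of_nonneg (by norm_num) (ENNReal.natCast_ne_top n)), mul_pow]
  congr 1
  rw [← ENNReal.rpow_natCast, ← ENNReal.rpow_mul]
  norm_num

/-- Substitute y = 1/x. The prior term K drops out as the local radius grows. -/
lemma tendsto_mul_sub_div_sqrt {a σ : ℝ} (hσ : 0 < σ) (δ K : ℝ) :
    Tendsto (fun x : ℝ => (x * a - δ) / √(K + (x * σ + 2 * δ) ^ 2)) atTop (𝓝 (a / σ)) := by
  have h1 : ContinuousAt (fun y : ℝ => (a - δ * y) / √(K * y ^ 2 + (σ + 2 * δ * y) ^ 2)) 0 := by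
    refine ContinuousAt.div (by fun_prop) (by fun_prop) ?_
    simp [Real.sqrt_sq hσ.le, hσ.ne']
  have h2 := h1.tendsto.comp tendsto_inv_atTop_zero
  simp only [mul_zero, sub_zero, add_zero, ne_eq, OfNat.ofNat_ne_zero, not_false_eq_true, zero_pow,
    zero_add, Real.sqrt_sq hσ.le] at h2
  refine h2.congr' ?_
  filter_upwards [eventually_gt_atTop 0] with x hx
  simp only [Function.comp]
  have e : K + (x * σ + 2 * δ) ^ 2 = x ^ 2 * (K * x⁻¹ ^ 2 + (σ + 2 * δ * x⁻¹) ^ 2) := by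
    field_simp
  rw [e, Real.sqrt_mul (sq_nonneg x), Real.sqrt_sq hx.le,
    show x * a - δ = x * (a - δ * x⁻¹) by field_simp, mul_div_mul_left _ _ hx.ne']

/-- Letting c → ∞ at fixed δ leaves (1 - δ)σ - δ(σ² + δ) inside the square; then δ → 0. -/
lemma le_asymptotic_hellingerBound (hψ : HasEfficientInfluenceFunction ν ψ P₀ ψdot)
    {p : ParamPath ν} (hp : IsQMDPath P₀ ψdot p) (hψm : Measurable fun t => ψ (p.law t)) :
    ENNReal.ofReal (∫ x, ψdot x ^ 2 ∂(P₀ : Measure X)) ≤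
      liminf (fun c : ℝ => liminf (fun n : ℕ => (n : ℝ≥0∞) * hellingerBound ψ p n c) atTop)
        atTop := by
  obtain ⟨ζ, hζ, hζn⟩ := hp.exists_hasDerivAt
  have hd := hψ.hasDerivAt hψ.tangent hp
  set σ := √(∫ x, ψdot x ^ 2 ∂(P₀ : Measure X)) with hσ
  have hσ2 : σ ^ 2 = ∫ x, ψdot x ^ 2 ∂(P₀ : Measure X) :=
    Real.sq_sqrt (integral_nonneg fun x => sq_nonneg _)
  have hb : ∫ x, ψdot x * hψ.tangent.1 x ∂(P₀ : Measure X) = σ ^ 2 := by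
    rw [hσ2]; simp only [HasEfficientInfluenceFunction.tangent, sq]
  rw [hb] at hd
  rw [← hσ2]
  rcases eq_or_lt_of_le (show 0 ≤ σ from Real.sqrt_nonneg _) with h0 | hσ0
  · rw [← h0]; simp
  have hlim : Tendsto (fun δ : ℝ => ENNReal.ofReal ((1 - δ) * σ ^ 2 / σ - δ * (σ ^ 2 + δ)) ^ 2)
      (𝓝[>] 0) (𝓝 (ENNReal.ofReal (σ ^ 2))) := by
    rw [ENNReal.ofReal_pow hσ0.le]
    refine ((ENNReal.continuous_pow 2).tendsto _).comp (ENNReal.tendsto_ofReal ?_)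
    have : Continuous fun δ : ℝ => (1 - δ) * σ ^ 2 / σ - δ * (σ ^ 2 + δ) := by fun_prop
    refine ((this.tendsto 0).mono_left nhdsWithin_le_nhds).trans (le_of_eq ?_)
    congr 1
    field_simp
    ring
  refine le_of_tendsto hlim ?_
  filter_upwards [Ioo_mem_nhdsGT (show (0 : ℝ) < 1 from one_pos)] with δ hδ
  obtain ⟨K, -, hK⟩ := le_liminf_hellingerBound hψm hζ hσ0 hζn hd hδ.1 hδ.2
  have hx : Tendsto (fun c : ℝ => c * (2 / Real.pi)) atTop atTop :=
    tendsto_id.atTop_mul_const (by have := Real.pi_pos; positivity)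
  have hA : Tendsto (fun c : ℝ => c * (2 / Real.pi) * ((1 - δ) * σ ^ 2)) atTop atTop :=
    hx.atTop_mul_const (by have := hδ.2; have : 0 < 1 - δ := by linarith
                           positivity)
  have hl := ((tendsto_mul_sub_div_sqrt (a := (1 - δ) * σ ^ 2) hσ0 δ K).comp hx).sub_const
    (δ * (σ ^ 2 + δ))
  have hl' := ((ENNReal.continuous_pow 2).tendsto _).comp (ENNReal.tendsto_ofReal hl)
  rw [← hl'.liminf_eq]
  refine liminf_le_liminf ?_
  filter_upwards [hx.eventually_ge_atTop 1, hA.eventually_ge_atTop δ] with c h1 h2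
  exact hK c h1 (by linarith)

end Asymp

/-! ### The bounded paths are differentiable in quadratic mean -/

lemma abs_sqrt_sub_one_le {a : ℝ} (ha : 0 ≤ a) : |√a - 1| ≤ |a - 1| := by
  have h : a - 1 = (√a - 1) * (√a + 1) := by
    have := Real.sq_sqrt ha
    nlinarith
  rw [h, abs_mul]
  refine le_mul_of_one_le_right (abs_nonneg _) ?_
  rw [abs_of_nonneg (by positivity)]
  linarith [Real.sqrt_nonneg a]

section Kappa
variable {κ : ℝ → ℝ} {K : ℝ}

lemma abs_kappa_sub_one_le (hd : Differentiable ℝ κ) (h0 : κ 0 = 1) (h1 : ∀ s, |deriv κ s| ≤ K)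
    (s : ℝ) : |κ s - 1| ≤ K * |s| := by
  have := convex_univ.norm_image_sub_le_of_norm_deriv_le (f := κ) (C := K)
    (fun x _ => hd x) (fun x _ => h1 x) (mem_univ 0) (mem_univ s)
  simpa [h0] using this

lemma abs_kappa_sub_le (hd : Differentiable ℝ κ) (hd2 : Differentiable ℝ (deriv κ)) (h0 : κ 0 = 1)
    (h01 : deriv κ 0 = 1) (h2 : ∀ s, |deriv (deriv κ) s| ≤ K) (s : ℝ) :
    |κ s - 1 - s| ≤ K * s ^ 2 := by
  have e1 : ∀ x, |deriv κ x - 1| ≤ K * |x| := fun x => by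
    have := convex_univ.norm_image_sub_le_of_norm_deriv_le (f := deriv κ) (C := K)
      (fun x _ => hd2 x) (fun x _ => h2 x) (mem_univ 0) (mem_univ x)
    simpa [h01] using this
  have hder : ∀ x, HasDerivAt (fun x => κ x - x) (deriv κ x - 1) x := fun x =>
    (hd x).hasDerivAt.sub (hasDerivAt_id x)
  have hK : 0 ≤ K := (abs_nonneg _).trans (h2 0)
  have := (convex_closedBall (0 : ℝ) |s|).norm_image_sub_le_of_norm_deriv_le
    (f := fun x => κ x - x) (C := K * |s|) (fun x _ => (hder x).differentiableAt)
    (fun x hx => by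
      rw [(hder x).deriv]
      refine (e1 x).trans ?_
      rw [mem_closedBall_zero_iff] at hx
      exact mul_le_mul_of_nonneg_left hx hK) (x := 0) (y := s) (by simp) (by simp)
  simp only [h0, sub_zero, Real.norm_eq_abs] at this
  rw [mul_assoc, ← sq, sq_abs] at this
  convert this using 2
  ring

variable {X : Type*} [MeasurableSpace X] {P : Measure X} [IsProbabilityMeasure P]

/-- Without the normalizing constant, the remainder is o(h²) by dominated convergence and the chain
rule for √κ at 0. The constant satisfies C_h - 1 = O(h²), because g has mean zero and κ'' is
bounded, so it contributes only O(h⁴). -/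
lemma isLittleO_sqrt_kappa (hκ0 : ∀ s, 0 ≤ κ s) (hd : Differentiable ℝ κ)
    (hd2 : Differentiable ℝ (deriv κ)) (h0 : κ 0 = 1) (h01 : deriv κ 0 = 1)
    (h1 : ∀ s, |deriv κ s| ≤ K) (h2 : ∀ s, |deriv (deriv κ) s| ≤ K) {g : X → ℝ}
    (hgm : Measurable g) (hg : MemLp g 2 P) (hg0 : ∫ x, g x ∂P = 0) :
    (fun h : ℝ => ∫ x, (√(κ (h * g x) / ∫ y, κ (h * g y) ∂P) - 1 - 1 / 2 * (h * g x)) ^ 2 ∂P)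
      =o[𝓝 0] fun h : ℝ => h ^ 2 := by
  have hK : 0 ≤ K := (abs_nonneg _).trans (h2 0)
  have hg1 : Integrable g P := hg.integrable one_le_two
  have hg2 : Integrable (fun x => g x ^ 2) P := hg.integrable_sq
  have hκm : Measurable κ := hd.continuous.measurable
  have hkm : ∀ h : ℝ, Measurable fun x => κ (h * g x) := fun h => hκm.comp (hgm.const_mul h)
  have hki : ∀ h : ℝ, Integrable (fun x => κ (h * g x)) P := by
    intro h
    refine ((hg1.abs.const_mul (K * |h|)).add (integrable_const 1)).mono'
      (hkm h).aestronglyMeasurable (ae_of_all _ fun x => ?_)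
    have := abs_kappa_sub_one_le hd h0 h1 (h * g x)
    rw [abs_mul] at this
    have h3 := abs_le.1 this
    rw [Real.norm_eq_abs, abs_of_nonneg (hκ0 _)]
    simp only [Pi.add_apply]
    linarith
  set C : ℝ → ℝ := fun h => ∫ y, κ (h * g y) ∂P with hC
  have hC1 : ∀ h, |C h - 1| ≤ K * (∫ x, g x ^ 2 ∂P) * h ^ 2 := by
    intro h
    have hk1 : Integrable (fun x => κ (h * g x) - 1) P := (hki h).sub (integrable_const 1)
    have e : C h - 1 = ∫ x, (κ (h * g x) - 1 - h * g x) ∂P := by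
      rw [integral_sub hk1 (hg1.const_mul h),
        integral_sub (hki h) (integrable_const 1), integral_const_mul, hg0]
      simp [hC]
    rw [e, ← Real.norm_eq_abs]
    refine (norm_integral_le_of_norm_le (hg2.const_mul (K * h ^ 2)) (ae_of_all _ fun x => ?_)).trans
      (le_of_eq ?_)
    · refine (abs_kappa_sub_le hd hd2 h0 h01 h2 (h * g x)).trans (le_of_eq ?_)
      ring
    · rw [integral_const_mul]; ring
  have hCcont : Tendsto C (𝓝 0) (𝓝 1) := by
    rw [tendsto_iff_norm_sub_tendsto_zero]
    refine squeeze_zero (fun _ => norm_nonneg _) (fun h => hC1 h) ?_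
    have : Continuous fun h : ℝ => K * (∫ x, g x ^ 2 ∂P) * h ^ 2 := by fun_prop
    simpa using this.tendsto 0
  have hsq : ∀ h, MemLp (fun x => √(κ (h * g x))) 2 P := by
    intro h
    rw [memLp_two_iff_integrable_sq (hkm h).sqrt.aestronglyMeasurable]
    simpa only [Real.sq_sqrt (hκ0 _)] using hki h
  set I₁ : ℝ → ℝ := fun h => ∫ x, (√(κ (h * g x)) - 1 - 1 / 2 * (h * g x)) ^ 2 ∂P with hI₁
  have hrem : ∀ h, MemLp (fun x => √(κ (h * g x)) - 1 - 1 / 2 * (h * g x)) 2 P := fun h =>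
    ((hsq h).sub (memLp_const 1)).sub ((hg.const_mul h).const_mul (1 / 2))
  have hI₁o : I₁ =o[𝓝 0] fun h : ℝ => h ^ 2 := by
    refine (Asymptotics.isLittleO_iff_tendsto fun h hh => ?_).2 ?_
    · have : h = 0 := by simpa using hh
      simp [hI₁, this, h0]
    · have e : ∀ h, I₁ h / h ^ 2 =
          ∫ x, ((√(κ (h * g x)) - 1 - 1 / 2 * (h * g x)) / h) ^ 2 ∂P := by
        intro h
        simp only [hI₁, div_pow]
        rw [integral_div]
      simp_rw [e]
      have hz : ∫ _ : X, (0 : ℝ) ∂P = 0 := integral_zero _ _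
      nth_rewrite 2 [← hz]
      -- The dominating function comes from |√κ(hg) - 1| ≤ |κ(hg) - 1| ≤ K|hg|.
      refine tendsto_integral_filter_of_dominated_convergence
        (fun x => ((K + 1 / 2) ^ 2) * g x ^ 2) (Eventually.of_forall fun h => ?_)
        (Eventually.of_forall fun h => ae_of_all _ fun x => ?_) (hg2.const_mul _)
        (ae_of_all _ fun x => ?_)
      · exact ((((hkm h).sqrt.sub_const 1).sub ((hgm.const_mul h).const_mul (1 / 2))).div_const
          h |>.pow_const 2).aestronglyMeasurable
      · rw [Real.norm_eq_abs, abs_of_nonneg (sq_nonneg _), ← mul_pow, ← sq_abs,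
          ← sq_abs ((K + 1 / 2) * g x), abs_div, abs_mul, abs_of_nonneg (by positivity : 0 ≤ K + 1 / 2)]
        refine pow_le_pow_left₀ (by positivity) ?_ 2
        refine div_le_of_le_mul₀ (abs_nonneg _) (by positivity) ?_
        refine (abs_sub _ _).trans ?_
        have i1 := (abs_sqrt_sub_one_le (hκ0 (h * g x))).trans
          (abs_kappa_sub_one_le hd h0 h1 (h * g x))
        rw [abs_mul] at i1
        have i2 : |1 / 2 * (h * g x)| = 1 / 2 * (|h| * |g x|) := by
          rw [abs_mul, abs_mul, abs_of_pos (by norm_num : (0 : ℝ) < 1 / 2)]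
        rw [i2]
        nlinarith
      · have hder : HasDerivAt (fun h : ℝ => √(κ (h * g x))) (1 / 2 * g x) 0 := by
          have a1 : HasDerivAt κ 1 (0 * g x) := by
            rw [zero_mul, ← h01]; exact (hd 0).hasDerivAt
          have a2 : HasDerivAt (fun h : ℝ => h * g x) (g x) 0 := by
            simpa using (hasDerivAt_id (0 : ℝ)).mul_const (g x)
          have a3 := (a1.comp 0 a2).sqrt (by simp [h0])
          simp only [Function.comp, zero_mul, h0, Real.sqrt_one] at a3
          convert a3 using 1
          ring
        have ho := hasDerivAt_iff_isLittleO_nhds_zero.1 hder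
        have ht := (ho.tendsto_div_nhds_zero).pow 2
        simp only [zero_add, zero_mul, h0, Real.sqrt_one, smul_eq_mul] at ht
        rw [zero_pow two_ne_zero] at ht
        refine ht.congr fun h => ?_
        ring_nf
  have hCo : (fun h => 2 * (C h - 1) ^ 2) =o[𝓝 0] fun h : ℝ => h ^ 2 := by
    have o1 : (fun h => C h - 1) =O[𝓝 0] fun h : ℝ => h ^ 2 := by
      refine Asymptotics.IsBigO.of_bound (K * ∫ x, g x ^ 2 ∂P) (Eventually.of_forall fun h => ?_)
      rw [Real.norm_eq_abs, Real.norm_eq_abs, abs_of_nonneg (sq_nonneg h)]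
      exact hC1 h
    have o2 : (fun h : ℝ => h ^ 2) =o[𝓝 0] fun h : ℝ => h := by
      simpa using Asymptotics.isLittleO_pow_pow (𝕜 := ℝ) (m := 1) (n := 2) (by norm_num)
    exact ((o1.trans_isLittleO o2).pow two_pos).const_mul_left 2
  refine Asymptotics.IsBigO.trans_isLittleO (g := fun h => 2 * I₁ h + 2 * (C h - 1) ^ 2) ?_
    ((hI₁o.const_mul_left 2).add hCo)
  refine Asymptotics.IsBigO.of_bound 1 ?_
  filter_upwards [hCcont.eventually (lt_mem_nhds one_pos)] with h hCh
  rw [Real.norm_of_nonneg (integral_nonneg fun x => sq_nonneg _), one_mul]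
  refine le_trans ?_ (le_abs_self _)
  have hs : 0 < √(C h) := Real.sqrt_pos.2 hCh
  -- Normalization multiplies √κ by 1 + d, and d²C = (√C - 1)² ≤ (C - 1)².
  set d := 1 / √(C h) - 1 with hd'
  have hpt : ∀ x, (√(κ (h * g x) / C h) - 1 - 1 / 2 * (h * g x)) ^ 2 ≤
      2 * (√(κ (h * g x)) - 1 - 1 / 2 * (h * g x)) ^ 2 + 2 * d ^ 2 * κ (h * g x) := by
    intro x
    have e : √(κ (h * g x) / C h) - 1 - 1 / 2 * (h * g x) =
        (√(κ (h * g x)) - 1 - 1 / 2 * (h * g x)) + d * √(κ (h * g x)) := by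
      rw [Real.sqrt_div (hκ0 _), hd']; ring
    rw [e, show 2 * d ^ 2 * κ (h * g x) = 2 * (d * √(κ (h * g x))) ^ 2 by
      rw [mul_pow, Real.sq_sqrt (hκ0 _)]; ring]
    nlinarith [sq_nonneg ((√(κ (h * g x)) - 1 - 1 / 2 * (h * g x)) - d * √(κ (h * g x)))]
  have hi1 : Integrable (fun x => 2 * (√(κ (h * g x)) - 1 - 1 / 2 * (h * g x)) ^ 2) P :=
    (hrem h).integrable_sq.const_mul 2
  have hi2 : Integrable (fun x => 2 * d ^ 2 * κ (h * g x)) P := (hki h).const_mul _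
  refine (integral_mono_of_nonneg (ae_of_all _ fun x => sq_nonneg _) (hi1.add hi2)
    (ae_of_all _ hpt)).trans ?_
  have hsum := integral_add hi1 hi2
  simp only [Pi.add_apply] at hsum ⊢
  rw [hsum, integral_const_mul, integral_const_mul]
  refine add_le_add le_rfl ?_
  change 2 * d ^ 2 * C h ≤ _
  have e : d ^ 2 * C h = (√(C h) - 1) ^ 2 := by
    rw [hd']
    nth_rewrite 2 [← Real.sq_sqrt hCh.le]
    field_simp
    ring
  rw [mul_assoc, e, ← sq_abs, ← sq_abs (C h - 1)]
  exact mul_le_mul_of_nonneg_left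
    (pow_le_pow_left₀ (abs_nonneg _) (abs_sqrt_sub_one_le hCh.le) 2) zero_le_two

end Kappa

/-- Equality of the measures for h near 0 forces p_h = p_0·κ(hg)/C_h up to ν-null sets, so the
ν-integral of the remainder is the P₀-integral treated in `isLittleO_sqrt_kappa`. The score is
replaced there by a measurable version. -/
lemma IsKappaPath.isQMDPath {X : Type*} [MeasurableSpace X] {ν : Measure X} [SigmaFinite ν]
    {P₀ : ProbabilityMeasure X} {κ : ℝ → ℝ} {K : ℝ} (hκ0 : ∀ s, 0 ≤ κ s)
    (hd : Differentiable ℝ κ)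
    (hd2 : Differentiable ℝ (deriv κ)) (h0 : κ 0 = 1) (h01 : deriv κ 0 = 1)
    (h1 : ∀ s, |deriv κ s| ≤ K) (h2 : ∀ s, |deriv (deriv κ) s| ≤ K)
    (g : TangentSpace P₀) {p : ParamPath ν} (hp : IsKappaPath κ P₀ g.1 p) :
    IsQMDPath P₀ g.1 p := by
  have hlaw0 : p.law 0 = P₀ := by
    refine Subtype.ext ?_
    refine (hp.self_of_nhds).trans ?_
    have e : (fun x => ENNReal.ofReal (κ (0 * g.1 x) / ∫ y, κ (0 * g.1 y) ∂(P₀ : Measure X))) =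
        1 := by
      ext x
      simp [h0]
    rw [e, withDensity_one]
    rfl
  obtain ⟨g, hg, hg0⟩ := g
  simp only at hp ⊢
  refine ⟨hlaw0, by rw [hlaw0]; exact hg, ?_⟩
  obtain ⟨g', hg'm, hgg'⟩ := hg.1
  have hm' : Measurable g' := hg'm.measurable
  have hP0 : (P₀ : Measure X) = ν.withDensity fun x => ENNReal.ofReal (p.dens 0 x) := by
    rw [← hlaw0]; rfl
  have hae : ∀ᵐ x ∂ν, g x * √(p.dens 0 x) = g' x * √(p.dens 0 x) := by
    have h1 := hgg'
    rw [EventuallyEq, hP0, ae_withDensity_iff (p.measurable_dens_right 0).ennreal_ofReal] at h1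
    filter_upwards [h1] with x hx
    by_cases h0 : p.dens 0 x = 0
    · simp [h0]
    · rw [hx]
      simpa using lt_of_le_of_ne (p.dens_nonneg 0 x) (Ne.symm h0)
  have hmain := isLittleO_sqrt_kappa (P := (P₀ : Measure X)) hκ0 hd hd2 h0 h01 h1 h2 hm'
    ((memLp_congr_ae hgg').1 hg) (by rw [← integral_congr_ae hgg', hg0])
  refine hmain.congr' ?_ EventuallyEq.rfl
  filter_upwards [hp] with h hph
  have hC : ∫ y, κ (h * g y) ∂(P₀ : Measure X) = ∫ y, κ (h * g' y) ∂(P₀ : Measure X) :=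
    integral_congr_ae (by filter_upwards [hgg'] with y hy; rw [hy])
  set C := ∫ y, κ (h * g' y) ∂(P₀ : Measure X) with hCdef
  have hC0 : 0 ≤ C := integral_nonneg fun y => hκ0 _
  have hk0 : ∀ x, 0 ≤ κ (h * g' x) / C := fun x => div_nonneg (hκ0 _) hC0
  have hkm : Measurable fun x => κ (h * g' x) / C :=
    (hd.continuous.measurable.comp (hm'.const_mul h)).div_const C
  have hlaw : ν.withDensity (fun x => ENNReal.ofReal (p.dens h x)) =
      ν.withDensity fun x => ENNReal.ofReal (p.dens 0 x * (κ (h * g' x) / C)) := by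
    have e1 : (p.law h : Measure X) =
        (P₀ : Measure X).withDensity fun x => ENNReal.ofReal (κ (h * g' x) / C) := by
      rw [hph, hC]
      refine withDensity_congr_ae ?_
      filter_upwards [hgg'] with y hy
      rw [hy]
    rw [hP0, ← withDensity_mul _ (p.measurable_dens_right 0).ennreal_ofReal
      hkm.ennreal_ofReal] at e1
    refine e1.trans ?_
    congr 1
    ext x
    rw [Pi.mul_apply, ENNReal.ofReal_mul (p.dens_nonneg 0 x)]
  have hdens : ∀ᵐ x ∂ν, p.dens h x = p.dens 0 x * (κ (h * g' x) / C) := by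
    have := (withDensity_eq_iff (p.measurable_dens_right h).ennreal_ofReal.aemeasurable
      ((p.measurable_dens_right 0).mul hkm).ennreal_ofReal.aemeasurable
      (by rw [p.lintegral_dens]; simp)).1 hlaw
    filter_upwards [this] with x hx
    exact (ENNReal.ofReal_eq_ofReal_iff (p.dens_nonneg h x)
      (mul_nonneg (p.dens_nonneg 0 x) (hk0 x))).1 hx
  rw [hP0, integral_withDensity_eq_integral_toReal_smul
    (p.measurable_dens_right 0).ennreal_ofReal (by simp)]
  refine integral_congr_ae ?_
  filter_upwards [hdens, hae] with x hx hx'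
  rw [ENNReal.toReal_ofReal (p.dens_nonneg 0 x), smul_eq_mul, zero_add, hx,
    Real.sqrt_mul (p.dens_nonneg 0 x), mul_assoc h, hx']
  nth_rewrite 1 [← Real.sq_sqrt (p.dens_nonneg 0 x)]
  ring

/-! ### Absolutely continuous functions -/

lemma absolutelyContinuousOnInterval_of_dist_le {f g : ℝ → ℝ} {a b : ℝ}
    (hf : AbsolutelyContinuousOnInterval f a b)
    (h : ∀ x ∈ uIcc a b, ∀ y ∈ uIcc a b, dist (g x) (g y) ≤ dist (f x) (f y)) :
    AbsolutelyContinuousOnInterval g a b := by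
  rw [absolutelyContinuousOnInterval_iff] at hf ⊢
  intro ε hε
  obtain ⟨δ, hδ, hfδ⟩ := hf ε hε
  refine ⟨δ, hδ, fun E hE hEδ => (Finset.sum_le_sum fun i hi => ?_).trans_lt (hfδ E hE hEδ)⟩
  exact h _ (hE.1 i hi).1 _ (hE.1 i hi).2

lemma absolutelyContinuousOnInterval_of_abs_sub_le_integral {f k : ℝ → ℝ} {a b : ℝ} (hab : a ≤ b)
    (hk : IntervalIntegrable k volume a b)
    (h : ∀ x y, a ≤ x → x ≤ y → y ≤ b → |f y - f x| ≤ ∫ t in x..y, k t) :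
    AbsolutelyContinuousOnInterval f a b := by
  have main : ∀ x y, a ≤ x → x ≤ y → y ≤ b →
      dist (f x) (f y) ≤ dist (∫ t in a..x, k t) (∫ t in a..y, k t) := by
    intro x y hx hxy hy
    have i1 : IntervalIntegrable k volume a x :=
      hk.mono_set (by rw [uIcc_of_le hab, uIcc_of_le hx]; exact Icc_subset_Icc le_rfl (hxy.trans hy))
    have i2 : IntervalIntegrable k volume x y :=
      hk.mono_set (by rw [uIcc_of_le hab, uIcc_of_le hxy]; exact Icc_subset_Icc hx hy)
    rw [dist_comm, Real.dist_eq, dist_comm, Real.dist_eq,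
      ← intervalIntegral.integral_add_adjacent_intervals i1 i2, add_sub_cancel_left]
    exact (h x y hx hxy hy).trans (le_abs_self _)
  refine absolutelyContinuousOnInterval_of_dist_le
    (hk.absolutelyContinuousOnInterval_intervalIntegral left_mem_uIcc) fun x hx y hy => ?_
  rw [uIcc_of_le hab] at hx hy
  rcases le_total x y with hxy | hxy
  · exact main x y hx.1 hxy hy.2
  · rw [dist_comm, dist_comm (∫ t in a..x, k t)]
    exact main y x hy.1 hxy hx.2

lemma abs_sub_le_integral_of_Ioo {G k : ℝ → ℝ} {x y : ℝ} (hxy : x ≤ y)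
    (hG : ContinuousOn G (Icc x y)) (hk : IntervalIntegrable k volume x y) (hk0 : ∀ t, 0 ≤ k t)
    (h : ∀ u v, x < u → u ≤ v → v < y → |G v - G u| ≤ ∫ t in u..v, k t) :
    |G y - G x| ≤ ∫ t in x..y, k t := by
  rcases eq_or_lt_of_le hxy with rfl | hlt
  · simp
  have hmem : ∀ᶠ ε in 𝓝[>] (0 : ℝ), ε ∈ Ioo 0 ((y - x) / 2) :=
    Ioo_mem_nhdsGT (by linarith)
  have t1 : Tendsto (fun ε : ℝ => G (y - ε)) (𝓝[>] 0) (𝓝 (G y)) := by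
    refine (hG y (right_mem_Icc.2 hxy)).tendsto.comp (tendsto_nhdsWithin_iff.2 ⟨?_, ?_⟩)
    · have : Continuous fun ε : ℝ => y - ε := by fun_prop
      simpa using (this.tendsto 0).mono_left nhdsWithin_le_nhds
    · filter_upwards [hmem] with ε hε
      constructor <;> linarith [hε.1, hε.2]
  have t2 : Tendsto (fun ε : ℝ => G (x + ε)) (𝓝[>] 0) (𝓝 (G x)) := by
    refine (hG x (left_mem_Icc.2 hxy)).tendsto.comp (tendsto_nhdsWithin_iff.2 ⟨?_, ?_⟩)
    · have : Continuous fun ε : ℝ => x + ε := by fun_prop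
      simpa using (this.tendsto 0).mono_left nhdsWithin_le_nhds
    · filter_upwards [hmem] with ε hε
      constructor <;> linarith [hε.1, hε.2]
  refine le_of_tendsto (t1.sub t2).abs ?_
  filter_upwards [hmem] with ε hε
  refine (h (x + ε) (y - ε) (by linarith [hε.1]) (by linarith [hε.2]) (by linarith [hε.1])).trans ?_
  exact intervalIntegral.integral_mono_interval (by linarith [hε.1]) (by linarith [hε.2])
    (by linarith [hε.1]) (ae_of_all _ hk0) hk

/-- On an interval containing zeros of q, only the pieces before the first and after the last zero
matter, as G vanishes at both. On each piece q is positive inside, and the increment bound extends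
to the end points by continuity. In the van Trees inequality this carries absolute continuity across
zeros of the prior density. -/
lemma absolutelyContinuousOnInterval_of_pos {a b : ℝ} (hab : a ≤ b) {q G k : ℝ → ℝ}
    (hq : ContinuousOn q (Icc a b)) (hq0 : ∀ t ∈ Icc a b, 0 ≤ q t) (hG : ContinuousOn G (Icc a b))
    (hGq : ∀ t ∈ Icc a b, q t = 0 → G t = 0) (hk : IntervalIntegrable k volume a b)
    (hk0 : ∀ t, 0 ≤ k t)
    (hpos : ∀ x y, a ≤ x → x ≤ y → y ≤ b → (∀ t ∈ Icc x y, 0 < q t) →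
      |G y - G x| ≤ ∫ t in x..y, k t) :
    AbsolutelyContinuousOnInterval G a b := by
  have hsub : ∀ x y, a ≤ x → x ≤ y → y ≤ b → IntervalIntegrable k volume x y :=
    fun x y hx hxy hy => hk.mono_set (by
      rw [uIcc_of_le hab, uIcc_of_le hxy]; exact Icc_subset_Icc hx hy)
  have hopen : ∀ x y, a ≤ x → x ≤ y → y ≤ b → (∀ t ∈ Ioo x y, 0 < q t) →
      |G y - G x| ≤ ∫ t in x..y, k t := fun x y hx hxy hy hp =>
    abs_sub_le_integral_of_Ioo hxy (hG.mono (Icc_subset_Icc hx hy)) (hsub x y hx hxy hy) hk0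
      fun u v hu huv hv => hpos u v (hx.trans hu.le) huv (hv.le.trans hy) fun t ht =>
        hp t ⟨hu.trans_le ht.1, ht.2.trans_lt hv⟩
  refine absolutelyContinuousOnInterval_of_abs_sub_le_integral hab hk fun x y hx hxy hy => ?_
  have hI : Icc x y ⊆ Icc a b := Icc_subset_Icc hx hy
  by_cases hZ : ∃ z ∈ Icc x y, q z = 0
  · set Z := Icc x y ∩ q ⁻¹' {0} with hZdef
    have hZc : IsCompact Z := isCompact_Icc.of_isClosed_subset
      ((hq.mono hI).preimage_isClosed_of_isClosed isClosed_Icc isClosed_singleton) inter_subset_left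
    have hZn : Z.Nonempty := by
      obtain ⟨z, hz, hz0⟩ := hZ
      exact ⟨z, hz, hz0⟩
    obtain ⟨z₁, hz₁, hmin⟩ := hZc.exists_isLeast hZn
    obtain ⟨z₂, hz₂, hmax⟩ := hZc.exists_isGreatest hZn
    have hz₁₂ : z₁ ≤ z₂ := hmin hz₂
    have b1 := hopen x z₁ hx hz₁.1.1 (hz₁.1.2.trans hy) fun t ht =>
      (hq0 t (hI ⟨ht.1.le, ht.2.le.trans hz₁.1.2⟩)).lt_of_ne fun h0 =>
        absurd (hmin ⟨⟨ht.1.le, ht.2.le.trans hz₁.1.2⟩, h0.symm⟩) (not_le.2 ht.2)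
    have b2 := hopen z₂ y (hx.trans hz₂.1.1) hz₂.1.2 hy fun t ht =>
      (hq0 t (hI ⟨hz₂.1.1.trans ht.1.le, ht.2.le⟩)).lt_of_ne fun h0 =>
        absurd (hmax ⟨⟨hz₂.1.1.trans ht.1.le, ht.2.le⟩, h0.symm⟩) (not_le.2 ht.1)
    rw [hGq z₁ (hI hz₁.1) hz₁.2, zero_sub, abs_neg] at b1
    rw [hGq z₂ (hI hz₂.1) hz₂.2, sub_zero] at b2
    have i1 := hsub x z₁ hx hz₁.1.1 (hz₁.1.2.trans hy)
    have i2 := hsub z₁ z₂ (hx.trans hz₁.1.1) hz₁₂ (hz₂.1.2.trans hy)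
    have i3 := hsub z₂ y (hx.trans hz₂.1.1) hz₂.1.2 hy
    have e1 := intervalIntegral.integral_add_adjacent_intervals i1 i2
    have e2 := intervalIntegral.integral_add_adjacent_intervals (i1.trans i2) i3
    have p2 : 0 ≤ ∫ t in z₁..z₂, k t := intervalIntegral.integral_nonneg hz₁₂ fun t _ => hk0 t
    have := abs_sub (G y) (G x)
    linarith
  · push Not at hZ
    exact hpos x y hx hxy hy fun t ht => (hq0 t (hI ht)).lt_of_ne (hZ t ht).symm

section LocallyAC
variable {f g : ℝ → ℝ} {a b : ℝ}

/-- Countably many compact intervals with rational end points cover the open interval. -/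
lemma LocallyAC.ae_differentiableAt (hf : LocallyAC f a b) :
    ∀ᵐ t ∂(volume.restrict (Ioo a b)), DifferentiableAt ℝ f t := by
  rw [ae_restrict_iff' measurableSet_Ioo]
  have h : ∀ x y : ℚ, ∀ᵐ t : ℝ, a < x → (x : ℝ) ≤ y → (y : ℝ) < b → t ∈ Icc (x : ℝ) y →
      DifferentiableAt ℝ f t := by
    intro x y
    by_cases hc : a < x ∧ (x : ℝ) ≤ y ∧ (y : ℝ) < b
    · filter_upwards [(hf x y hc.1 hc.2.1 hc.2.2).ae_differentiableAt] with t ht _ _ _ hmem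
      exact ht (by rwa [uIcc_of_le hc.2.1])
    · exact ae_of_all _ fun t h1 h2 h3 => absurd ⟨h1, h2, h3⟩ hc
  filter_upwards [ae_all_iff.2 fun x => ae_all_iff.2 fun y => h x y] with t ht hmem
  obtain ⟨x, hx1, hx2⟩ := exists_rat_btwn hmem.1
  obtain ⟨y, hy1, hy2⟩ := exists_rat_btwn hmem.2
  exact ht x y hx1 (hx2.trans hy1).le hy2 ⟨hx2.le, hy1.le⟩

lemma LocallyAC.continuousOn (hf : LocallyAC f a b) : ContinuousOn f (Ioo a b) := by
  intro t ht
  obtain ⟨x, hx1, hx2⟩ := exists_between ht.1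
  obtain ⟨y, hy1, hy2⟩ := exists_between ht.2
  have hc := (hf x y hx1 (hx2.trans hy1).le hy2).continuousOn
  rw [uIcc_of_le (hx2.trans hy1).le] at hc
  exact (hc.continuousAt (Icc_mem_nhds hx2 hy1)).continuousWithinAt

lemma LocallyAC.of_dist_le (hf : LocallyAC f a b)
    (h : ∀ x ∈ Ioo a b, ∀ y ∈ Ioo a b, dist (g x) (g y) ≤ dist (f x) (f y)) :
    LocallyAC g a b := by
  intro x y hx hxy hy
  have hs : uIcc x y ⊆ Ioo a b := by
    rw [uIcc_of_le hxy]; exact fun t ht => ⟨hx.trans_le ht.1, ht.2.trans_lt hy⟩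
  exact absolutelyContinuousOnInterval_of_dist_le (hf x y hx hxy hy)
    fun s hs' t ht => h s (hs hs') t (hs ht)

lemma abs_deriv_le_of_abs_sub_le {t : ℝ} (hf : DifferentiableAt ℝ f t)
    (h : ∀ᶠ s in 𝓝 t, |g s - g t| ≤ |f s - f t|) : |deriv g t| ≤ |deriv f t| := by
  by_cases hg : DifferentiableAt ℝ g t
  · refine le_of_tendsto_of_tendsto (hasDerivAt_iff_tendsto_slope.1 hg.hasDerivAt).abs
      (hasDerivAt_iff_tendsto_slope.1 hf.hasDerivAt).abs ?_
    filter_upwards [nhdsWithin_le_nhds h] with s hs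
    rw [slope_def_field, slope_def_field, abs_div, abs_div]
    gcongr
  · rw [deriv_zero_of_not_differentiableAt hg, abs_zero]
    exact abs_nonneg _

end LocallyAC

/-! ### Expectations of bounded statistics along a path -/

namespace ParamPath
variable {X : Type*} [MeasurableSpace X] {ν : Measure X}

/-- The expectation of `W` under `P_t`. -/
def mean (p : ParamPath ν) (W : X → ℝ) (t : ℝ) : ℝ := ∫ x, W x * p.dens t x ∂ν

section Bounded
variable (p : ParamPath ν) {W : X → ℝ} {M : ℝ}

lemma integrable_mul_dens (hW : Measurable W) (hM : ∀ x, |W x| ≤ M)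
    (t : ℝ) : Integrable (fun x => W x * p.dens t x) ν :=
  (p.integrable_dens t).bdd_mul hW.aestronglyMeasurable (ae_of_all _ hM)

lemma abs_mean_le (hM : ∀ x, |W x| ≤ M) (t : ℝ) : |p.mean W t| ≤ M := by
  rw [mean, ← Real.norm_eq_abs]
  refine (norm_integral_le_of_norm_le ((p.integrable_dens t).const_mul M)
    (ae_of_all _ fun x => ?_)).trans (le_of_eq ?_)
  · rw [norm_mul, Real.norm_of_nonneg (p.dens_nonneg t x)]
    exact mul_le_mul_of_nonneg_right (hM x) (p.dens_nonneg t x)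
  · rw [integral_const_mul, p.integral_dens, mul_one]

lemma memLp_bdd_mul_sqrt (hW : Measurable W) (hM : ∀ x, |W x| ≤ M)
    (t : ℝ) : MemLp (fun x => W x * √(p.dens t x)) 2 ν := by
  have hm : AEStronglyMeasurable (fun x => W x * √(p.dens t x)) ν :=
    (hW.mul (p.measurable_dens_right t).sqrt).aestronglyMeasurable
  rw [memLp_two_iff_integrable_sq hm]
  have := p.integrable_mul_dens (hW.pow_const 2) (M := M ^ 2)
    (fun x => by rw [abs_pow]; exact pow_le_pow_left₀ (abs_nonneg _) (hM x) 2) t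
  refine this.congr (ae_of_all _ fun x => ?_)
  simp only
  rw [mul_pow, Real.sq_sqrt (p.dens_nonneg t x)]

/-- With U = W·`root`, the left side is the inner product of a·r_s - b·r_t with a·U_s + b·U_t: the
cross terms cancel because ⟨r_s, U_t⟩ = ⟨r_t, U_s⟩. Keeping the weights a, b inside the norm is what
later yields the sharp constant in the information. -/
lemma abs_sq_mul_mean_sub_le (hW : Measurable W) (hM : ∀ x, |W x| ≤ M)
    {a b : ℝ} (ha : 0 ≤ a) (hb : 0 ≤ b) (s t : ℝ) :
    |a ^ 2 * p.mean W s - b ^ 2 * p.mean W t| ≤ ‖a • p.root s - b • p.root t‖ *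
      (a * √(p.mean (fun x => W x ^ 2) s) + b * √(p.mean (fun x => W x ^ 2) t)) := by
  have m := p.memLp_bdd_mul_sqrt hW hM
  set U : ℝ → Lp ℝ 2 ν := fun t => (m t).toLp with hU
  have hUn : ∀ t, ‖U t‖ = √(p.mean (fun x => W x ^ 2) t) := by
    intro t
    rw [← Real.sqrt_sq (norm_nonneg (U t)), hU, norm_sq_toLp, mean]
    congr 1
    refine integral_congr_ae (ae_of_all _ fun x => ?_)
    simp only
    rw [mul_pow, Real.sq_sqrt (p.dens_nonneg t x)]
  have hin : ∀ s t, inner ℝ (p.root s) (U t) = ∫ x, W x * (√(p.dens s x) * √(p.dens t x)) ∂ν := by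
    intro s t
    rw [root, hU, inner_toLp]
    refine integral_congr_ae (ae_of_all _ fun x => ?_)
    simp only
    ring
  have hin1 : ∀ t, inner ℝ (p.root t) (U t) = p.mean W t := by
    intro t
    rw [hin, mean]
    simp only [Real.mul_self_sqrt (p.dens_nonneg t _)]
  have hin2 : inner ℝ (p.root s) (U t) = inner ℝ (p.root t) (U s) := by
    rw [hin, hin]; simp only [mul_comm √(p.dens s _)]
  have e : a ^ 2 * p.mean W s - b ^ 2 * p.mean W t =
      inner ℝ (a • p.root s - b • p.root t) (a • U s + b • U t) := by
    simp only [inner_sub_left, inner_add_right, inner_smul_left, inner_smul_right, hin1, hin2,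
      conj_trivial]
    ring
  rw [e]
  refine (abs_real_inner_le_norm _ _).trans (mul_le_mul_of_nonneg_left ?_ (norm_nonneg _))
  refine (norm_add_le _ _).trans (le_of_eq ?_)
  rw [norm_smul, norm_smul, hUn, hUn, Real.norm_of_nonneg ha, Real.norm_of_nonneg hb]

lemma abs_mean_sq_le (hM : ∀ x, |W x| ≤ M)
    (t : ℝ) : |p.mean (fun x => W x ^ 2) t| ≤ M ^ 2 :=
  p.abs_mean_le
    (fun x => by rw [abs_pow]; exact pow_le_pow_left₀ (abs_nonneg _) (hM x) 2) t

lemma abs_mean_sub_le (hW : Measurable W) (hM : ∀ x, |W x| ≤ M)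
    (s t : ℝ) :
    |p.mean W s - p.mean W t| ≤ 2 * M * ‖p.root s - p.root t‖ := by
  have h := p.abs_sq_mul_mean_sub_le hW hM zero_le_one zero_le_one s t
  simp only [one_pow, one_mul, one_smul] at h
  have hb : ∀ t, √(p.mean (fun x => W x ^ 2) t) ≤ M := by
    intro t
    have hM0 : 0 ≤ M := (abs_nonneg _).trans (p.abs_mean_le hM t)
    exact (Real.sqrt_le_left hM0).2 ((le_abs_self _).trans (p.abs_mean_sq_le hM t))
  refine h.trans ?_
  rw [mul_comm]
  exact mul_le_mul_of_nonneg_right (by linarith [hb s, hb t]) (norm_nonneg _)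

lemma continuousAt_mean (hW : Measurable W) (hM : ∀ x, |W x| ≤ M)
    {t : ℝ} (ht : ContinuousAt p.root t) : ContinuousAt (p.mean W) t := by
  rw [ContinuousAt, tendsto_iff_norm_sub_tendsto_zero] at ht ⊢
  refine squeeze_zero (fun _ => norm_nonneg _) (fun s => p.abs_mean_sub_le hW hM s t) ?_
  simpa using ht.const_mul (2 * M)

lemma mean_sub_const (hW : Measurable W) (hM : ∀ x, |W x| ≤ M)
    (k t : ℝ) : p.mean (fun x => W x - k) t = p.mean W t - k := by
  rw [mean, mean]
  simp only [sub_mul]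
  rw [integral_sub (p.integrable_mul_dens hW hM t) ((p.integrable_dens t).const_mul k),
    integral_const_mul, p.integral_dens, mul_one]

lemma mean_sub_const_sq (hW : Measurable W) (hM : ∀ x, |W x| ≤ M)
    (k t : ℝ) : p.mean (fun x => (W x - k) ^ 2) t =
    p.mean (fun x => W x ^ 2) t - 2 * k * p.mean W t + k ^ 2 := by
  have h1 := p.integrable_mul_dens (hW.pow_const 2) (M := M ^ 2)
    (fun x => by rw [abs_pow]; exact pow_le_pow_left₀ (abs_nonneg _) (hM x) 2) t
  have h2 := (p.integrable_mul_dens hW hM t).const_mul (2 * k)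
  have h3 := (p.integrable_dens t).const_mul (k ^ 2)
  have e : ∀ x, (W x - k) ^ 2 * p.dens t x =
      (W x ^ 2 * p.dens t x - 2 * k * (W x * p.dens t x)) + k ^ 2 * p.dens t x := fun x => by ring
  have h12 : Integrable (fun x => W x ^ 2 * p.dens t x - 2 * k * (W x * p.dens t x)) ν := h1.sub h2
  rw [mean]
  simp only [e]
  rw [integral_add h12 h3, integral_sub h1 h2, integral_const_mul,
    integral_const_mul, p.integral_dens, mul_one]
  rfl

end Bounded

lemma norm_root_sub_le_integral (p : ParamPath ν) {x y : ℝ} (hxy : x ≤ y)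
    (hd : ∀ t ∈ Icc x y, DifferentiableAt ℝ p.root t)
    (hi : IntervalIntegrable (fun t => √(p.fisherInfo t)) volume x y) :
    ‖p.root y - p.root x‖ ≤ ∫ t in x..y, √(p.fisherInfo t) / 2 := by
  refine norm_sub_le_integral_of_norm_deriv_le_of_le hxy
    (fun t ht => (hd t ht).continuousAt.continuousWithinAt)
    (fun t ht => (hd t (Ioo_subset_Icc_self ht)).differentiableWithinAt)
    (ae_of_all _ fun t _ => ?_) (hi.div_const 2)
  rw [fisherInfo_eq, show 4 * ‖deriv p.root t‖ ^ 2 = (2 * ‖deriv p.root t‖) ^ 2 by ring,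
    Real.sqrt_sq (by positivity)]
  linarith

lemma continuousAt_root_sample [SigmaFinite ν] (p : ParamPath ν) (n : ℕ) {t : ℝ}
    (ht : ContinuousAt p.root t) : ContinuousAt (p.sample n).root t := by
  rw [ContinuousAt, tendsto_iff_norm_sub_tendsto_zero] at ht ⊢
  refine squeeze_zero (fun _ => norm_nonneg _) (fun s => p.norm_root_sample_sub_le n s t) ?_
  simpa using ht.const_mul √(n : ℝ)

/-- A pointwise Cauchy-Schwarz inequality for the derivative of `t ↦ q(t) E_t[T - k]`. -/
lemma abs_deriv_mul_mean_le [SigmaFinite ν] (p : ParamPath ν) (n : ℕ) {T : (Fin n → X) → ℝ}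
    (hT : Measurable T) {M : ℝ} (hM : ∀ x, |T x| ≤ M) {q : ℝ → ℝ} {t : ℝ} (k : ℝ)
    (hq0 : 0 < q t) (hq : DifferentiableAt ℝ q t) (hp : DifferentiableAt ℝ p.root t)
    (hF : DifferentiableAt ℝ ((p.sample n).mean T) t) :
    |deriv q t * ((p.sample n).mean T t - k) + q t * deriv ((p.sample n).mean T) t| ≤
      √(q t * (p.sample n).mean (fun x => (T x - k) ^ 2) t) *
        √(deriv q t ^ 2 / q t + q t * (n * p.fisherInfo t)) := by
  set p' := p.sample n with hp'
  have hW : Measurable fun x => T x - k := hT.sub_const k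
  have hWM : ∀ x, |T x - k| ≤ M + |k| := fun x =>
    (abs_sub _ _).trans (add_le_add (hM x) le_rfl)
  set E : ℝ → ℝ := p'.mean fun x => (T x - k) ^ 2 with hE
  have hE0 : ∀ s, 0 ≤ E s := fun s =>
    integral_nonneg fun x => mul_nonneg (sq_nonneg _) (p'.dens_nonneg s x)
  have hroot' : ContinuousAt p'.root t := p.continuousAt_root_sample n hp.continuousAt
  have hEc : ContinuousAt E t := p'.continuousAt_mean (hW.pow_const 2) (M := (M + |k|) ^ 2)
    (fun x => by rw [abs_pow]; exact pow_le_pow_left₀ (abs_nonneg _) (hWM x) 2) hroot'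
  set Φ : ℝ → ℝ := fun s => q s * (p'.mean T s - k) with hΦ
  have hΦd : HasDerivAt Φ (deriv q t * (p'.mean T t - k) + q t * deriv (p'.mean T) t) t :=
    hq.hasDerivAt.mul (hF.hasDerivAt.sub_const k)
  have hqpos : ∀ᶠ s in 𝓝[≠] t, 0 < q s :=
    nhdsWithin_le_nhds (hq.continuousAt.eventually (lt_mem_nhds hq0))
  have hsq : HasDerivAt (fun s => √(q s)) (deriv q t / (2 * √(q t))) t :=
    hq.hasDerivAt.sqrt hq0.ne'
  have hqc : Tendsto (fun s => √(q s)) (𝓝[≠] t) (𝓝 √(q t)) :=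
    (hsq.continuousAt.tendsto).mono_left nhdsWithin_le_nhds
  have lim1 := (hasDerivAt_iff_tendsto_slope.1 hΦd).abs
  have lim2 := (hasDerivAt_iff_tendsto_slope.1 hsq).pow 2
  have lim3 := ((hasDerivAt_iff_tendsto_slope.1 hp.hasDerivAt).norm.pow 2)
  -- These quotients bound those of Φ. For the sample, only the comparison of its squared distance
  -- with n times that of one observation is used.
  have lim4 : Tendsto (fun s => √((slope (fun s => √(q s)) t s) ^ 2 +
      √(q s) * √(q t) * (n * ‖slope p.root t s‖ ^ 2)) *
        (√(q s) * √(E s) + √(q t) * √(E t))) (𝓝[≠] t)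
      (𝓝 (√((deriv q t / (2 * √(q t))) ^ 2 + √(q t) * √(q t) * (n * ‖deriv p.root t‖ ^ 2)) *
        (√(q t) * √(E t) + √(q t) * √(E t)))) :=
    ((lim2.add ((hqc.mul_const _).mul (lim3.const_mul _))).sqrt).mul
      ((hqc.mul ((hEc.tendsto.mono_left nhdsWithin_le_nhds).sqrt)).add_const _)
  refine (le_of_tendsto_of_tendsto lim1 lim4 ?_).trans (le_of_eq ?_)
  · filter_upwards [hqpos, self_mem_nhdsWithin] with s hs hne
    have hst : 0 < |s - t| := abs_pos.2 (sub_ne_zero.2 hne)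
    have h1 := p'.abs_sq_mul_mean_sub_le hW hWM (Real.sqrt_nonneg (q s)) (Real.sqrt_nonneg (q t)) s t
    rw [Real.sq_sqrt hs.le, Real.sq_sqrt hq0.le, p'.mean_sub_const hT hM,
      p'.mean_sub_const hT hM] at h1
    rw [slope_def_field, abs_div, div_le_iff₀ hst]
    refine h1.trans ?_
    rw [mul_right_comm]
    refine mul_le_mul_of_nonneg_right ?_ (by positivity)
    rw [← sq_le_sq₀ (norm_nonneg _) (by positivity), mul_pow, Real.sq_sqrt (by positivity),
      norm_smul_sub_smul_sq (p'.norm_root s) (p'.norm_root t), slope_def_field, slope_def_module,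
      norm_smul, div_pow, mul_pow, norm_inv, Real.norm_eq_abs, inv_pow, sq_abs, add_mul]
    have hst1 : s - t ≠ 0 := sub_ne_zero.2 hne
    have hst2 : (s - t) ^ 2 ≠ 0 := pow_ne_zero 2 hst1
    rw [div_mul_cancel₀ _ hst2]
    refine add_le_add le_rfl ?_
    calc _ ≤ √(q s) * √(q t) * (n * ‖p.root s - p.root t‖ ^ 2) :=
          mul_le_mul_of_nonneg_left (p.norm_root_sample_sub_sq_le n s t) (by positivity)
      _ = _ := by field_simp
  · rw [fisherInfo_eq, Real.sqrt_mul hq0.le, ← two_mul]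
    have e : deriv q t ^ 2 / q t + q t * (n * (4 * ‖deriv p.root t‖ ^ 2)) = 2 ^ 2 *
        ((deriv q t / (2 * √(q t))) ^ 2 + √(q t) * √(q t) * (n * ‖deriv p.root t‖ ^ 2)) := by
      rw [div_pow, mul_pow, Real.sq_sqrt hq0.le, Real.mul_self_sqrt hq0.le]
      field_simp
      ring
    rw [e, Real.sqrt_mul (by norm_num), Real.sqrt_sq (by norm_num)]
    ring

end ParamPath

/-! ### The van Trees inequality -/

lemma continuousOn_indicator_Ioo {f : ℝ → ℝ} {a b : ℝ} (hf : ContinuousOn f (Ioo a b))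
    (ha : Tendsto f (𝓝[>] a) (𝓝 0)) (hb : Tendsto f (𝓝[<] b) (𝓝 0)) :
    ContinuousOn ((Ioo a b).indicator f) (Icc a b) := by
  intro t ht
  rcases eq_or_lt_of_le ht.1 with rfl | h1
  · refine ContinuousWithinAt.mono ?_ Icc_subset_Ici_self
    rw [← continuousWithinAt_Ioi_iff_Ici, ContinuousWithinAt, indicator_of_notMem (by simp)]
    refine squeeze_zero_norm (fun s => ?_) (by simpa using ha.norm)
    exact norm_indicator_le_norm_self f s
  rcases eq_or_lt_of_le ht.2 with rfl | h2
  · refine ContinuousWithinAt.mono ?_ Icc_subset_Iic_self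
    rw [← continuousWithinAt_Iio_iff_Iic, ContinuousWithinAt, indicator_of_notMem (by simp)]
    refine squeeze_zero_norm (fun s => ?_) (by simpa using hb.norm)
    exact norm_indicator_le_norm_self f s
  · have hn : Ioo a b ∈ 𝓝 t := Ioo_mem_nhds h1 h2
    refine ContinuousAt.continuousWithinAt ((hf.continuousAt hn).congr ?_)
    filter_upwards [hn] with s hs
    rw [indicator_of_mem hs]

namespace ParamPath
variable {X : Type*} [MeasurableSpace X] {ν : Measure X}

lemma absolutelyContinuousOnInterval_mean [SigmaFinite ν] (p : ParamPath ν) (n : ℕ)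
    {T : (Fin n → X) → ℝ} (hT : Measurable T) {M : ℝ} (hM : ∀ x, |T x| ≤ M) {x y : ℝ} (hxy : x ≤ y)
    (hd : ∀ t ∈ Icc x y, DifferentiableAt ℝ p.root t)
    (hi : IntervalIntegrable (fun t => √(p.fisherInfo t)) volume x y) :
    AbsolutelyContinuousOnInterval ((p.sample n).mean T) x y := by
  refine absolutelyContinuousOnInterval_of_abs_sub_le_integral hxy
    ((hi.div_const 2).const_mul (2 * M * √n)) fun u v hu huv hv => ?_
  have hM0 : 0 ≤ M := (abs_nonneg _).trans ((p.sample n).abs_mean_le hM 0)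
  rw [intervalIntegral.integral_const_mul]
  refine ((p.sample n).abs_mean_sub_le hT hM v u).trans ?_
  rw [mul_assoc (2 * M) √(n : ℝ)]
  refine mul_le_mul_of_nonneg_left ((p.norm_root_sample_sub_le n v u).trans ?_) (by positivity)
  refine mul_le_mul_of_nonneg_left ?_ (by positivity)
  refine p.norm_root_sub_le_integral huv
    (fun t ht => hd t ⟨hu.trans ht.1, ht.2.trans hv⟩) (hi.mono_set ?_)
  rw [uIcc_of_le hxy, uIcc_of_le huv]
  exact Icc_subset_Icc hu hv

/-- The van Trees inequality for bounded estimators and bounded functionals. -/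
theorem vanTrees_of_bounded [SigmaFinite ν] (p : ParamPath ν) (n : ℕ) {a b : ℝ} (hab : a < b)
    (hd : ∀ t ∈ Ioo a b, DifferentiableAt ℝ p.root t)
    {T : (Fin n → X) → ℝ} (hT : Measurable T) {M : ℝ} (hM : ∀ x, |T x| ≤ M)
    {φ q : ℝ → ℝ} (hφ : LocallyAC φ a b) (hφM : ∀ t ∈ Ioo a b, |φ t| ≤ M)
    (hq : LocallyAC q a b) (hq0 : ∀ t ∈ Ioo a b, 0 ≤ q t)
    (hqa : Tendsto q (𝓝[>] a) (𝓝 0)) (hqb : Tendsto q (𝓝[<] b) (𝓝 0))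
    (hφi : IntegrableOn (fun t => q t * deriv φ t) (Ioo a b))
    (hJ : IntegrableOn (fun t => if 0 < q t then deriv q t ^ 2 / q t else 0) (Ioo a b))
    (hI : IntegrableOn (fun t => q t * p.fisherInfo t) (Ioo a b)) :
    (∫ t in Ioo a b, q t * deriv φ t) ^ 2 ≤
      (∫ t in Ioo a b, q t * (p.sample n).mean (fun x => (T x - φ t) ^ 2) t) *
        (∫ t in Ioo a b, ((if 0 < q t then deriv q t ^ 2 / q t else 0) +
          n * (q t * p.fisherInfo t))) := by
  set p' := p.sample n with hp'
  set F : ℝ → ℝ := p'.mean T with hF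
  set A : ℝ → ℝ := fun t => p'.mean (fun x => (T x - φ t) ^ 2) t with hA
  set J : ℝ → ℝ := fun t => (if 0 < q t then deriv q t ^ 2 / q t else 0) +
    n * (q t * p.fisherInfo t) with hJdef
  have hM0 : 0 ≤ M := (abs_nonneg _).trans (p'.abs_mean_le hM 0)
  have hA0 : ∀ t, 0 ≤ A t := fun t =>
    integral_nonneg fun x => mul_nonneg (sq_nonneg _) (p'.dens_nonneg t x)
  have hA4 : ∀ t ∈ Ioo a b, A t ≤ 4 * M ^ 2 := by
    intro t ht
    refine (le_abs_self _).trans (p'.abs_mean_le (fun x => ?_) t)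
    rw [abs_pow, show 4 * M ^ 2 = (M + M) ^ 2 by ring]
    exact pow_le_pow_left₀ (abs_nonneg _) ((abs_sub _ _).trans (add_le_add (hM x) (hφM t ht))) 2
  have hJ0 : ∀ t ∈ Ioo a b, 0 ≤ J t := by
    intro t ht
    have h1 := mul_nonneg (Nat.cast_nonneg (α := ℝ) n)
      (mul_nonneg (hq0 t ht) (p.fisherInfo_nonneg t))
    rw [hJdef]
    simp only
    split_ifs with h
    · have := div_nonneg (sq_nonneg (deriv q t)) h.le
      linarith
    · linarith
  have hJi : IntegrableOn J (Ioo a b) := hJ.add (hI.const_mul _)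
  have hroot : ∀ t ∈ Ioo a b, ContinuousAt p'.root t := fun t ht =>
    p.continuousAt_root_sample n (hd t ht).continuousAt
  have hFc : ContinuousOn F (Ioo a b) := fun t ht =>
    (p'.continuousAt_mean hT hM (hroot t ht)).continuousWithinAt
  have hφc := hφ.continuousOn
  have hqc := hq.continuousOn
  have hAc : ContinuousOn A (Ioo a b) := by
    have h2 : ContinuousOn (p'.mean fun x => T x ^ 2) (Ioo a b) := fun t ht =>
      (p'.continuousAt_mean (hT.pow_const 2) (M := M ^ 2)
        (fun x => by rw [abs_pow]; exact pow_le_pow_left₀ (abs_nonneg _) (hM x) 2)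
        (hroot t ht)).continuousWithinAt
    have e : A = fun t => p'.mean (fun x => T x ^ 2) t - 2 * φ t * F t + φ t ^ 2 :=
      funext fun t => p'.mean_sub_const_sq hT hM (φ t) t
    rw [e]
    exact (h2.sub ((continuousOn_const.mul hφc).mul hFc)).add (hφc.pow 2)
  have hFφ : ∀ t ∈ Ioo a b, |F t - φ t| ≤ 2 * M := fun t ht =>
    (abs_sub _ _).trans (by linarith [p'.abs_mean_le hM t, hφM t ht])
  set q' : ℝ → ℝ := (Ioo a b).indicator q with hq'
  have hq'c : ContinuousOn q' (Icc a b) := continuousOn_indicator_Ioo hqc hqa hqb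
  have hqi : IntegrableOn q (Ioo a b) := by
    refine ((hq'c.integrableOn_Icc).mono_set Ioo_subset_Icc_self).congr_fun (fun t ht => ?_)
      measurableSet_Ioo
    exact indicator_of_mem ht q
  have hqA : IntegrableOn (fun t => q t * A t) (Ioo a b) := by
    refine Integrable.mono' (hqi.const_mul (4 * M ^ 2))
      ((hqc.mul hAc).aestronglyMeasurable measurableSet_Ioo) ?_
    filter_upwards [ae_restrict_mem measurableSet_Ioo] with t ht
    rw [Real.norm_of_nonneg (mul_nonneg (hq0 t ht) (hA0 t)), mul_comm]
    exact mul_le_mul_of_nonneg_right (hA4 t ht) (hq0 t ht)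
  -- The function to be integrated by parts: it tends to 0 at both end points, since q does and the
  -- other factor is at most 2M.
  set G₀ : ℝ → ℝ := fun t => q t * (F t - φ t) with hG₀
  set G : ℝ → ℝ := (Ioo a b).indicator G₀ with hG
  have hGc : ContinuousOn G (Icc a b) := by
    refine continuousOn_indicator_Ioo (hqc.mul (hFc.sub hφc))
      (squeeze_zero_norm' (a := fun t => ‖q t‖ * (2 * M)) ?_ (by simpa using hqa.norm.mul_const (2 * M)))
      (squeeze_zero_norm' (a := fun t => ‖q t‖ * (2 * M)) ?_ (by simpa using hqb.norm.mul_const (2 * M)))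
    · filter_upwards [Ioo_mem_nhdsGT hab] with t ht
      rw [norm_mul]
      exact mul_le_mul_of_nonneg_left (hFφ t ht) (norm_nonneg _)
    · filter_upwards [Ioo_mem_nhdsLT hab] with t ht
      rw [norm_mul]
      exact mul_le_mul_of_nonneg_left (hFφ t ht) (norm_nonneg _)
  -- the pointwise inequality
  have key : ∀ t ∈ Ioo a b, 0 < q t → DifferentiableAt ℝ q t → DifferentiableAt ℝ φ t →
      DifferentiableAt ℝ F t → HasDerivAt G₀ (deriv G₀ t) t ∧
      |deriv G₀ t + q t * deriv φ t| ≤ √(q t * A t) * √(J t) := by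
    intro t ht hqt hqd hφd hFd
    have h1 : HasDerivAt G₀ (deriv q t * (F t - φ t) + q t * (deriv F t - deriv φ t)) t :=
      hqd.hasDerivAt.mul (hFd.hasDerivAt.sub hφd.hasDerivAt)
    refine ⟨h1.differentiableAt.hasDerivAt, ?_⟩
    have h2 := p.abs_deriv_mul_mean_le n hT hM (φ t) hqt hqd (hd t ht) hFd
    have e : deriv G₀ t + q t * deriv φ t = deriv q t * (F t - φ t) + q t * deriv F t := by
      rw [h1.deriv]; ring
    rw [e]
    refine h2.trans (le_of_eq ?_)
    rw [hJdef]
    simp only [if_pos hqt]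
    rw [mul_left_comm (q t)]
  set k : ℝ → ℝ := (Ioo a b).indicator
    (fun t => 1 / 2 * (q t * A t + J t) + ‖q t * deriv φ t‖) with hk
  have hk0 : ∀ t, 0 ≤ k t := fun t => indicator_nonneg (fun s hs => by
    have h1 := mul_nonneg (hq0 s hs) (hA0 s)
    have h2 := hJ0 s hs
    positivity) t
  have hki : IntervalIntegrable k volume a b := by
    rw [intervalIntegrable_iff_integrableOn_Ioo_of_le hab.le]
    have hi : IntegrableOn (fun t => 1 / 2 * (q t * A t + J t) + ‖q t * deriv φ t‖) (Ioo a b) :=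
      ((hqA.add hJi).const_mul (1 / 2)).add hφi.norm
    exact hi.congr_fun (fun t ht => by rw [hk, indicator_of_mem ht]) measurableSet_Ioo
  have hGAC : AbsolutelyContinuousOnInterval G a b := by
    refine absolutelyContinuousOnInterval_of_pos hab.le hq'c
      (fun t _ => indicator_nonneg hq0 t) hGc (fun t _ h => ?_) hki hk0 ?_
    · by_cases ht : t ∈ Ioo a b
      · rw [hq', indicator_of_mem ht] at h
        rw [hG, indicator_of_mem ht, hG₀]
        simp [h]
      · rw [hG, indicator_of_notMem ht]
    · intro x y hx hxy hy hpos
      have hmem : ∀ t ∈ Icc x y, t ∈ Ioo a b := fun t ht => by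
        by_contra hc
        have := hpos t ht
        rw [hq', indicator_of_notMem hc] at this
        exact lt_irrefl _ this
      have hqpos : ∀ t ∈ Icc x y, 0 < q t := fun t ht => by
        have := hpos t ht
        rwa [hq', indicator_of_mem (hmem t ht)] at this
      have hx' := (hmem x ⟨le_rfl, hxy⟩).1
      have hy' := (hmem y ⟨hxy, le_rfl⟩).2
      -- The Fisher information is integrable only against q. On a compact interval where q > 0, its
      -- minimum q(t₀) is positive, so the information itself, and with it its root, is integrable
      -- there.
      obtain ⟨t₀, ht₀, hmin⟩ := isCompact_Icc.exists_isMinOn ⟨x, left_mem_Icc.2 hxy⟩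
        (hqc.mono hmem)
      have hm := hqpos t₀ ht₀
      have hsqrt : IntervalIntegrable (fun t => √(p.fisherInfo t)) volume x y := by
        rw [intervalIntegrable_iff_integrableOn_Icc_of_le hxy]
        have hI' : IntegrableOn (fun t => q t * p.fisherInfo t) (Icc x y) := hI.mono_set hmem
        refine Integrable.mono' ((integrable_const (1 : ℝ)).add (hI'.div_const (q t₀)))
          (p.aemeasurable_fisherInfo _).sqrt.aestronglyMeasurable ?_
        filter_upwards [ae_restrict_mem measurableSet_Icc] with t ht
        have hI0 := p.fisherInfo_nonneg t
        rw [Real.norm_of_nonneg (Real.sqrt_nonneg _)]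
        have h1 : √(p.fisherInfo t) ≤ 1 + p.fisherInfo t := by
          rw [Real.sqrt_le_left (by positivity)]; nlinarith
        have h2 : p.fisherInfo t ≤ q t * p.fisherInfo t / q t₀ := by
          rw [le_div_iff₀ hm, mul_comm]
          exact mul_le_mul_of_nonneg_right (hmin ht) hI0
        simp only [Pi.add_apply]
        linarith
      have hFAC := p.absolutelyContinuousOnInterval_mean n hT hM hxy (fun t ht => hd t (hmem t ht))
        hsqrt
      have hqAC := hq x y hx' hxy hy'
      have hφAC := hφ x y hx' hxy hy'
      have hG₀AC : AbsolutelyContinuousOnInterval G₀ x y := hqAC.mul (hFAC.sub hφAC)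
      rw [hG, indicator_of_mem (hmem x ⟨le_rfl, hxy⟩), indicator_of_mem (hmem y ⟨hxy, le_rfl⟩),
        ← hG₀AC.integral_deriv_eq_sub, ← Real.norm_eq_abs]
      refine intervalIntegral.norm_integral_le_of_norm_le hxy ?_ (hki.mono_set ?_)
      · filter_upwards [hFAC.ae_differentiableAt, hqAC.ae_differentiableAt,
          hφAC.ae_differentiableAt] with t h1 h2 h3 ht
        have ht' : t ∈ Icc x y := Ioc_subset_Icc_self ht
        rw [uIcc_of_le hxy] at h1 h2 h3
        have h4 := (key t (hmem t ht') (hqpos t ht') (h2 ht') (h3 ht') (h1 ht')).2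
        rw [hk, indicator_of_mem (hmem t ht')]
        have h5 : √(q t * A t) * √(J t) ≤ 1 / 2 * (q t * A t + J t) := by
          have e1 := Real.sq_sqrt (mul_nonneg (hq0 t (hmem t ht')) (hA0 t))
          have e2 := Real.sq_sqrt (hJ0 t (hmem t ht'))
          nlinarith [sq_nonneg (√(q t * A t) - √(J t))]
        have h6 : ‖deriv G₀ t‖ ≤ |deriv G₀ t + q t * deriv φ t| + ‖q t * deriv φ t‖ := by
          have := norm_sub_le (deriv G₀ t + q t * deriv φ t) (q t * deriv φ t)
          rwa [add_sub_cancel_right] at this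
        exact h6.trans (add_le_add (h4.trans h5) le_rfl)
      · rw [uIcc_of_le hab.le, uIcc_of_le hxy]
        exact Icc_subset_Icc hx hy
  have hint : ∫ t in Ioo a b, deriv G t = 0 := by
    rw [← integral_Ioc_eq_integral_Ioo, ← intervalIntegral.integral_of_le hab.le,
      hGAC.integral_deriv_eq_sub, hG, indicator_of_notMem (by simp), indicator_of_notMem (by simp),
      sub_zero]
  have hGi : IntegrableOn (deriv G) (Ioo a b) :=
    (intervalIntegrable_iff_integrableOn_Ioo_of_le hab.le).1 hGAC.intervalIntegrable_deriv
  have hpt : ∀ᵐ t ∂(volume.restrict (Ioo a b)),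
      ‖deriv G t + q t * deriv φ t‖ ≤ √(q t * A t) * √(J t) := by
    have hGd : ∀ᵐ t ∂(volume.restrict (Ioo a b)), DifferentiableAt ℝ G t := by
      rw [ae_restrict_iff' measurableSet_Ioo]
      filter_upwards [hGAC.ae_differentiableAt] with t ht ht'
      exact ht (by rw [uIcc_of_le hab.le]; exact Ioo_subset_Icc_self ht')
    filter_upwards [hGd, hq.ae_differentiableAt, hφ.ae_differentiableAt,
      ae_restrict_mem measurableSet_Ioo] with t hGt hqt hφt ht
    have hn : Ioo a b ∈ 𝓝 t := isOpen_Ioo.mem_nhds ht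
    have hGG : G =ᶠ[𝓝 t] G₀ := by
      filter_upwards [hn] with s hs
      rw [hG, indicator_of_mem hs]
    -- At an interior zero q has a minimum, so q' = 0 there, and |G| ≤ 2Mq forces G' = 0.
    rcases eq_or_lt_of_le (hq0 t ht) with h0 | h0
    · have hmin : IsLocalMin q t := by
        filter_upwards [hn] with s hs
        rw [← h0]; exact hq0 s hs
      have hle := abs_deriv_le_of_abs_sub_le (f := fun s => q s * (2 * M)) (g := G)
        (hqt.mul_const _) (by
          filter_upwards [hGG, hn] with s hs hs'
          rw [hs, hGG.eq_of_nhds, hG₀]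
          simp only [← h0, zero_mul, sub_zero]
          rw [abs_mul, abs_mul, abs_of_nonneg (show 0 ≤ 2 * M by positivity)]
          exact mul_le_mul_of_nonneg_left (hFφ s hs') (abs_nonneg _))
      rw [deriv_mul_const hqt, hmin.deriv_eq_zero, zero_mul, abs_zero] at hle
      rw [abs_nonpos_iff.1 hle, ← h0]
      simp
    · have hqne : ∀ᶠ s in 𝓝 t, q s ≠ 0 := hqt.continuousAt.eventually_ne h0.ne'
      -- Where q > 0, differentiability of the expectation is recovered from F = G/q + φ.
      have hFd : DifferentiableAt ℝ F t := by
        have h1 : DifferentiableAt ℝ (fun s => G s / q s + φ s) t :=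
          (hGt.div hqt h0.ne').add hφt
        refine h1.congr_of_eventuallyEq ?_
        filter_upwards [hGG, hqne] with s hs hs'
        rw [hs, hG₀]
        simp only
        rw [mul_div_cancel_left₀ _ hs', sub_add_cancel]
      rw [hGG.deriv_eq]
      exact (key t ht h0 hqt hφt hFd).2
  have hm1 : MemLp (fun t => √(q t * A t)) 2 (volume.restrict (Ioo a b)) := by
    rw [memLp_two_iff_integrable_sq hqA.1.aemeasurable.sqrt.aestronglyMeasurable]
    refine hqA.congr_fun (fun t ht => ?_) measurableSet_Ioo
    exact (Real.sq_sqrt (mul_nonneg (hq0 t ht) (hA0 t))).symm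
  have hm2 : MemLp (fun t => √(J t)) 2 (volume.restrict (Ioo a b)) := by
    rw [memLp_two_iff_integrable_sq hJi.1.aemeasurable.sqrt.aestronglyMeasurable]
    refine hJi.congr_fun (fun t ht => ?_) measurableSet_Ioo
    exact (Real.sq_sqrt (hJ0 t ht)).symm
  have e1 : ∫ t in Ioo a b, √(q t * A t) ^ 2 = ∫ t in Ioo a b, q t * A t :=
    setIntegral_congr_fun measurableSet_Ioo fun t ht =>
      Real.sq_sqrt (mul_nonneg (hq0 t ht) (hA0 t))
  have e2 : ∫ t in Ioo a b, √(J t) ^ 2 = ∫ t in Ioo a b, J t :=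
    setIntegral_congr_fun measurableSet_Ioo fun t ht => Real.sq_sqrt (hJ0 t ht)
  have hfin : |∫ t in Ioo a b, q t * deriv φ t| ≤
      √(∫ t in Ioo a b, q t * A t) * √(∫ t in Ioo a b, J t) := by
    -- Since ∫G' = 0, the integral of qφ' is that of G' + qφ', to which the pointwise bound and
    -- Cauchy-Schwarz apply.
    rw [← zero_add (∫ t in Ioo a b, q t * deriv φ t), ← hint, ← integral_add hGi hφi,
      ← Real.norm_eq_abs, ← e1, ← e2]
    refine (norm_integral_le_of_norm_le (hm1.integrable_mul hm2) hpt).trans ?_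
    exact (le_abs_self _).trans (abs_integral_mul_le hm1 hm2)
  have h1 : 0 ≤ ∫ t in Ioo a b, q t * A t :=
    setIntegral_nonneg measurableSet_Ioo fun t ht => mul_nonneg (hq0 t ht) (hA0 t)
  have h2 : 0 ≤ ∫ t in Ioo a b, J t := setIntegral_nonneg measurableSet_Ioo hJ0
  rw [← sq_abs]
  refine (pow_le_pow_left₀ (abs_nonneg _) hfin 2).trans (le_of_eq ?_)
  rw [mul_pow, Real.sq_sqrt h1, Real.sq_sqrt h2]

end ParamPath

/-! ### Integration with respect to a prior density -/

section Prior
variable {q : ℝ → ℝ} {a b : ℝ}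

lemma lintegral_priorMeasure (hq : AEMeasurable q (volume.restrict (Ioo a b))) (f : ℝ → ℝ≥0∞) :
    ∫⁻ t, f t ∂(priorMeasure q a b) = ∫⁻ t in Ioo a b, ENNReal.ofReal (q t) * f t :=
  lintegral_withDensity_eq_lintegral_mul_non_measurable₀ _ hq.ennreal_ofReal
    (ae_of_all _ fun _ => ENNReal.ofReal_lt_top) f

lemma integral_priorMeasure (hq : AEMeasurable q (volume.restrict (Ioo a b)))
    (hq0 : ∀ t ∈ Ioo a b, 0 ≤ q t) (f : ℝ → ℝ) :
    ∫ t, f t ∂(priorMeasure q a b) = ∫ t in Ioo a b, q t * f t := by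
  rw [priorMeasure, integral_withDensity_eq_integral_toReal_smul₀ hq.ennreal_ofReal
    (ae_of_all _ fun _ => ENNReal.ofReal_lt_top)]
  refine setIntegral_congr_fun measurableSet_Ioo fun t ht => ?_
  simp only [ENNReal.toReal_ofReal (hq0 t ht), smul_eq_mul]

lemma integrable_priorMeasure_iff (hq : AEMeasurable q (volume.restrict (Ioo a b)))
    (hq0 : ∀ t ∈ Ioo a b, 0 ≤ q t) {f : ℝ → ℝ} :
    Integrable f (priorMeasure q a b) ↔ IntegrableOn (fun t => q t * f t) (Ioo a b) := by
  rw [priorMeasure, integrable_withDensity_iff_integrable_smul₀' hq.ennreal_ofReal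
    (ae_of_all _ fun _ => ENNReal.ofReal_lt_top)]
  refine integrableOn_congr_fun (fun t ht => ?_) measurableSet_Ioo
  simp only [ENNReal.toReal_ofReal (hq0 t ht), smul_eq_mul]

lemma ae_mem_priorMeasure : ∀ᵐ t ∂(priorMeasure q a b), t ∈ Ioo a b :=
  (withDensity_absolutelyContinuous _ _).ae_le (ae_restrict_mem measurableSet_Ioo)

end Prior

lemma ofReal_integral_le_lintegral_ofReal {Ω : Type*} [MeasurableSpace Ω] {m : Measure Ω}
    {f : Ω → ℝ} (hf : 0 ≤ᵐ[m] f) :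
    ENNReal.ofReal (∫ x, f x ∂m) ≤ ∫⁻ x, ENNReal.ofReal (f x) ∂m := by
  by_cases h : Integrable f m
  · exact (ofReal_integral_eq_lintegral_ofReal h hf).le
  · rw [integral_undef h, ENNReal.ofReal_zero]
    exact zero_le

lemma abs_clip_sub_clip_le {M : ℝ} (x y : ℝ) :
    |max (-M) (min M x) - max (-M) (min M y)| ≤ |x - y| := by
  refine (abs_max_sub_max_le_max _ _ _ _).trans (max_le (by simp) ?_)
  exact (abs_min_sub_min_le_max _ _ _ _).trans (max_le (by simp) le_rfl)

namespace ParamPath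
variable {X : Type*} [MeasurableSpace X] {ν : Measure X}

lemma ofReal_mean_sample_le [SigmaFinite ν] (p : ParamPath ν) (n : ℕ) {W : (Fin n → X) → ℝ}
    (hW : ∀ x, 0 ≤ W x) (t : ℝ) :
    ENNReal.ofReal ((p.sample n).mean W t) ≤
      ∫⁻ x, ENNReal.ofReal (W x) ∂(p.sampleLaw n t) := by
  refine (ofReal_integral_le_lintegral_ofReal
    (ae_of_all _ fun x => mul_nonneg (hW x) ((p.sample n).dens_nonneg t x))).trans (le_of_eq ?_)
  have hd := ((p.sample n).measurable_dens_right t).ennreal_ofReal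
  rw [sampleLaw_eq]
  change _ = ∫⁻ x, _ ∂((Measure.pi fun _ : Fin n => ν).withDensity _)
  rw [lintegral_withDensity_eq_lintegral_mul_non_measurable _ hd
    (ae_of_all _ fun _ => ENNReal.ofReal_lt_top)]
  refine lintegral_congr fun x => ?_
  rw [Pi.mul_apply, mul_comm (W x), ENNReal.ofReal_mul ((p.sample n).dens_nonneg t x)]

/-- The van Trees inequality. -/
theorem vanTrees [SigmaFinite ν] (p : ParamPath ν) (n : ℕ) {a b : ℝ} (hab : a < b)
    (hd : ∀ t ∈ Ioo a b, DifferentiableAt ℝ p.root t)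
    {T : (Fin n → X) → ℝ} (hT : Measurable T) {φ q : ℝ → ℝ} (hφ : LocallyAC φ a b)
    (hq : IsNicePrior p φ q a b) :
    ENNReal.ofReal ((∫ t, deriv φ t ∂(priorMeasure q a b)) ^ 2) ≤
      (∫⁻ t, ∫⁻ x, ENNReal.ofReal ((T x - φ t) ^ 2) ∂(p.sampleLaw n t) ∂(priorMeasure q a b)) *
        (priorInfo q a b +
          n * ∫⁻ t, ENNReal.ofReal (p.fisherInfo t) ∂(priorMeasure q a b)) := by
  have hqm : AEMeasurable q (volume.restrict (Ioo a b)) :=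
    hq.ac.continuousOn.aemeasurable measurableSet_Ioo
  have hq0 := hq.nonneg
  have hφi := (integrable_priorMeasure_iff hqm hq0).1 hq.integrable_deriv
  have hJm : AEMeasurable (fun t => if 0 < q t then deriv q t ^ 2 / q t else 0)
      (volume.restrict (Ioo a b)) := by
    have h1 : AEMeasurable (fun t => deriv q t ^ 2 / q t) (volume.restrict (Ioo a b)) :=
      ((measurable_deriv q).pow_const 2).aemeasurable.div hqm
    refine h1.congr ?_
    filter_upwards [ae_restrict_mem measurableSet_Ioo] with t ht
    split_ifs with h
    · rfl
    · rw [le_antisymm (not_lt.1 h) (hq0 t ht), div_zero]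
  have hJ0 : ∀ t, 0 ≤ if 0 < q t then deriv q t ^ 2 / q t else 0 := by
    intro t
    split_ifs with h
    · exact div_nonneg (sq_nonneg _) h.le
    · exact le_rfl
  have hJe : priorInfo q a b =
      ∫⁻ t in Ioo a b, ENNReal.ofReal (if 0 < q t then deriv q t ^ 2 / q t else 0) := by
    refine lintegral_congr fun t => ?_
    split_ifs <;> simp
  have hJ : IntegrableOn (fun t => if 0 < q t then deriv q t ^ 2 / q t else 0) (Ioo a b) := by
    refine ⟨hJm.aestronglyMeasurable, ?_⟩
    rw [hasFiniteIntegral_iff_ofReal (ae_of_all _ hJ0), ← hJe]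
    exact hq.info_lt_top
  have hIi : Integrable p.fisherInfo (priorMeasure q a b) := by
    refine ⟨(p.aemeasurable_fisherInfo _).aestronglyMeasurable, ?_⟩
    rw [hasFiniteIntegral_iff_ofReal (ae_of_all _ p.fisherInfo_nonneg)]
    exact hq.integrable_info
  have hI := (integrable_priorMeasure_iff hqm hq0).1 hIi
  have hK : ENNReal.ofReal (∫ t in Ioo a b, ((if 0 < q t then deriv q t ^ 2 / q t else 0) +
      n * (q t * p.fisherInfo t))) = priorInfo q a b +
        n * ∫⁻ t, ENNReal.ofReal (p.fisherInfo t) ∂(priorMeasure q a b) := by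
    rw [integral_add hJ (hI.const_mul _), integral_const_mul,
      ← integral_priorMeasure hqm hq0, ENNReal.ofReal_add (integral_nonneg hJ0)
        (mul_nonneg (Nat.cast_nonneg n) (integral_nonneg p.fisherInfo_nonneg)),
      ENNReal.ofReal_mul (Nat.cast_nonneg n), ENNReal.ofReal_natCast,
      ofReal_integral_eq_lintegral_ofReal hIi (ae_of_all _ p.fisherInfo_nonneg), hJe,
      ofReal_integral_eq_lintegral_ofReal hJ (ae_of_all _ hJ0)]
  rw [integral_priorMeasure hqm hq0, ← hK]
  -- Estimator and functional are both truncated at level M. Truncation is a contraction, so it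
  -- increases neither the risk nor |φ'|, and dominated convergence recovers ∫φ' dQ as M → ∞.
  set clip : ℕ → ℝ → ℝ := fun M x => max (-(M : ℝ)) (min M x) with hclip
  have hcM : ∀ M x, |clip M x| ≤ M := fun M x => abs_le.2
    ⟨le_max_left _ _, max_le (by linarith [Nat.cast_nonneg (α := ℝ) M]) (min_le_left _ _)⟩
  have hcl : ∀ M x y, |clip M x - clip M y| ≤ |x - y| := fun M => abs_clip_sub_clip_le
  have hcm : ∀ M, Measurable (clip M) := fun M =>
    measurable_const.max (measurable_const.min measurable_id)
  have hφd := hφ.ae_differentiableAt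
  have hlim : Tendsto (fun M : ℕ => ∫ t in Ioo a b, q t * deriv (fun s => clip M (φ s)) t) atTop
      (𝓝 (∫ t in Ioo a b, q t * deriv φ t)) := by
    refine tendsto_integral_of_dominated_convergence (fun t => ‖q t * deriv φ t‖)
      (fun M => hqm.mul (measurable_deriv _).aemeasurable |>.aestronglyMeasurable) hφi.norm
      (fun M => ?_) ?_
    · filter_upwards [hφd] with t ht
      rw [norm_mul, norm_mul]
      exact mul_le_mul_of_nonneg_left
        (abs_deriv_le_of_abs_sub_le ht (Eventually.of_forall fun s => hcl M _ _)) (norm_nonneg _)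
    · filter_upwards [hφd] with t ht
      refine tendsto_const_nhds.congr' ?_
      obtain ⟨N, hN⟩ := exists_nat_gt |φ t|
      filter_upwards [eventually_ge_atTop N] with M hM
      have h1 : |φ t| < M := hN.trans_le (by exact_mod_cast hM)
      have h2 : φ =ᶠ[𝓝 t] fun s => clip M (φ s) := by
        filter_upwards [ht.continuousAt.abs.eventually (gt_mem_nhds h1)] with s hs
        rw [abs_lt] at hs
        rw [hclip]
        simp only
        rw [min_eq_right hs.2.le, max_eq_right hs.1.le]
      rw [h2.deriv_eq]
  refine le_of_tendsto' ((ENNReal.continuous_ofReal.tendsto _).comp (hlim.pow 2)) fun M => ?_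
  have hdle : ∀ᵐ t ∂(volume.restrict (Ioo a b)),
      ‖q t * deriv (fun s => clip M (φ s)) t‖ ≤ ‖q t * deriv φ t‖ := by
    filter_upwards [hφd] with t ht
    rw [norm_mul, norm_mul]
    exact mul_le_mul_of_nonneg_left
      (abs_deriv_le_of_abs_sub_le ht (Eventually.of_forall fun s => hcl M _ _)) (norm_nonneg _)
  have hb := p.vanTrees_of_bounded n hab hd (T := fun x => clip M (T x)) ((hcm M).comp hT)
    (fun x => hcM M (T x)) (φ := fun s => clip M (φ s))
    (hφ.of_dist_le fun x _ y _ => by rw [Real.dist_eq, Real.dist_eq]; exact hcl M _ _)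
    (fun t _ => hcM M (φ t)) hq.ac hq0 hq.tendsto_left hq.tendsto_right
    (hφi.norm.mono' (hqm.mul (measurable_deriv _).aemeasurable).aestronglyMeasurable hdle) hJ hI
  have hE0 : ∀ t, 0 ≤ (p.sample n).mean (fun x => (clip M (T x) - clip M (φ t)) ^ 2) t := fun t =>
    integral_nonneg fun x => mul_nonneg (sq_nonneg _) ((p.sample n).dens_nonneg t x)
  refine (ENNReal.ofReal_le_ofReal hb).trans ?_
  rw [ENNReal.ofReal_mul (setIntegral_nonneg measurableSet_Ioo
    fun t ht => mul_nonneg (hq0 t ht) (hE0 t))]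
  refine mul_le_mul_left ?_ _
  refine (ofReal_integral_le_lintegral_ofReal ?_).trans ?_
  · filter_upwards [ae_restrict_mem measurableSet_Ioo] with t ht
    exact mul_nonneg (hq0 t ht) (hE0 t)
  rw [lintegral_priorMeasure hqm]
  refine setLIntegral_mono' measurableSet_Ioo fun t ht => ?_
  rw [ENNReal.ofReal_mul (hq0 t ht)]
  refine mul_le_mul_right ?_ _
  refine (p.ofReal_mean_sample_le n (fun x => sq_nonneg _) t).trans ?_
  refine lintegral_mono fun x => ENNReal.ofReal_le_ofReal ?_
  exact sq_le_sq.2 (hcl M _ _)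

end ParamPath

lemma lintegral_add_sq_le {Ω : Type*} [MeasurableSpace Ω] {m : Measure Ω} {f g : Ω → ℝ}
    (hf : AEStronglyMeasurable f m) (hg : AEStronglyMeasurable g m)
    (hf2 : ∫⁻ x, ENNReal.ofReal (f x ^ 2) ∂m ≠ ∞) (hg2 : ∫⁻ x, ENNReal.ofReal (g x ^ 2) ∂m ≠ ∞) :
    ∫⁻ x, ENNReal.ofReal ((f x + g x) ^ 2) ∂m ≤
      ENNReal.ofReal ((√(∫⁻ x, ENNReal.ofReal (f x ^ 2) ∂m).toReal +
        √(∫⁻ x, ENNReal.ofReal (g x ^ 2) ∂m).toReal) ^ 2) := by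
  have mf := memLp_two_of_lintegral_sq_lt_top hf hf2.lt_top
  have mg := memLp_two_of_lintegral_sq_lt_top hg hg2.lt_top
  have h := lintegral_sq_eq_ofReal (mf.add mg)
  simp only [Pi.add_apply] at h
  rw [h, lintegral_sq_eq_ofReal mf, lintegral_sq_eq_ofReal mg,
    ENNReal.toReal_ofReal (integral_nonneg fun _ => sq_nonneg _),
    ENNReal.toReal_ofReal (integral_nonneg fun _ => sq_nonneg _)]
  exact ENNReal.ofReal_le_ofReal (integral_add_sq_le mf mg)

/-! ### Validity of the bound by approximating functionals -/

section FiniteSample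
variable {X : Type*} [MeasurableSpace X] {ν : Measure X} [SigmaFinite ν]
  {ψ : ProbabilityMeasure X → ℝ}

/-- The van Trees inequality bounds the Bayes risk of T as an estimator of φ from below. Minkowski
at each t bounds the risk at t by (√R + |ψ(P_t) - φ(t)|)², and Minkowski under the prior then gives
√R plus the L²(Q) distance of ψ and φ. -/
lemma approxBound_le_localMinimaxRisk (p : ParamPath ν) (hψm : Measurable fun t => ψ (p.law t))
    {n : ℕ} {c : ℝ} (hn : 0 < n) (hc : 0 < c) :
    approxBound ψ p n c ≤ localMinimaxRisk ψ p n c := by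
  refine iSup_le fun hd => iSup_le fun φ => iSup_le fun q => iSup_le fun hφ => iSup_le fun hq => ?_
  refine le_iInf fun T => le_iInf fun hT => ?_
  have hab : -(c / √(n : ℝ)) < c / √(n : ℝ) := by
    have : 0 < c / √(n : ℝ) := by positivity
    linarith
  set R := ⨆ t ∈ localSet n c, ∫⁻ x, ENNReal.ofReal ((T x - ψ (p.law t)) ^ 2) ∂(p.sampleLaw n t)
    with hR
  have hprob : IsProbabilityMeasure (priorMeasure q (-(c / √(n : ℝ))) (c / √(n : ℝ))) := ⟨hq.prob⟩
  have hφm : AEMeasurable φ (priorMeasure q (-(c / √(n : ℝ))) (c / √(n : ℝ))) :=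
    hq.integrable_fun.1.aemeasurable
  refine sq_rpow_half_sub_le fun hRt hYt => ?_
  have hvt := p.vanTrees n hab
    (fun t ht => (p.hellingerDifferentiableAt_iff t).1 (hd t ht)) hT hφ hq
  refine (ENNReal.div_le_of_le_mul hvt).trans ?_
  have hstep : ∀ t ∈ localSet n c, ∫⁻ x, ENNReal.ofReal ((T x - φ t) ^ 2) ∂(p.sampleLaw n t) ≤
      ENNReal.ofReal ((√R.toReal + |ψ (p.law t) - φ t|) ^ 2) := by
    intro t ht
    have hrt : ∫⁻ x, ENNReal.ofReal ((T x - ψ (p.law t)) ^ 2) ∂(p.sampleLaw n t) ≤ R :=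
      le_iSup₂ (f := fun t (_ : t ∈ localSet n c) =>
        ∫⁻ x, ENNReal.ofReal ((T x - ψ (p.law t)) ^ 2) ∂(p.sampleLaw n t)) t ht
    have hpr : IsProbabilityMeasure (p.sampleLaw n t) := by
      rw [ParamPath.sampleLaw]; infer_instance
    have h := lintegral_add_sq_le (m := p.sampleLaw n t) (f := fun x => T x - ψ (p.law t))
      (g := fun _ => ψ (p.law t) - φ t) (hT.sub_const _).aestronglyMeasurable
      aestronglyMeasurable_const (hrt.trans_lt hRt.lt_top).ne (by simp)
    simp only [sub_add_sub_cancel, lintegral_const, measure_univ, mul_one] at h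
    refine h.trans (ENNReal.ofReal_le_ofReal (pow_le_pow_left₀ (by positivity) ?_ 2))
    rw [ENNReal.toReal_ofReal (sq_nonneg _), Real.sqrt_sq_eq_abs]
    gcongr
  refine (lintegral_mono_ae ((ae_mem_priorMeasure).mono hstep)).trans ?_
  have h := lintegral_add_sq_le (m := priorMeasure q (-(c / √(n : ℝ))) (c / √(n : ℝ)))
    (f := fun _ => √R.toReal) (g := fun t => |ψ (p.law t) - φ t|) aestronglyMeasurable_const
    (hψm.aemeasurable.sub hφm).abs.aestronglyMeasurable (by simp) (by simpa only [sq_abs] using hYt)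
  simp only [sq_abs, lintegral_const, measure_univ, mul_one] at h
  rwa [ENNReal.toReal_ofReal (sq_nonneg _), Real.sqrt_sq_eq_abs,
    abs_of_nonneg (Real.sqrt_nonneg _)] at h

end FiniteSample

/-! ### Asymptotics of the bound by approximating functionals -/

/-- The biweight density on `(-r, r)`. -/
def biweight (r t : ℝ) : ℝ := 15 / (16 * r) * (1 - (t / r) ^ 2) ^ 2

section Biweight
variable {r : ℝ}

lemma contDiff_biweight : ContDiff ℝ 1 (biweight r) := by
  unfold biweight
  fun_prop

lemma biweight_pos (hr : 0 < r) {t : ℝ} (ht : t ∈ Ioo (-r) r) : 0 < biweight r t := by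
  have h1 : |t / r| < 1 := by rw [abs_div, abs_of_pos hr, div_lt_one hr]; exact abs_lt.2 ht
  have h2 : 0 < 1 - (t / r) ^ 2 := by linarith [(sq_lt_one_iff_abs_lt_one _).2 h1]
  unfold biweight
  positivity

lemma deriv_biweight (hr : 0 < r) (t : ℝ) :
    deriv (biweight r) t = -(15 / (4 * r ^ 3) * (t * (1 - (t / r) ^ 2))) := by
  have h : HasDerivAt (biweight r) _ t :=
    (((((hasDerivAt_id' t).div_const r).pow 2).const_sub 1).pow 2).const_mul (15 / (16 * r))
  rw [h.deriv]
  simp only [Nat.cast_ofNat, Nat.add_one_sub_one, pow_one, Pi.pow_apply]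
  field_simp
  ring

lemma integral_biweight (hr : 0 < r) : ∫ t in Ioo (-r) r, biweight r t = 1 := by
  rw [← integral_Ioc_eq_integral_Ioo, ← intervalIntegral.integral_of_le (by linarith)]
  have e : ∀ t, biweight r t = 15 / (16 * r) -
      15 / (8 * r ^ 3) * t ^ 2 + 15 / (16 * r ^ 5) * t ^ 4 := by
    intro t; unfold biweight; field_simp; ring
  simp only [e]
  rw [intervalIntegral.integral_add (Continuous.intervalIntegrable (by fun_prop) _ _)
      (Continuous.intervalIntegrable (by fun_prop) _ _),
    intervalIntegral.integral_sub (Continuous.intervalIntegrable (by fun_prop) _ _)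
      (Continuous.intervalIntegrable (by fun_prop) _ _), intervalIntegral.integral_const,
    intervalIntegral.integral_const_mul, intervalIntegral.integral_const_mul, integral_pow,
    integral_pow, smul_eq_mul]
  field_simp
  ring

/-- The density is a multiple of the square of a quadratic polynomial, so q'²/q is just a multiple
of t². -/
lemma priorInfo_biweight (hr : 0 < r) :
    priorInfo (biweight r) (-r) r = ENNReal.ofReal (10 / r ^ 2) := by
  have h1 : priorInfo (biweight r) (-r) r =
      ∫⁻ t in Ioo (-r) r, ENNReal.ofReal (15 / r ^ 5 * t ^ 2) := by
    refine setLIntegral_congr_fun measurableSet_Ioo fun t ht => ?_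
    have hpos := biweight_pos hr ht
    rw [if_pos hpos, deriv_biweight hr]
    congr 1
    rw [div_eq_iff hpos.ne']
    unfold biweight
    field_simp
    ring
  have hc : Continuous fun t : ℝ => 15 / r ^ 5 * t ^ 2 := by fun_prop
  rw [h1, ← ofReal_integral_eq_lintegral_ofReal
    ((hc.integrableOn_Icc (a := -r) (b := r)).mono_set Ioo_subset_Icc_self)
    (ae_of_all _ fun t => by positivity), ← integral_Ioc_eq_integral_Ioo,
    ← intervalIntegral.integral_of_le (by linarith), intervalIntegral.integral_const_mul,
    integral_pow]
  congr 1
  field_simp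
  ring

lemma priorMeasure_biweight_univ (hr : 0 < r) : priorMeasure (biweight r) (-r) r univ = 1 := by
  rw [priorMeasure, withDensity_apply _ MeasurableSet.univ, Measure.restrict_univ,
    ← ofReal_integral_eq_lintegral_ofReal
      ((contDiff_biweight.continuous.integrableOn_Icc (a := -r) (b := r)).mono_set
        Ioo_subset_Icc_self) ?_, integral_biweight hr, ENNReal.ofReal_one]
  filter_upwards [ae_restrict_mem measurableSet_Ioo] with t ht
  exact (biweight_pos hr ht).le

end Biweight

section Asymp
variable {X : Type*} [MeasurableSpace X] {ν : Measure X} {ψ : ProbabilityMeasure X → ℝ}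
  {P₀ : ProbabilityMeasure X} {ψdot : X → ℝ}

lemma isNicePrior_biweight {p : ParamPath ν} {r m s J : ℝ} (hr : 0 < r)
    (hJ : ∀ t ∈ Ioo (-r) r, p.fisherInfo t ≤ J) :
    IsNicePrior p (fun t => m + s * t) (biweight r) (-r) r := by
  have hcont := (contDiff_biweight (r := r)).continuous
  have hprob : IsProbabilityMeasure (priorMeasure (biweight r) (-r) r) :=
    ⟨priorMeasure_biweight_univ hr⟩
  have hd : deriv (fun t : ℝ => m + s * t) = fun _ => s := by
    funext t
    simp
  have h0 : biweight r (-r) = 0 ∧ biweight r r = 0 := by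
    unfold biweight
    constructor <;> field_simp <;> ring
  refine ⟨fun t ht => (biweight_pos hr ht).le, priorMeasure_biweight_univ hr,
    fun x y _ _ _ => contDiff_biweight.contDiffOn.absolutelyContinuousOnInterval, ?_, ?_, ?_, ?_,
    ?_, ?_, ?_⟩
  · rw [priorInfo_biweight hr, ENNReal.ofReal_pos]; positivity
  · rw [priorInfo_biweight hr]; exact ENNReal.ofReal_lt_top
  · rw [integrable_priorMeasure_iff hcont.aemeasurable fun t ht => (biweight_pos hr ht).le]
    exact ((hcont.mul (by fun_prop)).integrableOn_Icc (a := -r) (b := r)).mono_set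
      Ioo_subset_Icc_self
  · rw [hd]; exact integrable_const s
  · refine (lintegral_mono_ae ((ae_mem_priorMeasure).mono fun t ht =>
      ENNReal.ofReal_le_ofReal (hJ t ht))).trans_lt ?_
    simp
  · exact ((hcont.tendsto _).mono_left nhdsWithin_le_nhds).trans (by rw [h0.1])
  · exact ((hcont.tendsto _).mono_left nhdsWithin_le_nhds).trans (by rw [h0.2])

/-- A lower bound on the value of the approximation bound for an affine approximation and the
biweight prior. -/
lemma le_mul_approxBound {p : ParamPath ν} {n : ℕ} (hn : 0 < n) {c s J δ : ℝ} (hc : 0 < c)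
    (hs : 0 ≤ s) (hJ0 : 0 < J) (hδ : 0 ≤ δ)
    (hd : ∀ t ∈ localSet n c, p.HellingerDifferentiableAt t)
    (hJ : ∀ t ∈ localSet n c, p.fisherInfo t ≤ J)
    (happ : ∀ t ∈ localSet n c, √(n : ℝ) * |ψ (p.law t) - ψ (p.law 0) - t * s| ≤ δ) :
    ENNReal.ofReal (s / √(10 / c ^ 2 + J) - δ) ^ 2 ≤ n * approxBound ψ p n c := by
  have hn' : (0 : ℝ) < n := by exact_mod_cast hn
  have hsn : 0 < √(n : ℝ) := Real.sqrt_pos.2 hn'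
  have hr : 0 < c / √(n : ℝ) := by positivity
  set r := c / √(n : ℝ) with hrdef
  set D := 10 / c ^ 2 + J with hD
  have hD0 : 0 < D := by positivity
  set φ : ℝ → ℝ := fun t => ψ (p.law 0) + s * t with hφ
  have hφAC : LocallyAC φ (-r) r := fun x y _ _ _ =>
    ContDiffOn.absolutelyContinuousOnInterval (by rw [hφ]; fun_prop)
  have hnice : IsNicePrior p φ (biweight r) (-r) r := isNicePrior_biweight hr hJ
  have hprob : IsProbabilityMeasure (priorMeasure (biweight r) (-r) r) := ⟨hnice.prob⟩
  have hle : approxValue ψ p n φ (biweight r) (-r) r ≤ approxBound ψ p n c :=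
    le_iSup_of_le hd (le_iSup_of_le φ (le_iSup_of_le (biweight r)
      (le_iSup_of_le hφAC (le_iSup_of_le hnice le_rfl))))
  refine le_trans ?_ (mul_le_mul_right hle _)
  have hI : ∫⁻ t, ENNReal.ofReal (p.fisherInfo t) ∂(priorMeasure (biweight r) (-r) r) ≤
      ENNReal.ofReal J := by
    refine (lintegral_mono_ae ((ae_mem_priorMeasure).mono fun t ht =>
      ENNReal.ofReal_le_ofReal (hJ t ht))).trans (le_of_eq ?_)
    simp
  have hY : ∫⁻ t, ENNReal.ofReal ((ψ (p.law t) - φ t) ^ 2) ∂(priorMeasure (biweight r) (-r) r) ≤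
      ENNReal.ofReal ((δ / √(n : ℝ)) ^ 2) := by
    refine (lintegral_mono_ae ((ae_mem_priorMeasure).mono fun t ht =>
      ENNReal.ofReal_le_ofReal (?_ : _ ≤ (δ / √(n : ℝ)) ^ 2))).trans (le_of_eq (by simp))
    rw [← sq_abs]
    refine pow_le_pow_left₀ (abs_nonneg _) ?_ 2
    rw [le_div_iff₀ hsn, mul_comm]
    have := happ t ht
    rwa [sub_sub, mul_comm t] at this
  -- With r = c/√n the prior information is 10n/c², on the same scale n as the information in the
  -- sample.
  have hden : priorInfo (biweight r) (-r) r +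
      n * ∫⁻ t, ENNReal.ofReal (p.fisherInfo t) ∂(priorMeasure (biweight r) (-r) r) ≤
      ENNReal.ofReal (n * D) := by
    have e : (n : ℝ) * D = 10 / r ^ 2 + n * J := by
      rw [hD, hrdef, div_pow, Real.sq_sqrt hn'.le]
      field_simp
    rw [e, ENNReal.ofReal_add (by positivity) (by positivity), priorInfo_biweight hr,
      ENNReal.ofReal_mul hn'.le, ENNReal.ofReal_natCast]
    exact add_le_add le_rfl (mul_le_mul_right hI _)
  have hnum : ∫ t, deriv φ t ∂(priorMeasure (biweight r) (-r) r) = s := by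
    have : deriv φ = fun _ => s := by
      funext t
      simp [hφ]
    rw [this]
    simp
  have sqrt_ofReal : ∀ z : ℝ, 0 ≤ z → ENNReal.ofReal (z ^ 2) ^ (1 / 2 : ℝ) = ENNReal.ofReal z := by
    intro z hz
    rw [ENNReal.ofReal_rpow_of_nonneg (sq_nonneg z) (by norm_num), ← Real.sqrt_eq_rpow,
      Real.sqrt_sq hz]
  have t1 : ENNReal.ofReal (s / (√(n : ℝ) * √D)) ≤ (ENNReal.ofReal (s ^ 2) /
      (priorInfo (biweight r) (-r) r + n * ∫⁻ t, ENNReal.ofReal (p.fisherInfo t)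
        ∂(priorMeasure (biweight r) (-r) r))) ^ (1 / 2 : ℝ) := by
    rw [← sqrt_ofReal _ (by positivity)]
    refine ENNReal.rpow_le_rpow ?_ (by norm_num)
    refine le_trans (le_of_eq ?_) (ENNReal.div_le_div_left hden _)
    rw [← ENNReal.ofReal_div_of_pos (by positivity), div_pow, mul_pow, Real.sq_sqrt hn'.le,
      Real.sq_sqrt hD0.le]
  have t2 := ENNReal.rpow_le_rpow hY (show (0 : ℝ) ≤ 1 / 2 by norm_num)
  rw [sqrt_ofReal _ (by positivity)] at t2
  rw [approxValue, hnum]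
  refine le_trans (le_of_eq ?_) (mul_le_mul_right (pow_le_pow_left' (tsub_le_tsub t1 t2) 2) _)
  rw [← ENNReal.ofReal_sub _ (by positivity), ← ENNReal.ofReal_natCast, ← Real.sq_sqrt hn'.le,
    ENNReal.ofReal_pow hsn.le, ← mul_pow, ← ENNReal.ofReal_mul hsn.le]
  congr 2
  rw [Real.sqrt_sq hsn.le]
  field_simp

lemma IsQMDPath.fisherInfo_zero {g : X → ℝ} {p : ParamPath ν} (hp : IsQMDPath P₀ g p) :
    p.fisherInfo 0 = ∫ x, g x ^ 2 ∂(P₀ : Measure X) := by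
  obtain ⟨ζ, hζ, hζn⟩ := hp.exists_hasDerivAt
  rw [p.fisherInfo_eq, hζ.deriv, show 4 * ‖ζ‖ ^ 2 = (2 * ‖ζ‖) ^ 2 by ring, hζn,
    Real.sq_sqrt (integral_nonneg fun x => sq_nonneg _)]

/-- Along the score ψdot, ψ is approximated by its tangent with slope v = ∫ψdot² dP₀, with error
δ/√n on the local set. Continuity keeps the information below v + δ there. Letting c → ∞ removes the
prior information, and then δ → 0. -/
lemma le_asymptotic_approxBound (hψ : HasEfficientInfluenceFunction ν ψ P₀ ψdot)
    {p : ParamPath ν} (hp : IsQMDPath P₀ ψdot p)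
    (hdiff : ∀ᶠ t in 𝓝 (0 : ℝ), p.HellingerDifferentiableAt t)
    (hI : ContinuousAt p.fisherInfo 0) :
    ENNReal.ofReal (∫ x, ψdot x ^ 2 ∂(P₀ : Measure X)) ≤
      liminf (fun c : ℝ => liminf (fun n : ℕ => (n : ℝ≥0∞) * approxBound ψ p n c) atTop)
        atTop := by
  have hd := hψ.hasDerivAt hψ.tangent hp
  have hI0 := hp.fisherInfo_zero
  set v := ∫ x, ψdot x ^ 2 ∂(P₀ : Measure X) with hv
  have hv0 : 0 ≤ v := integral_nonneg fun x => sq_nonneg _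
  have hb : ∫ x, ψdot x * hψ.tangent.1 x ∂(P₀ : Measure X) = v := by
    rw [hv]; simp only [HasEfficientInfluenceFunction.tangent, sq]
  rw [hb] at hd
  rcases eq_or_lt_of_le hv0 with h0 | hvpos
  · rw [← h0]; simp
  have hlim : Tendsto (fun δ : ℝ => ENNReal.ofReal (v / √(v + δ) - δ) ^ 2)
      (𝓝[>] 0) (𝓝 (ENNReal.ofReal v)) := by
    have h1 : ContinuousAt (fun δ : ℝ => v / √(v + δ) - δ) 0 := by
      refine ContinuousAt.sub (ContinuousAt.div (by fun_prop) (by fun_prop) ?_) (by fun_prop)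
      simpa using (Real.sqrt_pos.2 hvpos).ne'
    have h2 := ((ENNReal.continuous_pow 2).tendsto _).comp (ENNReal.tendsto_ofReal h1.tendsto)
    refine (h2.mono_left nhdsWithin_le_nhds).trans (le_of_eq ?_)
    rw [add_zero, sub_zero, ← ENNReal.ofReal_pow (by positivity), Real.div_sqrt,
      Real.sq_sqrt hv0]
  refine le_of_tendsto hlim ?_
  filter_upwards [self_mem_nhdsWithin] with δ hδ
  have hδ : 0 < δ := hδ
  have hl : Tendsto (fun c : ℝ => ENNReal.ofReal (v / √(10 / c ^ 2 + (v + δ)) - δ) ^ 2) atTop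
      (𝓝 (ENNReal.ofReal (v / √(v + δ) - δ) ^ 2)) := by
    refine ((ENNReal.continuous_pow 2).tendsto _).comp (ENNReal.tendsto_ofReal ?_)
    have h1 : Tendsto (fun c : ℝ => 10 / c ^ 2) atTop (𝓝 0) :=
      tendsto_const_nhds.div_atTop (tendsto_pow_atTop two_ne_zero)
    have h2 := ((h1.add_const (v + δ)).sqrt)
    rw [zero_add] at h2
    exact (tendsto_const_nhds.div h2 (Real.sqrt_pos.2 (by positivity)).ne').sub_const δ
  rw [← hl.liminf_eq]
  refine liminf_le_liminf ?_
  filter_upwards [eventually_gt_atTop 0] with c hc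
  refine le_liminf_of_le (by isBoundedDefault) ?_
  have hI' : ∀ᶠ t in 𝓝 (0 : ℝ), p.fisherInfo t ≤ v + δ :=
    (hI.eventually (gt_mem_nhds (show p.fisherInfo 0 < v + δ by rw [hI0]; linarith))).mono
      fun _ h => h.le
  filter_upwards [eventually_gt_atTop 0, eventually_forall_localSet hdiff c,
    eventually_forall_localSet hI' c, eventually_sqrt_mul_norm_sub_le hd hc hδ] with n hn h1 h2 h3
  have hn' : (0 : ℝ) < n := by exact_mod_cast hn
  refine le_mul_approxBound hn hc hv0 (by positivity) hδ.le h1 h2 fun t ht => ?_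
  have := h3 t ht 0 (mem_localSet.2 (by rw [abs_zero]; positivity))
  simpa [Real.norm_eq_abs] using this

end Asymp

end SEB

end

/-! ### The four efficiency bounds -/

theorem mainTheorem4 {X : Type*} [MeasurableSpace X] (ν : Measure X) [SigmaFinite ν]
    (ψ : ProbabilityMeasure X → ℝ) (P₀ : ProbabilityMeasure X) (ψdot : X → ℝ)
    (hψ : SEB.HasEfficientInfluenceFunction ν ψ P₀ ψdot) :
    -- (i) approximation by absolutely continuous functionals
    (∀ P : SEB.TangentSpace P₀ → SEB.ParamPath ν,
      (∀ g, SEB.IsQMDPath P₀ g.1 (P g)) →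
      (∀ g, Measurable fun t => ψ ((P g).law t)) →
      (∀ g, ∀ᶠ t in 𝓝 (0 : ℝ), (P g).HellingerDifferentiableAt t) →
      (∀ g, ContinuousAt (P g).fisherInfo 0) →
      SEB.YieldsBound ψ P SEB.approxBound
        (ENNReal.ofReal (∫ x, ψdot x ^ 2 ∂(P₀ : Measure X)))) ∧
    -- (ii) chi-squared mixture bound along the bounded paths
    (∀ (κ : ℝ → ℝ) (K : ℝ), (∀ s, 0 ≤ κ s) → Differentiable ℝ κ → Differentiable ℝ (deriv κ) →
      κ 0 = 1 → deriv κ 0 = 1 → (∀ s, |deriv κ s| ≤ K) → (∀ s, |deriv (deriv κ) s| ≤ K) →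
      ∀ P : SEB.TangentSpace P₀ → SEB.ParamPath ν,
      (∀ g, SEB.IsKappaPath κ P₀ g.1 (P g)) →
      (∀ g, Measurable fun t => ψ ((P g).law t)) →
      SEB.YieldsBound ψ P SEB.chiSqBound
        (ENNReal.ofReal (∫ x, ψdot x ^ 2 ∂(P₀ : Measure X)))) ∧
    -- (iii) Hellinger mixture bound
    (∀ P : SEB.TangentSpace P₀ → SEB.ParamPath ν,
      (∀ g, SEB.IsQMDPath P₀ g.1 (P g)) →
      (∀ g, Measurable fun t => ψ ((P g).law t)) →
      SEB.YieldsBound ψ P SEB.hellingerBound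
        (ENNReal.ofReal (∫ x, ψdot x ^ 2 ∂(P₀ : Measure X)))) ∧
    -- (iv) two-point Hellinger bound, with the exact constant it gives
    (∃ C : ℝ, |C - 0.28953| ≤ 0.000005 ∧
      IsLUB ((fun s : ℝ => (-(1 / 4) + 1 / 2 * Real.exp (-(s ^ 2) / 8)) * s ^ 2) '' Ici 0) C ∧
      ∀ P : SEB.TangentSpace P₀ → SEB.ParamPath ν,
      (∀ g, SEB.IsQMDPath P₀ g.1 (P g)) →
      SEB.YieldsBound ψ P SEB.twoPointBound
        (ENNReal.ofReal (C * ∫ x, ψdot x ^ 2 ∂(P₀ : Measure X))) ∧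
      SEB.asymptoticValue P (SEB.twoPointBound ψ) =
        ENNReal.ofReal (C * ∫ x, ψdot x ^ 2 ∂(P₀ : Measure X))) := by
  refine ⟨fun P hP hm hd hI => ?_, fun κ K hκ0 hκ hκ' h0 h01 h1 h2 P hP hm => ?_,
    fun P hP hm => ?_, ?_⟩
  · exact SEB.YieldsBound.of_le
      (fun g n c hn hc => SEB.approxBound_le_localMinimaxRisk (P g) (hm g) hn hc)
      (le_iSup_of_le hψ.tangent (SEB.le_asymptotic_approxBound hψ (hP hψ.tangent)
        (hd hψ.tangent) (hI hψ.tangent)))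
  · refine SEB.YieldsBound.of_le
      (fun g n c _ _ => SEB.chiSqBound_le_localMinimaxRisk (P g) (hm g) n c)
      (le_iSup_of_le hψ.tangent ((SEB.le_asymptotic_hellingerBound hψ
        (SEB.IsKappaPath.isQMDPath hκ0 hκ hκ' h0 h01 h1 h2 hψ.tangent (hP hψ.tangent))
        (hm hψ.tangent)).trans ?_))
    -- The chi-squared bound inherits the asymptotic value of the smaller Hellinger bound.
    refine liminf_le_liminf (Eventually.of_forall fun c => ?_)
    exact liminf_le_liminf (Eventually.of_forall fun n =>
      mul_le_mul_right (SEB.hellingerBound_le_chiSqBound _ n c) _)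
  · exact SEB.YieldsBound.of_le
      (fun g n c _ _ => (SEB.hellingerBound_le_chiSqBound (P g) n c).trans
        (SEB.chiSqBound_le_localMinimaxRisk (P g) (hm g) n c))
      (le_iSup_of_le hψ.tangent (SEB.le_asymptotic_hellingerBound hψ (hP hψ.tangent)
        (hm hψ.tangent)))
  · obtain ⟨C, hC, hlub⟩ := SEB.exists_isLUB_twoPointProfile
    refine ⟨C, hC, hlub, fun P hP => ?_⟩
    have hge := le_iSup_of_le (f := fun g : SEB.TangentSpace P₀ =>
      liminf (fun c : ℝ => liminf (fun n : ℕ => (n : ℝ≥0∞) * SEB.twoPointBound ψ (P g) n c) atTop)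
        atTop) hψ.tangent (SEB.le_asymptotic_twoPointBound hψ (hP hψ.tangent) hlub)
    refine ⟨SEB.YieldsBound.of_le
      (fun g n c _ _ => SEB.twoPointBound_le_localMinimaxRisk (P g) n c) hge,
      le_antisymm (iSup_le fun g => ?_) hge⟩
    exact SEB.asymptotic_twoPointBound_le hψ g (hP g)
      fun s hs => hlub.1 (mem_image_of_mem _ hs)
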